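/- Consider $\min_{x\in\mathbb{R}^{d_x}}\{\Phi(x)-\Psi(x)\}$ with $\Phi(x)=\max_{y\in\mathcal Y}\phi(x,y)$, $\Psi(x)=\max_{z\in\mathcal Z}\psi(x,z)$, where $\mathcal Y\subset\mathbb{R}^{d_y}$, $\mathcal Z\subset\mathbb{R}^{d_z}$ are nonempty, convex and compact. For $\gamma>0$ let $f_\gamma(x)=\min_u\{f(u)+\frac1{2\gamma}\|u-x\|^2\}$, $\mathrm{prox}_{\gamma f}(x)=\arg\min_u\{f(u)+\frac1{2\gamma}\|u-x\|^2\}$, $F_\gamma=\Phi_\gamma-\Psi_\gamma$, $y^*(x)=\arg\max_{y\in\mathcal Y}\phi(x,y)$, $z^*(x)=\arg\max_{z\in\mathcal Z}\psi(x,z)$. Let $\partial f(x)$ be the set of $v$ with $f(u)\ge f(x)+\langle v,u-x\rangle+o(\|u-x\|)$ as $u\to x$. Assume, with constants $\delta_\phi,\delta_\psi\ge0$ and $\mu_\phi,\mu_\psi,L_{\phi,yx},L_{\psi,zx},M>0$: (i) $\phi(\cdot,y)+\frac{\delta_\phi}2\|\cdot\|^2$ and $\psi(\cdot,z)+\frac{\delta_\psi}2\|\cdot\|^2$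 are convex for all $y\in\mathcal Y$, $z\in\mathcal Z$; (ii) $\phi(x,\cdot)$ is $\mu_\phi$-strongly concave on $\mathcal Y$ and $\psi(x,\cdot)$ is $\mu_\psi$-strongly concave on $\mathcal Z$; (iii) $\phi$ and $\psi$ are differentiable in $y\in\mathcal Y$ and $z\in\mathcal Z$, and $\nabla_y\phi(\cdot,y)$ and $\nabla_z\psi(\cdot,z)$ are $L_{\phi,yx}$- and $L_{\psi,zx}$-Lipschitz for all $y\in\mathcal Y$, $z\in\mathcal Z$; (iv) $F_\gamma(x)\ge F_\gamma^*$ for all $x$, for a real constant $F_\gamma^*$; (v) the stochastic oracles $\tilde\partial_x\phi,\tilde\nabla_y\phi,\tilde\partial_x\psi,\tilde\nabla_z\psi$ are unbiased estimators (of an element of $\partial_x\phi(x,y)$, of $\nabla_y\phi(x,y)$, of an element of $\partial_x\psi(x,z)$, of $\nabla_z\psi(x,z)$) with second moments at most $M^2$, for all $x\in\mathbb{R}^{d_x}$, $y\in\mathcal Y$, $z\in\mathcal Z$. From deterministic $x_0,x_\phi^0,x_\psi^0\in\mathbb{R}^{d_x}$, $y_0\in\mathcal Y$, $z_0\in\mathcal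 Z$, with a fresh independent sample in every iteration, SMAG iterates $$x_\phi^{t+1}=x_\phi^t-\eta_1\big(\tilde\partial_x\phi(x_\phi^t,y_t)+\tfrac1\gamma(x_\phi^t-x_t)\big),\qquad y_{t+1}=P_{\mathcal Y}\big(y_t+\eta_1\tilde\nabla_y\phi(x_\phi^t,y_t)\big),$$ $$x_\psi^{t+1}=x_\psi^t-\eta_1\big(\tilde\partial_x\psi(x_\psi^t,z_t)+\tfrac1\gamma(x_\psi^t-x_t)\big),\qquad z_{t+1}=P_{\mathcal Z}\big(z_t+\eta_1\tilde\nabla_z\psi(x_\psi^t,z_t)\big),$$ $$G_{t+1}=\tfrac1\gamma(x_t-x_\phi^{t+1})-\tfrac1\gamma(x_t-x_\psi^{t+1}),\qquad x_{t+1}=x_t-\eta_0G_{t+1}.$$ Let $\epsilon>0$, $0<\gamma<\min\{\delta_\phi^{-1},\delta_\psi^{-1}\}$ (with $0^{-1}=+\infty$), and $$\alpha=\min\Big\{\tfrac{1/\gamma-\delta_\phi}4,\tfrac{1/\gamma-\delta_\psi}4,\mu_\phi,\mu_\psi\Big\},\quad \tau=\min\Big\{\tfrac{\gamma^2\alpha^2}4,\tfrac{\mu_\phi^{1.5}\gamma^2\alpha^{1.5}}{4L_{\phi,yx}},\tfrac{\mu_\psi^{1.5}\gamma^2\alpha^{1.5}}{4L_{\psi,zx}}\Big\},$$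 $$\nu=\min\Big\{1,\tfrac{2\tau}{\gamma^2\alpha}\Big\},\quad L_F=\tfrac{2}{\gamma-\gamma^2\min\{\delta_\psi,\delta_\phi\}},$$ $$\eta_1=\min\Big\{\tfrac{\gamma^2(1/\gamma-\delta_\phi)}2,\tfrac{\gamma^2(1/\gamma-\delta_\psi)}2,\tfrac1{2L_F\tau},\tfrac{\min\{1,\gamma^2\}\min\{\alpha,\tau\}\nu\alpha}{768\tau M^2}\epsilon^2\Big\},\quad \eta_0=\tau\eta_1.$$ Put $$P_0=\tfrac{2\eta_0}{\eta_1\gamma^2\alpha}\,\mathbb E\Big[\|x_\phi^1-\mathrm{prox}_{\gamma\Phi}(x_0)\|^2+\|y_1-y^*(\mathrm{prox}_{\gamma\Phi}(x_0))\|^2+\|x_\psi^1-\mathrm{prox}_{\gamma\Psi}(x_0)\|^2+\|z_1-z^*(\mathrm{prox}_{\gamma\Psi}(x_0))\|^2\Big],$$ $$T_0=\tfrac{16(F_\gamma(x_0)-F_\gamma^*+P_0)}{\min\{1,\gamma^{-2}\}\min\{\alpha,\tau\}\nu\epsilon^2}\max\Big\{\tfrac2{\gamma^2(1/\gamma-\delta_\phi)},\tfrac2{\gamma^2(1/\gamma-\delta_\psi)},2L_F\tau,\tfrac{768\tau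 M^2}{\min\{1,\gamma^2\}\min\{\alpha,\tau\}\nu\alpha\epsilon^2}\Big\}.$$ Then $F_\gamma$ is differentiable. Moreover, there is a constant $C$, depending only on the problem, the constants above (including $\gamma$ and $F_\gamma^*$) and the initial points, such that $\eta_1\le C\epsilon^2$ for every $\epsilon>0$ and $T_0\le C\epsilon^{-4}$ whenever $\epsilon\le1$. For every integer $T\ge1$ with $T\ge T_0$, all expectations below are finite and $$\frac1T\sum_{t=0}^{T-1}\Big(\mathbb E\|x_\phi^{t+1}-\mathrm{prox}_{\gamma\Phi}(x_t)\|^2+\mathbb E\|x_\psi^{t+1}-\mathrm{prox}_{\gamma\Psi}(x_t)\|^2+\mathbb E\|\nabla F_\gamma(x_t)\|^2\Big)\le\min\{1,\gamma^{-2}\}\frac{\epsilon^2}4 .$$ If $\bar t$ is uniform on $\{1,\dots,T\}$ and independent of the samples, then $$\mathbb E\big[\|x_\phi^{\bar t}-\mathrm{prox}_{\gamma\Phi}(x_{\bar t-1})\|^2+\|x_\psi^{\bar t}-\mathrm{prox}_{\gamma\Psi}(x_{\bar t-1})\|^2+\|\nabla F_\gamma(x_{\bar t-1})\|^2\big]\le\min\{1,\gamma^{-2}\}\frac{\epsilon^2}4,$$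 and both $X=x_\phi^{\bar t}$ and $X=x_\psi^{\bar t}$ are nearly $\epsilon$-critical points: there are random vectors $v,x',x''$ with $v\in\partial\Phi(x')-\partial\Psi(x'')$ almost surely and $\max\{\mathbb E\|v\|,\mathbb E\|X-x'\|,\mathbb E\|X-x''\|\}\le\epsilon$. -/

import Mathlib

open MeasureTheory ProbabilityTheory Filter Topology

noncomputable section

namespace SMAG

/-- Euclidean space of dimension `n`. -/
abbrev Vec (n : ℕ) := EuclideanSpace ℝ (Fin n)

/-- `f` is `δ`-weakly convex: `f + (δ/2)‖·‖²` is convex. -/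
def WeaklyConvex {n : ℕ} (δ : ℝ) (f : Vec n → ℝ) : Prop :=
  ConvexOn ℝ Set.univ (fun x => f x + δ / 2 * ‖x‖ ^ 2)

/-- The subdifferential of `f` at `x`: all `v` with
`f y ≥ f x + ⟨v, y - x⟩ + o(‖y - x‖)` as `y → x`. -/
def subdifferential {n : ℕ} (f : Vec n → ℝ) (x : Vec n) : Set (Vec n) :=
  {v | ∀ c : ℝ, 0 < c → ∀ᶠ y in 𝓝 x, f x + inner ℝ v (y - x) - c * ‖y - x‖ ≤ f y}

/-- The Moreau envelope `f_γ(x) = min_u { f u + ‖u - x‖² / (2γ) }`. -/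
def moreauEnvelope {n : ℕ} (γ : ℝ) (f : Vec n → ℝ) (x : Vec n) : ℝ :=
  ⨅ u : Vec n, (f u + 1 / (2 * γ) * ‖u - x‖ ^ 2)

/-- The proximal point: a minimizer of `u ↦ f u + ‖u - x‖² / (2γ)`. -/
def prox {n : ℕ} (γ : ℝ) (f : Vec n → ℝ) (x : Vec n) : Vec n :=
  Classical.epsilon fun p => IsMinOn (fun u => f u + 1 / (2 * γ) * ‖u - x‖ ^ 2) Set.univ p

/-- The Euclidean projection of `u` onto `C`: a nearest point of `C`. -/
def proj {n : ℕ} (C : Set (Vec n)) (u : Vec n) : Vec n :=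
  Classical.epsilon fun p => p ∈ C ∧ IsMinOn (fun w => ‖u - w‖) C p

/-- The value function `x ↦ max_{y ∈ Y} f x y`. -/
def maxValue {m n : ℕ} (f : Vec m → Vec n → ℝ) (Y : Set (Vec n)) (x : Vec m) : ℝ :=
  sSup (f x '' Y)

/-- The maximizer `x ↦ argmax_{y ∈ Y} f x y`. -/
def argMax {m n : ℕ} (f : Vec m → Vec n → ℝ) (Y : Set (Vec n)) (x : Vec m) : Vec n :=
  Classical.epsilon fun y => y ∈ Y ∧ IsMaxOn (f x) Y y

/-- The data of a problem `min_x { max_{y ∈ Y} φ x y - max_{z ∈ Z} ψ x z }`. -/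
structure DMax (dx dy dz : ℕ) where
  φ : Vec dx → Vec dy → ℝ
  ψ : Vec dx → Vec dz → ℝ
  Y : Set (Vec dy)
  Z : Set (Vec dz)

namespace DMax

variable {dx dy dz : ℕ} (prob : DMax dx dy dz)

/-- `Φ(x) = max_{y ∈ Y} φ x y`. -/
def Φ : Vec dx → ℝ := maxValue prob.φ prob.Y

/-- `Ψ(x) = max_{z ∈ Z} ψ x z`. -/
def Ψ : Vec dx → ℝ := maxValue prob.ψ prob.Z

/-- The smoothed objective `F_γ = Φ_γ - Ψ_γ`. -/
def envF (γ : ℝ) (x : Vec dx) : ℝ :=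
  moreauEnvelope γ prob.Φ x - moreauEnvelope γ prob.Ψ x

end DMax

/-- The constants: smoothing parameter `γ`, weak convexity moduli `δ`, strong concavity moduli `μ`,
Lipschitz constants `L` of the partial gradients, and the bound `M` on the (sub)gradient noise. -/
structure Params where
  γ : ℝ
  δφ : ℝ
  δψ : ℝ
  μφ : ℝ
  μψ : ℝ
  Lφ : ℝ
  Lψ : ℝ
  M : ℝ

namespace Params

variable (p : Params)

def α : ℝ :=
  min (min ((1 / p.γ - p.δφ) / 4) ((1 / p.γ - p.δψ) / 4)) (min p.μφ p.μψ)

def τ : ℝ :=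
  min (p.γ ^ 2 * p.α ^ 2 / 4)
    (min (p.μφ ^ (1.5 : ℝ) * p.γ ^ 2 * p.α ^ (1.5 : ℝ) / (4 * p.Lφ))
      (p.μψ ^ (1.5 : ℝ) * p.γ ^ 2 * p.α ^ (1.5 : ℝ) / (4 * p.Lψ)))

def ν : ℝ := min 1 (2 * p.τ / (p.γ ^ 2 * p.α))

def LF : ℝ := 2 / (p.γ - p.γ ^ 2 * min p.δψ p.δφ)

/-- The step size of the proximal and dual variables. -/
def η₁ (ε : ℝ) : ℝ :=
  min (min (p.γ ^ 2 * (1 / p.γ - p.δφ) / 2) (p.γ ^ 2 * (1 / p.γ - p.δψ) / 2))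
    (min (1 / (2 * p.LF * p.τ))
      (min 1 (p.γ ^ 2) * min p.α p.τ * p.ν * p.α / (768 * p.τ * p.M ^ 2) * ε ^ 2))

/-- The step size of the primal variable. -/
def η₀ (ε : ℝ) : ℝ := p.τ * p.η₁ ε

end Params

/-- Structural assumptions on one component `max_{y ∈ Y} f x y`. -/
structure IsComponent {m n : ℕ} (f : Vec m → Vec n → ℝ) (Y : Set (Vec n)) (δ μ L : ℝ) : Prop where
  nonempty : Y.Nonempty
  convex : Convex ℝ Y
  compact : IsCompact Y
  δ_nonneg : 0 ≤ δ
  μ_pos : 0 < μ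
  L_pos : 0 < L
  weaklyConvex : ∀ y ∈ Y, WeaklyConvex δ (fun x => f x y)
  stronglyConcave : ∀ x, StrongConcaveOn Y μ (f x)
  differentiable : ∀ x, ∀ y ∈ Y, DifferentiableAt ℝ (f x) y
  gradient_lipschitz : ∀ y ∈ Y, ∀ x x',
    ‖gradient (f x) y - gradient (f x') y‖ ≤ L * ‖x - x'‖

/-- `gx`, `gy` are unbiased stochastic estimators, driven by a random sample of law `D`, of a
subgradient of `f · y` at `x` and of the gradient of `f x` at `y`, with second moments at most
`M ^ 2`. -/
structure IsOracle {m n : ℕ} {Ξ : Type*} [MeasurableSpace Ξ] (D : Measure Ξ)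
    (f : Vec m → Vec n → ℝ) (Y : Set (Vec n)) (M : ℝ)
    (gx : Vec m → Vec n → Ξ → Vec m) (gy : Vec m → Vec n → Ξ → Vec n) : Prop where
  measurable_gx : Measurable fun q : Vec m × Vec n × Ξ => gx q.1 q.2.1 q.2.2
  measurable_gy : Measurable fun q : Vec m × Vec n × Ξ => gy q.1 q.2.1 q.2.2
  memLp_gx : ∀ x, ∀ y ∈ Y, MemLp (gx x y) 2 D
  memLp_gy : ∀ x, ∀ y ∈ Y, MemLp (gy x y) 2 D
  unbiased_gx : ∀ x, ∀ y ∈ Y, ∫ s, gx x y s ∂D ∈ subdifferential (fun u => f u y) x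
  unbiased_gy : ∀ x, ∀ y ∈ Y, ∫ s, gy x y s ∂D = gradient (f x) y
  secondMoment_gx : ∀ x, ∀ y ∈ Y, ∫ s, ‖gx x y s‖ ^ 2 ∂D ≤ M ^ 2
  secondMoment_gy : ∀ x, ∀ y ∈ Y, ∫ s, ‖gy x y s‖ ^ 2 ∂D ≤ M ^ 2

/-- The four stochastic (sub)gradients; the last argument is the random sample. -/
structure Oracle (dx dy dz : ℕ) (Ξ : Type*) where
  gxφ : Vec dx → Vec dy → Ξ → Vec dx
  gyφ : Vec dx → Vec dy → Ξ → Vec dy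
  gxψ : Vec dx → Vec dz → Ξ → Vec dx
  gzψ : Vec dx → Vec dz → Ξ → Vec dz

/-- The variables maintained by the algorithm. -/
structure State (dx dy dz : ℕ) where
  x : Vec dx
  xφ : Vec dx
  xψ : Vec dx
  y : Vec dy
  z : Vec dz

section Algorithm

variable {dx dy dz : ℕ} {Ξ : Type*}

/-- One iteration of SMAG with sample `s`. -/
def step (prob : DMax dx dy dz) (γ η₀ η₁ : ℝ) (g : Oracle dx dy dz Ξ)
    (S : State dx dy dz) (s : Ξ) : State dx dy dz :=
  let xφ' := S.xφ - η₁ • (g.gxφ S.xφ S.y s + (1 / γ) • (S.xφ - S.x))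
  let y' := proj prob.Y (S.y + η₁ • g.gyφ S.xφ S.y s)
  let xψ' := S.xψ - η₁ • (g.gxψ S.xψ S.z s + (1 / γ) • (S.xψ - S.x))
  let z' := proj prob.Z (S.z + η₁ • g.gzψ S.xψ S.z s)
  let G := (1 / γ) • (S.x - xφ') - (1 / γ) • (S.x - xψ')
  { x := S.x - η₀ • G, xφ := xφ', xψ := xψ', y := y', z := z' }

/-- The iterates of SMAG from the initial state `S₀`, with the samples `ξ 0, ξ 1, …`. -/
def iter (prob : DMax dx dy dz) (γ η₀ η₁ : ℝ) (g : Oracle dx dy dz Ξ)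
    (S₀ : State dx dy dz) (ξ : ℕ → Ξ) : ℕ → State dx dy dz
  | 0 => S₀
  | t + 1 => step prob γ η₀ η₁ g (iter prob γ η₀ η₁ g S₀ ξ t) (ξ t)

end Algorithm

section Conclusions

variable {dx dy dz : ℕ} {Ω : Type*} [MeasurableSpace Ω]

/-- The random point `X` is a nearly `ε`-critical point of `Φ - Ψ`: there are random `v, x', x''`
with `v ∈ ∂Φ(x') - ∂Ψ(x'')` and `max {E‖v‖, E‖X - x'‖, E‖X - x''‖} ≤ ε`. -/
def NearlyCritical (prob : DMax dx dy dz) (P : Measure Ω) (ε : ℝ) (X : Ω → Vec dx) : Prop :=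
  ∃ v x' x'' : Ω → Vec dx,
    (∀ᵐ ω ∂P, ∃ a ∈ subdifferential prob.Φ (x' ω), ∃ b ∈ subdifferential prob.Ψ (x'' ω),
      v ω = a - b) ∧
    Integrable v P ∧ Integrable (fun ω => X ω - x' ω) P ∧ Integrable (fun ω => X ω - x'' ω) P ∧
    max (∫ ω, ‖v ω‖ ∂P) (max (∫ ω, ‖X ω - x' ω‖ ∂P) (∫ ω, ‖X ω - x'' ω‖ ∂P)) ≤ ε

/-- Squared error of `xφ` in the next state `S'` as an estimate of `prox_{γΦ}` at `x` of `S`. -/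
def errφ (prob : DMax dx dy dz) (γ : ℝ) (S S' : State dx dy dz) : ℝ :=
  ‖S'.xφ - prox γ prob.Φ S.x‖ ^ 2

/-- Squared error of `xψ` in the next state `S'` as an estimate of `prox_{γΨ}` at `x` of `S`. -/
def errψ (prob : DMax dx dy dz) (γ : ℝ) (S S' : State dx dy dz) : ℝ :=
  ‖S'.xψ - prox γ prob.Ψ S.x‖ ^ 2

/-- Squared gradient norm `‖∇F_γ(x)‖²` at the state `S`. -/
def gradSq (prob : DMax dx dy dz) (γ : ℝ) (S : State dx dy dz) : ℝ :=
  ‖gradient (prob.envF γ) S.x‖ ^ 2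

/-- The initial potential `P₀` of a random sequence of states `S`. -/
def initPotential (prob : DMax dx dy dz) (p : Params) (ε : ℝ) (P : Measure Ω)
    (S : ℕ → Ω → State dx dy dz) : ℝ :=
  2 * p.η₀ ε / (p.η₁ ε * p.γ ^ 2 * p.α) *
    ((∫ ω, errφ prob p.γ (S 0 ω) (S 1 ω) ∂P)
      + (∫ ω, ‖(S 1 ω).y - argMax prob.φ prob.Y (prox p.γ prob.Φ (S 0 ω).x)‖ ^ 2 ∂P)
      + (∫ ω, errψ prob p.γ (S 0 ω) (S 1 ω) ∂P)
      + (∫ ω, ‖(S 1 ω).z - argMax prob.ψ prob.Z (prox p.γ prob.Ψ (S 0 ω).x)‖ ^ 2 ∂P))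

/-- The iteration threshold, where `Δ` stands for `F_γ(x₀) - F_γ^* + P₀`. -/
def iterBound (p : Params) (ε Δ : ℝ) : ℝ :=
  16 * Δ / (min 1 ((p.γ ^ 2)⁻¹) * min p.α p.τ * p.ν * ε ^ 2) *
    max (max (2 / (p.γ ^ 2 * (1 / p.γ - p.δφ))) (2 / (p.γ ^ 2 * (1 / p.γ - p.δψ))))
      (max (2 * p.LF * p.τ)
        (768 * p.τ * p.M ^ 2 / (min 1 (p.γ ^ 2) * min p.α p.τ * p.ν * p.α * ε ^ 2)))

end Conclusions

end SMAG

end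

/-! Since `1/γ > δ`, the proximal objective of a `δ`-weakly convex function is strongly convex.
Hence proximal points exist and are Lipschitz in the centre, and the Moreau envelope lies between
two quadratics touching it at each point. So `F_γ` is differentiable with gradient `(prox_{γΨ} -
prox_{γΦ})/γ` and has a quadratic upper bound (`Regular.envF_le`). The direction `G` is this
gradient with the proximal points replaced by running estimates; SMAG is inexact gradient descent on
`F_γ`, and `Regular.envF_descent` charges the inexactness to the squared estimation errors.

The estimates follow a moving target. The pair (proximal point, its maximizer) is a saddle point of
`f u y + ‖u - x‖²/(2γ)` (`IsComponent.isMinOn_proxObj_argMax`), which is strongly convex in `u` and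
strongly concave in `y`. One stochastic descent-ascent step therefore contracts the expected squared
distance to it, up to noise of order `η₁² M²` (`IsOracle.stepDist_integral_le`). The term `(u -
x)/γ` is not bounded a priori; it is split at the proximal point, which lies within `γ M` of `x`.
When `x` moves, the saddle point moves Lipschitz-continuously, at a cost proportional to `‖x_{t+1} -
x_t‖²/η₁` (`IsComponent.potential_le`). The descent inequality leaves `-‖x_{t+1} - x_t‖²/(4η₀)`
unspent, which covers this cost once `τ = η₀/η₁` is small.

Thus `E F_γ(x_t)` plus `2η₀/(η₁γ²α)` times the expected squared distances is a Lyapunov function: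
each step lowers it by `η₀` times the gradient and estimation errors, up to noise
(`IsTrajectory.lyapunov_step`). Summation, the lower bound on `F_γ` and the choice of `η₁` and `T₀`
bound the average (`Regular.average_le`). For near criticality, `∇F_γ(x)` is itself a difference of
subgradients at the two proximal points, whose distance is `γ‖∇F_γ(x)‖` (`Regular.nearlyCritical`).
-/

noncomputable section

namespace SMAG

/-! ### Weak convexity, proximal points and Moreau envelopes. -/

section Prox

variable {n : ℕ} {f : Vec n → ℝ} {δ γ : ℝ}

/-- Let `t → 0⁺`. This closes variational arguments: perturb by `t`, divide by `t`, and an error `t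
* c` remains. -/
theorem le_of_forall_le_add_mul {a b c : ℝ} (h : ∀ t : ℝ, 0 < t → t < 1 → a ≤ b + t * c) :
    a ≤ b := by
  have hlim : Tendsto (fun t : ℝ => b + t * c) (𝓝[>] 0) (𝓝 (b + 0 * c)) := by
    apply Tendsto.mono_left _ nhdsWithin_le_nhds
    exact (by fun_prop : Continuous fun t : ℝ => b + t * c).tendsto 0
  have := ge_of_tendsto hlim (b := a) (by
    filter_upwards [Ioo_mem_nhdsGT (zero_lt_one' ℝ)] with t ht using h t ht.1 ht.2)
  simpa using this

/-- A strongly convex function grows quadratically away from a minimizer. -/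
theorem _root_.StrongConvexOn.add_sq_le_of_isMinOn {E : Type*} [NormedAddCommGroup E]
    [NormedSpace ℝ E] {s : Set E} {m : ℝ} {h : E → ℝ} (hh : StrongConvexOn s m h) {p u : E}
    (hp : p ∈ s) (hu : u ∈ s) (hmin : IsMinOn h s p) : h p + m / 2 * ‖p - u‖ ^ 2 ≤ h u := by
  apply le_of_forall_le_add_mul (c := m / 2 * ‖p - u‖ ^ 2)
  intro t ht0 ht1
  have h1 := hh.2 hp hu (sub_nonneg.2 ht1.le) ht0.le (by ring)
  have h2 : h p ≤ h ((1 - t) • p + t • u) :=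
    hmin (hh.1 hp hu (sub_nonneg.2 ht1.le) ht0.le (by ring))
  simp only [smul_eq_mul] at h1
  have h3 : t * (h p + m / 2 * ‖p - u‖ ^ 2) ≤ t * (h u + t * (m / 2 * ‖p - u‖ ^ 2)) := by
    nlinarith
  exact le_of_mul_le_mul_left h3 ht0

/-- Cancelling the quadratic leaves convexity with a defect. This form does not mention the origin,
so it combines with `‖u - x‖²` for any centre and survives pointwise maxima. -/
theorem WeaklyConvex.le_combo (hf : WeaklyConvex δ f) (x y : Vec n) {t : ℝ} (h0 : 0 ≤ t)
    (h1 : t ≤ 1) :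
    f (x + t • (y - x)) ≤ (1 - t) * f x + t * f y + δ / 2 * (t * (1 - t)) * ‖y - x‖ ^ 2 := by
  have h := hf.2 (Set.mem_univ x) (Set.mem_univ y) (sub_nonneg.2 h1) h0 (by ring)
  have e : (1 - t) • x + t • y = x + t • (y - x) := by module
  have e2 : ‖x + t • (y - x)‖ ^ 2
      = (1 - t) * ‖x‖ ^ 2 + t * ‖y‖ ^ 2 - t * (1 - t) * ‖y - x‖ ^ 2 := by
    simp only [← real_inner_self_eq_norm_sq, inner_add_left, inner_add_right, inner_sub_left,
      inner_sub_right, real_inner_smul_left, real_inner_smul_right, real_inner_comm x y]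
    ring
  simp only [smul_eq_mul, e, e2] at h
  nlinarith

theorem weaklyConvex_of_le_combo
    (hf : ∀ x y : Vec n, ∀ t : ℝ, 0 ≤ t → t ≤ 1 →
      f (x + t • (y - x)) ≤ (1 - t) * f x + t * f y + δ / 2 * (t * (1 - t)) * ‖y - x‖ ^ 2) :
    WeaklyConvex δ f := by
  refine ⟨convex_univ, fun x _ y _ a b ha hb hab => ?_⟩
  obtain rfl : a = 1 - b := by linarith
  have h := hf x y b hb (by linarith)
  have e : (1 - b) • x + b • y = x + b • (y - x) := by module
  have e2 : ‖x + b • (y - x)‖ ^ 2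
      = (1 - b) * ‖x‖ ^ 2 + b * ‖y‖ ^ 2 - b * (1 - b) * ‖y - x‖ ^ 2 := by
    simp only [← real_inner_self_eq_norm_sq, inner_add_left, inner_add_right, inner_sub_left,
      inner_sub_right, real_inner_smul_left, real_inner_smul_right, real_inner_comm x y]
    ring
  simp only [smul_eq_mul, e, e2]
  nlinarith

/-- Local subgradients of a weakly convex function give a global quadratic minorant. -/
theorem WeaklyConvex.le_of_mem_subdifferential (hf : WeaklyConvex δ f) {x v : Vec n}
    (hv : v ∈ subdifferential f x) (u : Vec n) :
    f x + inner ℝ v (u - x) - δ / 2 * ‖u - x‖ ^ 2 ≤ f u := by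
  apply le_of_forall_pos_lt_add
  intro e he
  -- The slope error is chosen so that it costs less than `e` at `u`; the `+ 1` covers `u = x`. The
  -- local inequality is then applied on the segment towards `u`, divided by `t`, and `t → 0⁺`.
  set c := e / (2 * (‖u - x‖ + 1)) with hc
  have hd : 0 < 2 * (‖u - x‖ + 1) := by positivity
  have hcpos : 0 < c := div_pos he hd
  have hce : c * ‖u - x‖ < e := by
    have : c * (2 * (‖u - x‖ + 1)) = e := by rw [hc]; field_simp
    nlinarith [norm_nonneg (u - x)]
  have ht : Tendsto (fun t : ℝ => x + t • (u - x)) (𝓝[>] 0) (𝓝 x) := by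
    apply Tendsto.mono_left _ nhdsWithin_le_nhds
    have := (by fun_prop : Continuous fun t : ℝ => x + t • (u - x)).tendsto 0
    simpa using this
  have hev := ht.eventually (hv c hcpos)
  have key : ∀ᶠ t : ℝ in 𝓝[>] 0, f x + inner ℝ v (u - x) - c * ‖u - x‖
      ≤ f u + δ / 2 * ((1 - t) * ‖u - x‖ ^ 2) := by
    filter_upwards [hev, Ioo_mem_nhdsGT (zero_lt_one' ℝ)] with t h1 ht
    have h2 := hf.le_combo x u ht.1.le ht.2.le
    rw [add_sub_cancel_left, real_inner_smul_right, norm_smul, Real.norm_eq_abs,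
      abs_of_pos ht.1] at h1
    have h3 : t * (f x + inner ℝ v (u - x) - c * ‖u - x‖)
        ≤ t * (f u + δ / 2 * ((1 - t) * ‖u - x‖ ^ 2)) := by nlinarith
    exact le_of_mul_le_mul_left h3 ht.1
  have hlim : Tendsto (fun t : ℝ => f u + δ / 2 * ((1 - t) * ‖u - x‖ ^ 2)) (𝓝[>] 0)
      (𝓝 (f u + δ / 2 * ((1 - 0) * ‖u - x‖ ^ 2))) := by
    apply Tendsto.mono_left _ nhdsWithin_le_nhds
    exact (by fun_prop : Continuous fun t : ℝ =>
      f u + δ / 2 * ((1 - t) * ‖u - x‖ ^ 2)).tendsto 0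
  have := ge_of_tendsto hlim key
  linarith

/-- The proximal objective `u ↦ f u + ‖u - x‖² / (2γ)`. -/
def proxObj (γ : ℝ) (f : Vec n → ℝ) (x u : Vec n) : ℝ := f u + 1 / (2 * γ) * ‖u - x‖ ^ 2

theorem WeaklyConvex.strongConvexOn_proxObj (hf : WeaklyConvex δ f) (hγ : 0 < γ) (x : Vec n) :
    StrongConvexOn Set.univ (1 / γ - δ) (proxObj γ f x) := by
  refine ⟨convex_univ, fun u _ w _ a b ha hb hab => ?_⟩
  obtain rfl : a = 1 - b := by linarith
  have h := hf.le_combo u w hb (by linarith)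
  have e : (1 - b) • u + b • w = u + b • (w - u) := by module
  have e2 : ‖u + b • (w - u) - x‖ ^ 2
      = (1 - b) * ‖u - x‖ ^ 2 + b * ‖w - x‖ ^ 2 - b * (1 - b) * ‖w - u‖ ^ 2 := by
    simp only [← real_inner_self_eq_norm_sq, inner_add_left, inner_add_right, inner_sub_left,
      inner_sub_right, real_inner_smul_left, real_inner_smul_right, real_inner_comm u w,
      real_inner_comm x u, real_inner_comm x w]
    ring
  simp only [smul_eq_mul, e, e2, proxObj, norm_sub_rev u w]
  have : (1 / γ - δ) / 2 = 1 / (2 * γ) - δ / 2 := by field_simp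
  rw [this]
  nlinarith

theorem WeaklyConvex.continuous (hf : WeaklyConvex δ f) : Continuous f := by
  have h := ConvexOn.continuousOn isOpen_univ hf
  rw [← continuousOn_univ]
  have h2 : ContinuousOn (fun x : Vec n => (f x + δ / 2 * ‖x‖ ^ 2) - δ / 2 * ‖x‖ ^ 2) Set.univ :=
    h.sub (by fun_prop)
  simpa using h2

/-- A continuous strongly convex function on a finite-dimensional space attains its minimum. -/
theorem exists_isMinOn_of_strongConvexOn {h : Vec n → ℝ} {m : ℝ} (hm : 0 < m)
    (hc : Continuous h) (hh : StrongConvexOn Set.univ m h) : ∃ p, IsMinOn h Set.univ p := by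
  obtain ⟨q, -, hq⟩ := (isCompact_closedBall (0 : Vec n) 1).exists_isMinOn
    ⟨0, by simp⟩ hc.continuousOn
  have hq0 : h q ≤ h 0 := hq (by simp)
  -- This radius makes the quadratic gain `m/2 * (r - 1)` exceed `h 0 - h q` for `r > R`, so no
  -- point outside the ball beats `0`.
  set R : ℝ := 1 + 2 * (h 0 - h q) / m with hR
  have hR1 : 1 ≤ R := by
    have : 0 ≤ 2 * (h 0 - h q) / m := div_nonneg (by linarith) hm.le
    linarith
  obtain ⟨p, -, hp⟩ := (isCompact_closedBall (0 : Vec n) R).exists_isMinOn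
    ⟨0, by simp; linarith⟩ hc.continuousOn
  refine ⟨p, fun u _ => ?_⟩
  by_cases hu : ‖u‖ ≤ R
  · exact hp (by simpa using hu)
  have hp0 : h p ≤ h 0 := hp (by simp; linarith)
  refine hp0.trans ?_
  set r := ‖u‖ with hr
  have hrR : R < r := not_le.1 hu
  have hr1 : 1 < r := by linarith
  have hr0 : 0 < r := by linarith
  have hr2 : 0 ≤ 1 - 1 / r := by rw [sub_nonneg, div_le_one hr0]; exact hr1.le
  -- Strong convexity on the segment from `0` to `u`, at the unit vector `u / ‖u‖`, where `h` is at
  -- least its minimum `h q` over the unit ball.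
  have h1 := hh.2 (Set.mem_univ (0 : Vec n)) (Set.mem_univ u) hr2 (one_div_pos.2 hr0).le
    (by ring)
  have h2 : h q ≤ h ((1 - 1 / r) • (0 : Vec n) + (1 / r) • u) := by
    apply hq
    simp only [smul_zero, zero_add, mem_closedBall_zero_iff, norm_smul, Real.norm_eq_abs]
    rw [abs_of_pos (by positivity), ← hr]
    field_simp
    exact le_rfl
  simp only [smul_eq_mul, zero_sub, norm_neg, ← hr] at h1
  have h3 := h2.trans h1
  have h4 : r * h q ≤ (r - 1) * h 0 + h u - (r - 1) * (m / 2 * r) := by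
    have := mul_le_mul_of_nonneg_left h3 hr0.le
    calc _ ≤ _ := this
      _ = _ := by field_simp
  have h5 : h 0 - h q ≤ m / 2 * (r - 1) := by
    have : 2 * (h 0 - h q) / m < r - 1 := by linarith
    rw [div_lt_iff₀ hm] at this
    linarith
  nlinarith

theorem one_div_sub_pos (hγ : 0 < γ) (hγδ : γ * δ < 1) : 0 < 1 / γ - δ := by
  rw [sub_pos, lt_div_iff₀ hγ]; linarith

theorem WeaklyConvex.isMinOn_prox (hf : WeaklyConvex δ f) (hγ : 0 < γ) (hγδ : γ * δ < 1)
    (x : Vec n) : IsMinOn (proxObj γ f x) Set.univ (prox γ f x) := by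
  have hcont := hf.continuous
  exact Classical.epsilon_spec (p := fun p =>
    IsMinOn (fun u => f u + 1 / (2 * γ) * ‖u - x‖ ^ 2) Set.univ p)
    (exists_isMinOn_of_strongConvexOn (one_div_sub_pos hγ hγδ)
    (by fun_prop) (hf.strongConvexOn_proxObj hγ x))

theorem WeaklyConvex.proxObj_prox_add_le (hf : WeaklyConvex δ f) (hγ : 0 < γ) (hγδ : γ * δ < 1)
    (x u : Vec n) :
    proxObj γ f x (prox γ f x) + (1 / γ - δ) / 2 * ‖prox γ f x - u‖ ^ 2 ≤ proxObj γ f x u :=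
  (hf.strongConvexOn_proxObj hγ x).add_sq_le_of_isMinOn (Set.mem_univ _) (Set.mem_univ _)
    (hf.isMinOn_prox hγ hγδ x)

theorem WeaklyConvex.moreauEnvelope_eq (hf : WeaklyConvex δ f) (hγ : 0 < γ) (hγδ : γ * δ < 1)
    (x : Vec n) : moreauEnvelope γ f x = proxObj γ f x (prox γ f x) := by
  have h := hf.isMinOn_prox hγ hγδ x
  apply le_antisymm
  · exact ciInf_le (f := fun u => proxObj γ f x u)
      ⟨proxObj γ f x (prox γ f x), by rintro _ ⟨u, rfl⟩; exact h (Set.mem_univ u)⟩ _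
  · exact le_ciInf fun u => h (Set.mem_univ u)

/-- Each proximal point competes in the other's problem. Adding the two quadratic growth
inequalities cancels `f` and leaves `γ(1/γ - δ)‖p - p'‖² ≤ ⟨p - p', x - x'⟩`. -/
theorem WeaklyConvex.norm_prox_sub_le (hf : WeaklyConvex δ f) (hγ : 0 < γ) (hγδ : γ * δ < 1)
    (x x' : Vec n) : γ * (1 / γ - δ) * ‖prox γ f x - prox γ f x'‖ ≤ ‖x - x'‖ := by
  set p := prox γ f x
  set p' := prox γ f x'
  have h1 := hf.proxObj_prox_add_le hγ hγδ x p'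
  have h2 := hf.proxObj_prox_add_le hγ hγδ x' p
  have hρ := one_div_sub_pos hγ hγδ
  have e : ‖p' - x‖ ^ 2 + ‖p - x'‖ ^ 2 - ‖p - x‖ ^ 2 - ‖p' - x'‖ ^ 2
      = 2 * inner ℝ (p - p') (x - x') := by
    simp only [← real_inner_self_eq_norm_sq, inner_sub_left,
      inner_sub_right, real_inner_comm p x, real_inner_comm p x', real_inner_comm p' x,
      real_inner_comm p' x']
    ring
  change proxObj γ f x p + _ ≤ _ at h1
  change proxObj γ f x' p' + (1 / γ - δ) / 2 * ‖p' - p‖ ^ 2 ≤ _ at h2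
  rw [norm_sub_rev p' p] at h2
  unfold proxObj at h1 h2
  have h3 : γ * (1 / γ - δ) * ‖p - p'‖ ^ 2 ≤ inner ℝ (p - p') (x - x') := by
    have : (1 / γ - δ) * ‖p - p'‖ ^ 2 ≤ 1 / (2 * γ) * (2 * inner ℝ (p - p') (x - x')) := by
      rw [← e]; linarith
    have := mul_le_mul_of_nonneg_left this hγ.le
    calc _ = _ := by ring
      _ ≤ _ := this
      _ = _ := by field_simp
  have h4 := real_inner_le_norm (p - p') (x - x')
  rcases (norm_nonneg (p - p')).eq_or_lt with h0 | h0
  · rw [← h0]; simp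
  · nlinarith

theorem WeaklyConvex.norm_prox_sub_sq_le (hf : WeaklyConvex δ f) (hγ : 0 < γ) (hγδ : γ * δ < 1)
    (x x' : Vec n) :
    ‖prox γ f x - prox γ f x'‖ ^ 2 ≤ ‖x - x'‖ ^ 2 / (γ * (1 / γ - δ)) ^ 2 := by
  have hk : 0 < γ * (1 / γ - δ) := mul_pos hγ (one_div_sub_pos hγ hγδ)
  rw [le_div_iff₀ (by positivity), ← mul_pow]
  apply pow_le_pow_left₀ (by positivity)
  rw [mul_comm]
  exact hf.norm_prox_sub_le hγ hγδ x x'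

theorem WeaklyConvex.continuous_prox (hf : WeaklyConvex δ f) (hγ : 0 < γ) (hγδ : γ * δ < 1) :
    Continuous (prox γ f) := by
  have hk : 0 < γ * (1 / γ - δ) := mul_pos hγ (one_div_sub_pos hγ hγδ)
  refine (LipschitzWith.of_dist_le_mul (K := (1 / (γ * (1 / γ - δ))).toNNReal)
    fun x x' => ?_).continuous
  rw [dist_eq_norm, dist_eq_norm, Real.coe_toNNReal _ (by positivity), one_div_mul_eq_div,
    le_div_iff₀ hk, mul_comm]
  exact hf.norm_prox_sub_le hγ hγδ x x'

/-- The proximal point of `x` is a competitor at `x'`; expanding the square around it gives exactly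
the right-hand side. -/
theorem WeaklyConvex.moreauEnvelope_le (hf : WeaklyConvex δ f) (hγ : 0 < γ) (hγδ : γ * δ < 1)
    (x x' : Vec n) : moreauEnvelope γ f x' ≤ moreauEnvelope γ f x
      + inner ℝ ((1 / γ) • (x - prox γ f x)) (x' - x) + 1 / (2 * γ) * ‖x' - x‖ ^ 2 := by
  rw [hf.moreauEnvelope_eq hγ hγδ, hf.moreauEnvelope_eq hγ hγδ]
  have h : proxObj γ f x' (prox γ f x') ≤ proxObj γ f x' (prox γ f x) :=
    hf.isMinOn_prox hγ hγδ x' (Set.mem_univ _)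
  refine h.trans (le_of_eq ?_)
  generalize prox γ f x = p
  have e : ‖p - x'‖ ^ 2 = ‖p - x‖ ^ 2 + 2 * inner ℝ (x - p) (x' - x) + ‖x' - x‖ ^ 2 := by
    simp only [← real_inner_self_eq_norm_sq, inner_sub_left,
      inner_sub_right, real_inner_comm p x, real_inner_comm p x', real_inner_comm x' x]
    ring
  rw [proxObj, proxObj, e, real_inner_smul_left]
  field_simp
  ring

/-- The upper bound with `x` and `x'` exchanged. Moving the base point of the gradient back to `x`
costs `⟨p' - p, x' - x⟩/γ`, controlled by the Lipschitz bound for proximal points. -/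
theorem WeaklyConvex.le_moreauEnvelope (hf : WeaklyConvex δ f) (hγ : 0 < γ) (hγδ : γ * δ < 1)
    (x x' : Vec n) : moreauEnvelope γ f x
      + inner ℝ ((1 / γ) • (x - prox γ f x)) (x' - x)
      - (1 / (γ ^ 2 * (1 / γ - δ)) - 1 / (2 * γ)) * ‖x' - x‖ ^ 2 ≤ moreauEnvelope γ f x' := by
  have h := hf.moreauEnvelope_le hγ hγδ x' x
  have hl := hf.norm_prox_sub_le hγ hγδ x' x
  set p := prox γ f x
  set p' := prox γ f x'
  have hk : 0 < γ * (1 / γ - δ) := mul_pos hγ (one_div_sub_pos hγ hγδ)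
  have h1 := real_inner_le_norm (p' - p) (x' - x)
  have h2 : ‖p' - p‖ * ‖x' - x‖ ≤ ‖x' - x‖ ^ 2 / (γ * (1 / γ - δ)) := by
    rw [le_div_iff₀ hk]; nlinarith [norm_nonneg (x' - x)]
  have e : inner ℝ ((1 / γ) • (x' - p')) (x - x')
      = - inner ℝ ((1 / γ) • (x - p)) (x' - x) - 1 / γ * ‖x' - x‖ ^ 2
        + 1 / γ * inner ℝ (p' - p) (x' - x) := by
    simp only [← real_inner_self_eq_norm_sq, inner_sub_left, real_inner_smul_left,
      inner_sub_right]
    ring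
  rw [e, norm_sub_rev x x'] at h
  have h3 : 1 / γ * inner ℝ (p' - p) (x' - x) ≤ 1 / (γ ^ 2 * (1 / γ - δ)) * ‖x' - x‖ ^ 2 := by
    have := mul_le_mul_of_nonneg_left (h1.trans h2) (one_div_pos.2 hγ).le
    refine this.trans (le_of_eq ?_)
    have := one_div_sub_pos hγ hγδ
    generalize 1 / γ - δ = r at *
    field_simp
  have h4 : 1 / γ = 2 * (1 / (2 * γ)) := by field_simp
  nlinarith

/-- The two quadratic bounds make the first-order remainder `O(‖x' - x‖²)`, hence `o(‖x' - x‖)`. -/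
theorem WeaklyConvex.hasGradientAt_moreauEnvelope (hf : WeaklyConvex δ f) (hγ : 0 < γ)
    (hγδ : γ * δ < 1) (x : Vec n) :
    HasGradientAt (moreauEnvelope γ f) ((1 / γ) • (x - prox γ f x)) x := by
  rw [hasGradientAt_iff_isLittleO]
  set K := |1 / (γ ^ 2 * (1 / γ - δ)) - 1 / (2 * γ)| + 1 / (2 * γ) with hK
  have hbig : (fun x' => moreauEnvelope γ f x' - moreauEnvelope γ f x
      - inner ℝ ((1 / γ) • (x - prox γ f x)) (x' - x)) =O[𝓝 x] fun x' => ‖x' - x‖ ^ 2 := by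
    apply Asymptotics.IsBigO.of_bound K
    refine Eventually.of_forall fun x' => ?_
    have h1 := hf.moreauEnvelope_le hγ hγδ x x'
    have h2 := hf.le_moreauEnvelope hγ hγδ x x'
    have h3 : 0 < 1 / (2 * γ) := by positivity
    have h4 := le_abs_self (1 / (γ ^ 2 * (1 / γ - δ)) - 1 / (2 * γ))
    have h5 := abs_nonneg (1 / (γ ^ 2 * (1 / γ - δ)) - 1 / (2 * γ))
    rw [Real.norm_eq_abs, Real.norm_of_nonneg (sq_nonneg _), abs_le]
    constructor <;> nlinarith [sq_nonneg ‖x' - x‖]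
  refine hbig.trans_isLittleO ?_
  have : (fun x' : Vec n => ‖x' - x‖ ^ 2) =o[𝓝 x] fun x' => ‖x' - x‖ := by
    have ht : Tendsto (fun x' : Vec n => ‖x' - x‖) (𝓝 x) (𝓝 0) := by
      simpa using ((by fun_prop : Continuous fun x' : Vec n => ‖x' - x‖).tendsto x)
    exact (Asymptotics.isLittleO_pow_id (𝕜 := ℝ) one_lt_two).comp_tendsto ht
  exact this.trans_isBigO (Asymptotics.isBigO_refl _ _).norm_left

/-- The residual at the proximal point is a subgradient there. -/
theorem WeaklyConvex.smul_sub_prox_mem_subdifferential (hf : WeaklyConvex δ f) (hγ : 0 < γ)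
    (hγδ : γ * δ < 1) (x : Vec n) :
    (1 / γ) • (x - prox γ f x) ∈ subdifferential f (prox γ f x) := by
  intro c hc
  have hmin := hf.isMinOn_prox hγ hγδ x
  set p := prox γ f x
  -- Minimality gives the subgradient inequality up to `‖u - p‖²/(2γ)`, which is at most `c‖u - p‖`
  -- within distance `2γc`.
  filter_upwards [Metric.ball_mem_nhds p (show 0 < c * (2 * γ) by positivity)] with u hu
  have h : proxObj γ f x p ≤ proxObj γ f x u := hmin (Set.mem_univ u)
  have hu' : ‖u - p‖ < c * (2 * γ) := by simpa [dist_eq_norm] using hu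
  have e : ‖u - x‖ ^ 2 = ‖p - x‖ ^ 2 - 2 * inner ℝ (x - p) (u - p) + ‖u - p‖ ^ 2 := by
    simp only [← real_inner_self_eq_norm_sq, inner_sub_left,
      inner_sub_right, real_inner_comm p x, real_inner_comm p u, real_inner_comm u x]
    ring
  rw [proxObj, proxObj, e] at h
  rw [real_inner_smul_left]
  have h1 : 1 / (2 * γ) * ‖u - p‖ ≤ c := by
    rw [one_div_mul_eq_div, div_le_iff₀ (by positivity)]; exact hu'.le
  have h2 : 1 / (2 * γ) * ‖u - p‖ ^ 2 ≤ c * ‖u - p‖ := by nlinarith [norm_nonneg (u - p)]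
  have h4 : 1 / γ = 2 * (1 / (2 * γ)) := by field_simp
  rw [h4]
  nlinarith

end Prox

/-! ### First-order inequalities for strongly concave functions. -/

section StrongConcave

variable {n : ℕ} {s : Set (Vec n)} {μ : ℝ} {g : Vec n → ℝ} {v y y' : Vec n}

theorem _root_.HasGradientAt.tendsto_slope (hg : HasGradientAt g v y) (d : Vec n) :
    Tendsto (fun t : ℝ => t⁻¹ * (g (y + t • d) - g y)) (𝓝[>] 0) (𝓝 (inner ℝ v d)) := by
  have := (hg.hasFDerivAt.hasLineDerivAt d).tendsto_slope_zero_right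
  simpa using this

theorem _root_.StrongConcaveOn.le_add_inner_gradient (hs : StrongConcaveOn s μ g)
    (hg : HasGradientAt g v y) (hy : y ∈ s) (hy' : y' ∈ s) :
    g y' ≤ g y + inner ℝ v (y' - y) - μ / 2 * ‖y' - y‖ ^ 2 := by
  have hlim : Tendsto (fun t : ℝ => t⁻¹ * (g (y + t • (y' - y)) - g y)
      + t * (μ / 2 * ‖y' - y‖ ^ 2)) (𝓝[>] 0)
      (𝓝 (inner ℝ v (y' - y) + 0 * (μ / 2 * ‖y' - y‖ ^ 2))) :=
    (hg.tendsto_slope _).add ((tendsto_id.mono_left nhdsWithin_le_nhds).mul_const _)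
  have := ge_of_tendsto hlim (b := g y' - g y + μ / 2 * ‖y' - y‖ ^ 2) (by
    filter_upwards [Ioo_mem_nhdsGT (zero_lt_one' ℝ)] with t ht
    have h := hs.2 hy hy' (sub_nonneg.2 ht.2.le) ht.1.le (by ring)
    have e : (1 - t) • y + t • y' = y + t • (y' - y) := by module
    simp only [smul_eq_mul, e, norm_sub_rev y y'] at h
    rw [← sub_le_iff_le_add, inv_mul_eq_div, le_div_iff₀ ht.1]
    nlinarith)
  linarith

theorem inner_gradient_nonpos_of_isMaxOn (hs : Convex ℝ s) (hg : HasGradientAt g v y)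
    (hmax : IsMaxOn g s y) (hy : y ∈ s) (hy' : y' ∈ s) : inner ℝ v (y' - y) ≤ 0 := by
  apply le_of_tendsto (hg.tendsto_slope (y' - y))
  filter_upwards [Ioo_mem_nhdsGT (zero_lt_one' ℝ)] with t ht
  have h : g (y + t • (y' - y)) ≤ g y := hmax (hs.add_smul_sub_mem hy hy' ⟨ht.1.le, ht.2.le⟩)
  exact mul_nonpos_of_nonneg_of_nonpos (inv_nonneg.2 ht.1.le) (by linarith)

theorem _root_.StrongConcaveOn.add_sq_le_of_isMaxOn (hs : StrongConcaveOn s μ g) (hy : y ∈ s)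
    (hy' : y' ∈ s) (hmax : IsMaxOn g s y) : g y' + μ / 2 * ‖y - y'‖ ^ 2 ≤ g y := by
  have h : StrongConvexOn s μ (-g) := UniformConcaveOn.neg hs
  have := h.add_sq_le_of_isMinOn hy hy' hmax.neg
  simp only [Pi.neg_apply] at this
  linarith

end StrongConcave

/-! ### Euclidean projection onto a convex compact set. -/

section Proj

variable {n : ℕ} {C : Set (Vec n)}

theorem proj_spec (hne : C.Nonempty) (hc : IsCompact C) (u : Vec n) :
    proj C u ∈ C ∧ IsMinOn (fun w => ‖u - w‖) C (proj C u) :=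
  Classical.epsilon_spec (p := fun p => p ∈ C ∧ IsMinOn (fun w => ‖u - w‖) C p)
    (hc.exists_isMinOn hne (by fun_prop))

theorem inner_sub_proj_nonpos (hne : C.Nonempty) (hcv : Convex ℝ C) (hc : IsCompact C)
    (u : Vec n) {w : Vec n} (hw : w ∈ C) : inner ℝ (u - proj C u) (w - proj C u) ≤ 0 := by
  obtain ⟨h1, h2⟩ := proj_spec hne hc u
  refine (norm_eq_iInf_iff_real_inner_le_zero hcv h1).1 ?_ w hw
  have : Nonempty C := hne.to_subtype
  apply le_antisymm
  · exact le_ciInf fun w => h2 w.2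
  · exact ciInf_le (f := fun w : C => ‖u - w‖)
      ⟨0, by rintro _ ⟨w, rfl⟩; exact norm_nonneg _⟩ (⟨proj C u, h1⟩ : C)

theorem norm_proj_sub_proj_le (hne : C.Nonempty) (hcv : Convex ℝ C) (hc : IsCompact C)
    (u w : Vec n) : ‖proj C u - proj C w‖ ≤ ‖u - w‖ := by
  have h1 := inner_sub_proj_nonpos hne hcv hc u (proj_spec hne hc w).1
  have h2 := inner_sub_proj_nonpos hne hcv hc w (proj_spec hne hc u).1
  set p := proj C u
  set q := proj C w
  have e : ‖p - q‖ ^ 2 = inner ℝ (u - p) (q - p) + inner ℝ (w - q) (p - q)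
      + inner ℝ (u - w) (p - q) := by
    simp only [← real_inner_self_eq_norm_sq, inner_sub_left, inner_sub_right]
    ring
  have h3 := real_inner_le_norm (u - w) (p - q)
  rcases (norm_nonneg (p - q)).eq_or_lt with h0 | h0
  · rw [← h0]; simp
  · nlinarith

theorem proj_eq_self (hne : C.Nonempty) (hc : IsCompact C) {u : Vec n} (hu : u ∈ C) :
    proj C u = u := by
  have h : ‖u - proj C u‖ ≤ ‖u - u‖ := (proj_spec hne hc u).2 hu
  rw [sub_self, norm_zero, norm_le_zero_iff, sub_eq_zero] at h
  exact h.symm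

theorem norm_proj_sub_le (hne : C.Nonempty) (hcv : Convex ℝ C) (hc : IsCompact C)
    (u : Vec n) {w : Vec n} (hw : w ∈ C) : ‖proj C u - w‖ ≤ ‖u - w‖ := by
  simpa [proj_eq_self hne hc hw] using norm_proj_sub_proj_le hne hcv hc u w

theorem continuous_proj (hne : C.Nonempty) (hcv : Convex ℝ C) (hc : IsCompact C) :
    Continuous (proj C) :=
  (LipschitzWith.of_dist_le_mul (K := 1) fun u w => by
    simpa [dist_eq_norm] using norm_proj_sub_proj_le hne hcv hc u w).continuous

end Proj

/-! ### The value function, its maximizer, and the saddle point of the proximal problem. -/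

namespace IsComponent

variable {m n : ℕ} {f : Vec m → Vec n → ℝ} {Y : Set (Vec n)} {δ μ L γ : ℝ}
  (hf : IsComponent f Y δ μ L)

include hf

theorem hasGradientAt (x : Vec m) {y : Vec n} (hy : y ∈ Y) :
    HasGradientAt (f x) (gradient (f x) y) y :=
  (hf.differentiable x y hy).hasGradientAt

theorem continuousOn (x : Vec m) : ContinuousOn (f x) Y := fun y hy =>
  (hf.differentiable x y hy).continuousAt.continuousWithinAt

theorem argMax_spec (x : Vec m) : argMax f Y x ∈ Y ∧ IsMaxOn (f x) Y (argMax f Y x) :=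
  Classical.epsilon_spec (p := fun y => y ∈ Y ∧ IsMaxOn (f x) Y y)
    (hf.compact.exists_isMaxOn hf.nonempty (hf.continuousOn x))

theorem argMax_mem (x : Vec m) : argMax f Y x ∈ Y := (hf.argMax_spec x).1

theorem maxValue_eq (x : Vec m) : maxValue f Y x = f x (argMax f Y x) :=
  IsGreatest.csSup_eq ⟨⟨_, hf.argMax_mem x, rfl⟩, by
    rintro _ ⟨y, hy, rfl⟩; exact (hf.argMax_spec x).2 hy⟩

theorem le_maxValue (x : Vec m) {y : Vec n} (hy : y ∈ Y) : f x y ≤ maxValue f Y x := by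
  rw [hf.maxValue_eq]; exact (hf.argMax_spec x).2 hy

/-- Freeze the maximizer at the intermediate point: the defect inequality of that single slice
suffices, as its end values are at most the maxima there. -/
theorem weaklyConvex_maxValue : WeaklyConvex δ (maxValue f Y) := by
  apply weaklyConvex_of_le_combo
  intro x x' t h0 h1
  rw [hf.maxValue_eq (x + t • (x' - x))]
  set y := argMax f Y (x + t • (x' - x))
  have hy : y ∈ Y := hf.argMax_mem _
  have h := (hf.weaklyConvex y hy).le_combo x x' h0 h1
  have h2 := mul_le_mul_of_nonneg_left (hf.le_maxValue x hy) (sub_nonneg.2 h1)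
  have h3 := mul_le_mul_of_nonneg_left (hf.le_maxValue x' hy) h0
  linarith

/-- Strong concavity of `f x`, used at its maximizer `y` and through its gradient at `y'`, gives
`μ‖y - y'‖² ≤ ⟨∇f x y', y - y'⟩`. Optimality of `y'` for `f x'` allows subtracting `∇f x' y'`, and
the gradient is Lipschitz in `x`. -/
theorem norm_argMax_sub_le (x x' : Vec m) :
    μ * ‖argMax f Y x - argMax f Y x'‖ ≤ L * ‖x - x'‖ := by
  obtain ⟨hy, hym⟩ := hf.argMax_spec x
  obtain ⟨hy', hym'⟩ := hf.argMax_spec x'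
  set y := argMax f Y x
  set y' := argMax f Y x'
  have h1 := (hf.stronglyConcave x).add_sq_le_of_isMaxOn hy hy' hym
  have h2 := (hf.stronglyConcave x).le_add_inner_gradient (hf.hasGradientAt x hy') hy' hy
  have h3 := inner_gradient_nonpos_of_isMaxOn hf.convex (hf.hasGradientAt x' hy') hym' hy' hy
  have h4 := real_inner_le_norm (gradient (f x) y' - gradient (f x') y') (y - y')
  rw [inner_sub_left] at h4
  have h5 := mul_le_mul_of_nonneg_right (hf.gradient_lipschitz y' hy' x x')
    (norm_nonneg (y - y'))
  rcases (norm_nonneg (y - y')).eq_or_lt with h0 | h0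
  · rw [← h0, mul_zero]; exact mul_nonneg hf.L_pos.le (norm_nonneg _)
  · nlinarith

theorem continuous_argMax : Continuous (argMax f Y) := by
  refine (LipschitzWith.of_dist_le_mul (K := (L / μ).toNNReal) fun x x' => ?_).continuous
  rw [dist_eq_norm, dist_eq_norm, Real.coe_toNNReal _ (div_pos hf.L_pos hf.μ_pos).le,
    div_mul_eq_mul_div, le_div_iff₀ hf.μ_pos, mul_comm]
  exact hf.norm_argMax_sub_le x x'

/-- Minimax: the proximal point of the value function is the proximal point of `f · y` where `y`
is the maximizer at the proximal point. -/
theorem isMinOn_proxObj_argMax (hγ : 0 < γ) (hγδ : γ * δ < 1) (x : Vec m) :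
    IsMinOn (proxObj γ (fun u => f u (argMax f Y (prox γ (maxValue f Y) x))) x) Set.univ
      (prox γ (maxValue f Y) x) := by
  intro u _
  have hmin := hf.weaklyConvex_maxValue.isMinOn_prox hγ hγδ x
  set p := prox γ (maxValue f Y) x
  set y := argMax f Y p
  have hy : y ∈ Y := hf.argMax_mem p
  have hline : Tendsto (fun t : ℝ => p + t • (u - p)) (𝓝[>] 0) (𝓝 p) := by
    apply Tendsto.mono_left _ nhdsWithin_le_nhds
    have := (by fun_prop : Continuous fun t : ℝ => p + t • (u - p)).tendsto 0
    simpa using this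
  -- The limit is taken within `Y`, since continuity of `f u` is available only on `Y`.
  have hyt : Tendsto (fun t : ℝ => argMax f Y (p + t • (u - p))) (𝓝[>] 0) (𝓝[Y] y) :=
    tendsto_nhdsWithin_iff.2 ⟨(hf.continuous_argMax.tendsto p).comp hline,
      Eventually.of_forall fun t => hf.argMax_mem _⟩
  have hft : Tendsto (fun t : ℝ => proxObj γ (fun u => f u (argMax f Y (p + t • (u - p)))) x u)
      (𝓝[>] 0) (𝓝 (proxObj γ (fun u => f u y) x u)) :=
    (Tendsto.comp (hf.continuousOn u y hy) hyt).add_const _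
  change proxObj γ (fun u => f u y) x p ≤ proxObj γ (fun u => f u y) x u
  refine ge_of_tendsto hft ?_
  filter_upwards [Ioo_mem_nhdsGT (zero_lt_one' ℝ)] with t ht
  -- With the maximizer at `w` frozen, the slice equals the value function at `w` and lies below it
  -- at `p`. Convexity of the slice objective on `[p, u]` and minimality of `p` then bound the
  -- optimal value by the slice objective at `u`; as `t → 0⁺` the frozen maximizer tends to `y`.
  set w := p + t • (u - p) with hw
  have hyw : argMax f Y w ∈ Y := hf.argMax_mem w
  have h1 : proxObj γ (maxValue f Y) x p ≤ proxObj γ (maxValue f Y) x w := hmin (Set.mem_univ w)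
  have h2 := ((hf.weaklyConvex _ hyw).strongConvexOn_proxObj hγ x).2 (Set.mem_univ p)
    (Set.mem_univ u) (sub_nonneg.2 ht.2.le) ht.1.le (by ring)
  have e : (1 - t) • p + t • u = w := by rw [hw]; module
  rw [e] at h2
  have h3 := hf.le_maxValue p hyw
  have h5 := mul_nonneg (mul_nonneg (sub_nonneg.2 ht.2.le) ht.1.le)
    (mul_nonneg (half_pos (one_div_sub_pos hγ hγδ)).le (sq_nonneg ‖p - u‖))
  have h6 := mul_le_mul_of_nonneg_left h3 (sub_nonneg.2 ht.2.le)
  have hpv : maxValue f Y p = f p y := hf.maxValue_eq p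
  have hwv := hf.maxValue_eq w
  simp only [proxObj, smul_eq_mul] at h1 h2 ⊢
  have h4 : t * (f p y + 1 / (2 * γ) * ‖p - x‖ ^ 2)
      ≤ t * (f u (argMax f Y w) + 1 / (2 * γ) * ‖u - x‖ ^ 2) := by
    rw [hwv] at h1
    rw [hpv] at h1 h6
    linarith
  exact le_of_mul_le_mul_left h4 ht.1

end IsComponent

/-! ### One stochastic descent-ascent step. -/

section Step

variable {m n : ℕ} {f : Vec m → Vec n → ℝ} {Y : Set (Vec n)} {δ μ L γ M : ℝ}
  {Ξ : Type*} [MeasurableSpace Ξ] {D : Measure Ξ} [IsProbabilityMeasure D]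
  {gx : Vec m → Vec n → Ξ → Vec m} {gy : Vec m → Vec n → Ξ → Vec n}

/-- Nonnegativity of the variance: `‖E g‖² ≤ E‖g‖²`. It provides, at every point, a subgradient of
norm at most `M`. -/
theorem IsOracle.norm_integral_gx_le (hg : IsOracle D f Y M gx gy) (hM : 0 ≤ M) (x : Vec m)
    {y : Vec n} (hy : y ∈ Y) : ‖∫ s, gx x y s ∂D‖ ≤ M := by
  have h2 := hg.memLp_gx x y hy
  set e := ∫ s, gx x y s ∂D with he
  have hint : Integrable (gx x y) D := h2.integrable (by norm_num)
  have hsq : Integrable (fun s => ‖gx x y s‖ ^ 2) D := h2.integrable_norm_pow (by norm_num)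
  have h0 : 0 ≤ ∫ s, ‖gx x y s - e‖ ^ 2 ∂D := integral_nonneg fun _ => by positivity
  have e1 : ∀ s, ‖gx x y s - e‖ ^ 2 = ‖gx x y s‖ ^ 2 - 2 * inner ℝ e (gx x y s) + ‖e‖ ^ 2 := by
    intro s; rw [norm_sub_sq_real, real_inner_comm]
  have hi : Integrable (fun s => inner ℝ e (gx x y s)) D := hint.const_inner e
  have e2 : ∫ s, ‖gx x y s - e‖ ^ 2 ∂D
      = ∫ s, ‖gx x y s‖ ^ 2 ∂D - 2 * inner ℝ e (∫ s, gx x y s ∂D) + ‖e‖ ^ 2 := by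
    have hs : Integrable (fun s => ‖gx x y s‖ ^ 2 - 2 * inner ℝ e (gx x y s)) D :=
      hsq.sub (hi.const_mul 2)
    simp_rw [e1]
    rw [integral_add hs (integrable_const _),
      integral_sub hsq (hi.const_mul 2), integral_const_mul, integral_inner hint]
    simp
  rw [← he, real_inner_self_eq_norm_sq] at e2
  have := hg.secondMoment_gx x y hy
  exact le_of_sq_le_sq (by linarith) hM

/-- Displacement of the proximal step, given bounded subgradients of the component. -/
theorem IsOracle.norm_prox_sub_le (hg : IsOracle D f Y M gx gy) (hf : IsComponent f Y δ μ L)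
    (hM : 0 ≤ M) (hγ : 0 < γ) (hγδ : γ * δ < 1) (x : Vec m) :
    ‖prox γ (maxValue f Y) x - x‖ ≤ γ * M := by
  have hmin := hf.isMinOn_proxObj_argMax hγ hγδ x
  set p := prox γ (maxValue f Y) x
  set y := argMax f Y p
  have hy : y ∈ Y := hf.argMax_mem p
  set d := ‖p - x‖ with hd
  have hd0 : 0 ≤ d := norm_nonneg _
  have key : d ^ 2 / γ ≤ M * d := by
    apply le_of_forall_le_add_mul (c := (1 / (2 * γ) + δ / 2) * d ^ 2)
    intro t ht0 ht1
    -- Moving from `p` towards `x` lowers the quadratic term by about `t d²/γ`. By minimality the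
    -- slice must rise by as much, but the bounded subgradient at `w`, tested at `p`, limits the
    -- rise to about `t M d`.
    set w := p + t • (x - p) with hw
    have h1 := (hf.weaklyConvex y hy).le_of_mem_subdifferential (hg.unbiased_gx w y hy) p
    have h2 : proxObj γ (fun u => f u y) x p ≤ proxObj γ (fun u => f u y) x w :=
      hmin (Set.mem_univ w)
    have e1 : ‖p - w‖ = t * d := by
      rw [hw, sub_add_cancel_left, norm_neg, norm_smul, Real.norm_of_nonneg ht0.le, norm_sub_rev]
    have e2 : ‖w - x‖ = (1 - t) * d := by
      have : w - x = (1 - t) • (p - x) := by rw [hw]; module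
      rw [this, norm_smul, Real.norm_of_nonneg (by linarith)]
    have h3 := hg.norm_integral_gx_le hM w hy
    have h4 := abs_real_inner_le_norm (∫ s, gx w y s ∂D) (p - w)
    have h5 := neg_le_of_abs_le h4
    have h6 := mul_le_mul_of_nonneg_right h3 (norm_nonneg (p - w))
    rw [e1] at h1 h5 h6
    simp only [proxObj, e2, ← hd] at h2
    have h7 : t * (d ^ 2 / γ) ≤ t * (M * d + t * ((1 / (2 * γ) + δ / 2) * d ^ 2)) := by
      have : d ^ 2 / γ = 2 * (1 / (2 * γ) * d ^ 2) := by field_simp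
      rw [this]
      nlinarith
    exact le_of_mul_le_mul_left h7 ht0
  rw [div_le_iff₀ hγ] at key
  rcases hd0.eq_or_lt with h0 | h0
  · rw [← h0]; positivity
  · nlinarith

/-- Here `q` is the bounded part of the proximal gradient and `w` the part proportional to the
current error. Only `w` has to be reabsorbed by the contraction; `g` and `q` are noise of size `M`.
-/
theorem inner_expansion_bound (a g w q : Vec m) {η M : ℝ}
    (hq : ‖q‖ ≤ M) :
    ‖a - η • (g + (q + w))‖ ^ 2 ≤ ‖a‖ ^ 2 - 2 * η * inner ℝ (g + (q + w)) a
      + η ^ 2 * (4 * ‖g‖ ^ 2 + 4 * M ^ 2 + 2 * ‖w‖ ^ 2) := by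
  have h1 : ‖g + (q + w)‖ ^ 2 ≤ 4 * ‖g‖ ^ 2 + 4 * M ^ 2 + 2 * ‖w‖ ^ 2 := by
    have a1 : ‖g + (q + w)‖ ≤ ‖g‖ + ‖q‖ + ‖w‖ := by
      rw [← add_assoc]; exact norm_add₃_le
    have a2 : ‖g + (q + w)‖ ^ 2 ≤ (‖g‖ + ‖q‖ + ‖w‖) ^ 2 := pow_le_pow_left₀ (norm_nonneg _) a1 2
    have a3 : ‖q‖ ^ 2 ≤ M ^ 2 := pow_le_pow_left₀ (norm_nonneg _) hq 2
    nlinarith [sq_nonneg (‖g‖ + ‖q‖ - ‖w‖), sq_nonneg (‖g‖ - ‖q‖)]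
  have e : ‖a - η • (g + (q + w))‖ ^ 2
      = ‖a‖ ^ 2 - 2 * η * inner ℝ (g + (q + w)) a + η ^ 2 * ‖g + (q + w)‖ ^ 2 := by
    rw [norm_sub_sq_real, real_inner_smul_right, real_inner_comm, norm_smul, mul_pow,
      Real.norm_eq_abs, sq_abs]
    ring
  rw [e]
  have := mul_le_mul_of_nonneg_left h1 (sq_nonneg η)
  linarith

/-- Squared distance after one stochastic descent-ascent step to the saddle point of the proximal
problem at `x`. -/
def stepDist (f : Vec m → Vec n → ℝ) (Y : Set (Vec n)) (γ η : ℝ)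
    (gx : Vec m → Vec n → Ξ → Vec m) (gy : Vec m → Vec n → Ξ → Vec n)
    (x u : Vec m) (y : Vec n) (s : Ξ) : ℝ :=
  ‖u - η • (gx u y s + (1 / γ) • (u - x)) - prox γ (maxValue f Y) x‖ ^ 2
    + ‖proj Y (y + η • gy u y s) - argMax f Y (prox γ (maxValue f Y) x)‖ ^ 2

/-- Contraction in expectation of one stochastic descent-ascent step. -/
theorem IsOracle.stepDist_integral_le (hg : IsOracle D f Y M gx gy) (hf : IsComponent f Y δ μ L)
    (hM : 0 ≤ M) (hγ : 0 < γ) (hγδ : γ * δ < 1) {η : ℝ} (hη : 0 ≤ η) (x u : Vec m) {y : Vec n}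
    (hy : y ∈ Y) :
    Integrable (stepDist f Y γ η gx gy x u y) D ∧
    ∫ s, stepDist f Y γ η gx gy x u y s ∂D
      ≤ (1 - 2 * η * (1 / γ - δ) + 2 * η ^ 2 / γ ^ 2) * ‖u - prox γ (maxValue f Y) x‖ ^ 2
        + (1 - 2 * η * μ) * ‖y - argMax f Y (prox γ (maxValue f Y) x)‖ ^ 2
        + 9 * η ^ 2 * M ^ 2 := by
  have hmin := hf.isMinOn_proxObj_argMax hγ hγδ x
  have hpx := hg.norm_prox_sub_le hf hM hγ hγδ x
  unfold stepDist
  set p := prox γ (maxValue f Y) x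
  obtain ⟨hyp, hypm⟩ := hf.argMax_spec p
  set yp := argMax f Y p
  have hx2 := hg.memLp_gx u y hy
  have hy2 := hg.memLp_gy u y hy
  have hxi : Integrable (gx u y) D := hx2.integrable (by norm_num)
  have hyi : Integrable (gy u y) D := hy2.integrable (by norm_num)
  have hxs : Integrable (fun s => ‖gx u y s‖ ^ 2) D := hx2.integrable_norm_pow (by norm_num)
  have hys : Integrable (fun s => ‖gy u y s‖ ^ 2) D := hy2.integrable_norm_pow (by norm_num)
  have hxin : Integrable (fun s => inner ℝ (u - p) (gx u y s)) D := hxi.const_inner _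
  have hyin : Integrable (fun s => inner ℝ (y - yp) (gy u y s)) D := hyi.const_inner _
  -- Splitting `(u - x)/γ` at the proximal point `p`.
  set q := (1 / γ) • (p - x) with hq
  set w := (1 / γ) • (u - p) with hw
  have hqM : ‖q‖ ≤ M := by
    rw [hq, norm_smul, Real.norm_of_nonneg (by positivity), one_div_mul_eq_div, div_le_iff₀ hγ]
    linarith
  have hwn : ‖w‖ ^ 2 = ‖u - p‖ ^ 2 / γ ^ 2 := by
    rw [hw, norm_smul, Real.norm_of_nonneg (by positivity)]; field_simp
  have hqw : (1 / γ) • (u - x) = q + w := by rw [hq, hw]; module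
  set c : ℝ := ‖u - p‖ ^ 2 - 2 * η * inner ℝ (q + w) (u - p)
    + η ^ 2 * (4 * M ^ 2 + 2 * ‖w‖ ^ 2) + ‖y - yp‖ ^ 2 with hc
  set B : Ξ → ℝ := fun s => c - 2 * η * inner ℝ (u - p) (gx u y s) + 4 * η ^ 2 * ‖gx u y s‖ ^ 2
    + 2 * η * inner ℝ (y - yp) (gy u y s) + η ^ 2 * ‖gy u y s‖ ^ 2 with hB
  have i1 : Integrable (fun s => c - 2 * η * inner ℝ (u - p) (gx u y s)) D :=
    (integrable_const c).sub (hxin.const_mul _)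
  have i2 : Integrable (fun s => c - 2 * η * inner ℝ (u - p) (gx u y s)
    + 4 * η ^ 2 * ‖gx u y s‖ ^ 2) D := i1.add (hxs.const_mul _)
  have i3 : Integrable (fun s => c - 2 * η * inner ℝ (u - p) (gx u y s)
    + 4 * η ^ 2 * ‖gx u y s‖ ^ 2 + 2 * η * inner ℝ (y - yp) (gy u y s)) D :=
    i2.add (hyin.const_mul _)
  have hBi : Integrable B D := i3.add (hys.const_mul _)
  have hBint : ∫ s, B s ∂D = c - 2 * η * inner ℝ (u - p) (∫ s, gx u y s ∂D)
      + 4 * η ^ 2 * ∫ s, ‖gx u y s‖ ^ 2 ∂D + 2 * η * inner ℝ (y - yp) (∫ s, gy u y s ∂D)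
      + η ^ 2 * ∫ s, ‖gy u y s‖ ^ 2 ∂D := by
    rw [hB, integral_add i3 (hys.const_mul _), integral_add i2 (hyin.const_mul _),
      integral_add i1 (hxs.const_mul _), integral_sub (integrable_const c) (hxin.const_mul _),
      integral_const_mul, integral_const_mul, integral_const_mul, integral_const_mul,
      integral_inner hxi, integral_inner hyi]
    simp
  have hbound : ∀ s, ‖u - η • (gx u y s + (1 / γ) • (u - x)) - p‖ ^ 2
      + ‖proj Y (y + η • gy u y s) - yp‖ ^ 2 ≤ B s := by
    intro s
    have a1 := inner_expansion_bound (u - p) (gx u y s) w q (η := η) hqM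
    rw [inner_add_left, real_inner_comm] at a1
    have a2 : ‖proj Y (y + η • gy u y s) - yp‖ ^ 2 ≤ ‖y + η • gy u y s - yp‖ ^ 2 :=
      pow_le_pow_left₀ (norm_nonneg _)
        (norm_proj_sub_le hf.nonempty hf.convex hf.compact _ hyp) 2
    have a3 : ‖y + η • gy u y s - yp‖ ^ 2 = ‖y - yp‖ ^ 2
        + 2 * η * inner ℝ (y - yp) (gy u y s) + η ^ 2 * ‖gy u y s‖ ^ 2 := by
      rw [add_sub_right_comm, norm_add_sq_real, real_inner_smul_right, norm_smul, mul_pow,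
        Real.norm_eq_abs, sq_abs]
      ring
    have a4 : u - η • (gx u y s + (1 / γ) • (u - x)) - p
        = (u - p) - η • (gx u y s + (q + w)) := by rw [hqw]; abel
    rw [a4]
    simp only [hB, hc]
    linarith
  have hcont : Integrable (fun s => ‖u - η • (gx u y s + (1 / γ) • (u - x)) - p‖ ^ 2
      + ‖proj Y (y + η • gy u y s) - yp‖ ^ 2) D := by
    refine hBi.mono' ?_ (Eventually.of_forall fun s => ?_)
    · have hp := continuous_proj hf.nonempty hf.convex hf.compact
      have m1 := hxi.aestronglyMeasurable
      have m2 := hyi.aestronglyMeasurable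
      refine AEStronglyMeasurable.add ?_ ?_
      · exact (by fun_prop : Continuous fun v : Vec m =>
          ‖u - η • (v + (1 / γ) • (u - x)) - p‖ ^ 2).comp_aestronglyMeasurable m1
      · exact (by fun_prop : Continuous fun v : Vec n =>
          ‖proj Y (y + η • v) - yp‖ ^ 2).comp_aestronglyMeasurable m2
    · rw [Real.norm_of_nonneg (by positivity)]; exact hbound s
  refine ⟨hcont, (integral_mono hcont hBi hbound).trans ?_⟩
  rw [hBint]
  have hsx := hg.secondMoment_gx u y hy
  have hsy := hg.secondMoment_gy u y hy
  -- The next four inequalities run around the rectangle with corners `(u, y)`, `(p, y)`, `(p, yp)`,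
  -- `(u, yp)`. In the sum all values of `f` cancel, leaving the strong monotonicity `key` of the
  -- saddle operator.
  have b1 := (hf.weaklyConvex y hy).le_of_mem_subdifferential (hg.unbiased_gx u y hy) p
  have b2 := (hf.stronglyConcave u).le_add_inner_gradient (hf.hasGradientAt u hy) hy hyp
  have b3 := (hf.stronglyConcave p).add_sq_le_of_isMaxOn hyp hy hypm
  have b4 := ((hf.weaklyConvex yp hyp).strongConvexOn_proxObj hγ x).add_sq_le_of_isMinOn
    (Set.mem_univ p) (Set.mem_univ u) hmin
  rw [← hg.unbiased_gy u y hy] at b2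
  simp only [proxObj] at b4
  set vx := ∫ s, gx u y s ∂D
  set vy := ∫ s, gy u y s ∂D
  have e1 : inner ℝ vx (p - u) = - inner ℝ (u - p) vx := by
    rw [← neg_sub u p, inner_neg_right, real_inner_comm]
  have e2 : inner ℝ vy (yp - y) = - inner ℝ (y - yp) vy := by
    rw [← neg_sub y yp, inner_neg_right, real_inner_comm]
  have e3 : 1 / (2 * γ) * ‖u - x‖ ^ 2 - 1 / (2 * γ) * ‖p - x‖ ^ 2
      = inner ℝ (q + w) (u - p) - 1 / (2 * γ) * ‖u - p‖ ^ 2 := by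
    rw [← hqw, real_inner_smul_left]
    simp only [← real_inner_self_eq_norm_sq, inner_sub_left, inner_sub_right,
      real_inner_comm u x, real_inner_comm u p, real_inner_comm p x]
    field_simp
    ring
  rw [e1, norm_sub_rev p u] at b1
  rw [e2, norm_sub_rev yp y] at b2
  rw [norm_sub_rev yp y] at b3
  rw [norm_sub_rev p u] at b4
  have e4 : 1 / γ * ‖u - p‖ ^ 2 = 2 * (1 / (2 * γ) * ‖u - p‖ ^ 2) := by field_simp
  have key : - inner ℝ (u - p) vx - inner ℝ (q + w) (u - p) + inner ℝ (y - yp) vy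
      ≤ -((1 / γ - δ) * ‖u - p‖ ^ 2) - μ * ‖y - yp‖ ^ 2 := by
    linarith
  have key2 := mul_le_mul_of_nonneg_left key (by positivity : 0 ≤ 2 * η)
  have hsx' := mul_le_mul_of_nonneg_left hsx (by positivity : 0 ≤ 4 * η ^ 2)
  have hsy' := mul_le_mul_of_nonneg_left hsy (by positivity : 0 ≤ η ^ 2)
  have e5 : 2 * η ^ 2 / γ ^ 2 * ‖u - p‖ ^ 2 = η ^ 2 * (2 * ‖w‖ ^ 2) := by
    rw [hwn]; ring
  -- The noise constant is `9 = 4 + 4 + 1`: sampled subgradient, displacement `q`, sampled gradient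
  -- in `y`.
  rw [hc]
  linarith

end Step

/-! ### A Young inequality for a moving target. -/

section Young

/-- Half of the contraction pays for the change of target from `b` to `c`. The rate `r` is separate
from `s` because `s` may exceed `1` in the dual variable; if `1 - 2s < 0` the left side is
nonpositive and `r ≤ 1` suffices. -/
theorem young_contraction {E : Type*} [SeminormedAddCommGroup E] (a b c : E) {s r : ℝ}
    (hs : 0 < s) (hrs : r ≤ s) (hr1 : r ≤ 1) :
    (1 - 2 * s) * ‖a - c‖ ^ 2 ≤ (1 - r) * ‖a - b‖ ^ 2 + 1 / s * ‖b - c‖ ^ 2 := by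
  have hA := sq_nonneg ‖a - b‖
  have hB := sq_nonneg ‖b - c‖
  have hs' : 0 < 1 / s := one_div_pos.2 hs
  rcases le_or_gt 0 (1 - 2 * s) with h | h
  · have h1 : ‖a - c‖ ≤ ‖a - b‖ + ‖b - c‖ := norm_sub_le_norm_sub_add_norm_sub a b c
    have h2 : ‖a - c‖ ^ 2 ≤ (‖a - b‖ + ‖b - c‖) ^ 2 := pow_le_pow_left₀ (norm_nonneg _) h1 2
    have h3 : (‖a - b‖ + ‖b - c‖) ^ 2
        ≤ (1 + s) * ‖a - b‖ ^ 2 + (1 + 1 / s) * ‖b - c‖ ^ 2 := by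
      have h4 : 0 ≤ s * (‖a - b‖ - 1 / s * ‖b - c‖) ^ 2 := by positivity
      have h5 : s * (‖a - b‖ - 1 / s * ‖b - c‖) ^ 2
          = s * ‖a - b‖ ^ 2 - 2 * ‖a - b‖ * ‖b - c‖ + 1 / s * ‖b - c‖ ^ 2 := by
        field_simp
        ring
      nlinarith
    have h4 := mul_le_mul_of_nonneg_left (h2.trans h3) h
    have h5 : (1 - 2 * s) * ((1 + s) * ‖a - b‖ ^ 2 + (1 + 1 / s) * ‖b - c‖ ^ 2)
        = (1 - s - 2 * s ^ 2) * ‖a - b‖ ^ 2 + (1 / s - 1 - 2 * s) * ‖b - c‖ ^ 2 := by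
      field_simp
      ring
    nlinarith [mul_nonneg (sq_nonneg s) hA, mul_nonneg hs.le hB]
  · nlinarith [sq_nonneg ‖a - c‖, mul_nonneg (sub_nonneg.2 hr1) hA, mul_nonneg hs'.le hB]

end Young

/-! ### Motion of the saddle point when the centre moves. -/

section Drift

variable {m n : ℕ} {f : Vec m → Vec n → ℝ} {Y : Set (Vec n)} {δ μ L γ M η a : ℝ}

/-- Upper bound on the expected squared distance to the saddle point after one step. -/
def potential (f : Vec m → Vec n → ℝ) (Y : Set (Vec n)) (γ μ M η a : ℝ) (x u : Vec m)
    (y : Vec n) : ℝ :=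
  (1 - 2 * (η * a)) * ‖u - prox γ (maxValue f Y) x‖ ^ 2
    + (1 - 2 * (η * μ)) * ‖y - argMax f Y (prox γ (maxValue f Y) x)‖ ^ 2 + 9 * η ^ 2 * M ^ 2

/-- Young's inequality in each variable. The proximal point moves by at most `‖x - x'‖/(4γa)` and
its maximizer by `L/μ` times that; the Young factors `1/(ηa)` and `1/(ημ)` produce `1/a` and
`L²/μ³`. -/
theorem IsComponent.potential_le (hf : IsComponent f Y δ μ L) (hγ : 0 < γ) (hγδ : γ * δ < 1)
    (hη : 0 < η) (ha : 0 < a) (haδ : 4 * a ≤ 1 / γ - δ) (haμ : a ≤ μ) (hηa : η * a ≤ 1)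
    (x x' u : Vec m) (y : Vec n) :
    potential f Y γ μ M η a x' u y
      ≤ (1 - η * a) * (‖u - prox γ (maxValue f Y) x‖ ^ 2
          + ‖y - argMax f Y (prox γ (maxValue f Y) x)‖ ^ 2)
        + (1 / a + L ^ 2 / μ ^ 3) / (16 * γ ^ 2 * a ^ 2 * η) * ‖x - x'‖ ^ 2
        + 9 * η ^ 2 * M ^ 2 := by
  unfold potential
  have hp := hf.weaklyConvex_maxValue.norm_prox_sub_sq_le hγ hγδ x x'
  set p := prox γ (maxValue f Y) x
  set p' := prox γ (maxValue f Y) x'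
  have hμ := hf.μ_pos
  have hL := hf.L_pos
  have h1 := young_contraction u p p' (mul_pos hη ha) le_rfl hηa
  have h2 := young_contraction y (argMax f Y p) (argMax f Y p') (mul_pos hη hμ)
    (mul_le_mul_of_nonneg_left haμ hη.le) hηa
  have h3 : ‖p - p'‖ ^ 2 ≤ ‖x - x'‖ ^ 2 / (16 * γ ^ 2 * a ^ 2) := by
    refine hp.trans ?_
    apply div_le_div_of_nonneg_left (by positivity) (by positivity)
    have : γ * (4 * a) ≤ γ * (1 / γ - δ) := mul_le_mul_of_nonneg_left haδ hγ.le
    calc 16 * γ ^ 2 * a ^ 2 = (γ * (4 * a)) ^ 2 := by ring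
      _ ≤ _ := pow_le_pow_left₀ (by positivity) this 2
  have h4 : ‖argMax f Y p - argMax f Y p'‖ ^ 2 ≤ L ^ 2 / μ ^ 2 * ‖p - p'‖ ^ 2 := by
    have := pow_le_pow_left₀ (by positivity) (hf.norm_argMax_sub_le p p') 2
    rw [div_mul_eq_mul_div, le_div_iff₀ (by positivity)]
    nlinarith
  have h5 := mul_le_mul_of_nonneg_left h3 (show 0 ≤ 1 / (η * a) by positivity)
  have h6 := mul_le_mul_of_nonneg_left (h4.trans (mul_le_mul_of_nonneg_left h3
    (show 0 ≤ L ^ 2 / μ ^ 2 by positivity))) (show 0 ≤ 1 / (η * μ) by positivity)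
  have e : (1 / a + L ^ 2 / μ ^ 3) / (16 * γ ^ 2 * a ^ 2 * η) * ‖x - x'‖ ^ 2
      = 1 / (η * a) * (‖x - x'‖ ^ 2 / (16 * γ ^ 2 * a ^ 2))
        + 1 / (η * μ) * (L ^ 2 / μ ^ 2 * (‖x - x'‖ ^ 2 / (16 * γ ^ 2 * a ^ 2))) := by
    field_simp
  rw [e]
  linarith

variable {Ξ : Type*} {gx : Vec m → Vec n → Ξ → Vec m} {gy : Vec m → Vec n → Ξ → Vec n}

theorem stepDist_nonneg (x u : Vec m) (y : Vec n) (s : Ξ) :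
    0 ≤ stepDist f Y γ η gx gy x u y s := by unfold stepDist; positivity

variable [MeasurableSpace Ξ] {D : Measure Ξ} [IsProbabilityMeasure D]

/-- The cap on `η` makes the quadratic term `2η²/γ²` at most half of the contraction `2η(1/γ - δ)`;
the other half exceeds `2ηa`. -/
theorem IsOracle.stepDist_integral_le_potential (hg : IsOracle D f Y M gx gy)
    (hf : IsComponent f Y δ μ L) (hM : 0 ≤ M) (hγ : 0 < γ) (hγδ : γ * δ < 1) (hη : 0 ≤ η)
    (haδ : 4 * a ≤ 1 / γ - δ) (hηγ : η ≤ γ ^ 2 * (1 / γ - δ) / 2) (x u : Vec m) {y : Vec n}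
    (hy : y ∈ Y) :
    Integrable (stepDist f Y γ η gx gy x u y) D ∧
    ∫ s, stepDist f Y γ η gx gy x u y s ∂D ≤ potential f Y γ μ M η a x u y := by
  obtain ⟨h1, h2⟩ := hg.stepDist_integral_le hf hM hγ hγδ hη x u hy
  refine ⟨h1, h2.trans ?_⟩
  unfold potential
  have hρ := one_div_sub_pos hγ hγδ
  have h3 : 2 * η ^ 2 / γ ^ 2 ≤ η * (1 / γ - δ) := by
    rw [div_le_iff₀ (by positivity)]
    nlinarith
  have h4 : 1 - 2 * η * (1 / γ - δ) + 2 * η ^ 2 / γ ^ 2 ≤ 1 - 2 * (η * a) := by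
    nlinarith [mul_le_mul_of_nonneg_left haδ hη, mul_nonneg hη hρ.le]
  have h5 := mul_le_mul_of_nonneg_right h4 (sq_nonneg ‖u - prox γ (maxValue f Y) x‖)
  linarith

end Drift

/-! ### Fresh samples, random indices and second moments. -/

section Probability

variable {Ω A Ξ : Type*} [MeasurableSpace Ω] [MeasurableSpace A] [MeasurableSpace Ξ]
  {P : Measure Ω} [IsProbabilityMeasure P]

/-- Integrating first over a sample that is independent of the current state. -/
theorem integrable_and_integral_le_of_indepFun {S : Ω → A} {ξ : Ω → Ξ} (hS : Measurable S)
    (hξ : Measurable ξ) (hind : IndepFun S ξ P) {h : A → Ξ → ℝ}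
    (hh : Measurable fun q : A × Ξ => h q.1 q.2) (h0 : ∀ q s, 0 ≤ h q s) {B : A → ℝ}
    (hB : ∀ ω, Integrable (h (S ω)) (P.map ξ) ∧ ∫ s, h (S ω) s ∂(P.map ξ) ≤ B (S ω))
    (hBi : Integrable (fun ω => B (S ω)) P) :
    Integrable (fun ω => h (S ω) (ξ ω)) P ∧
      ∫ ω, h (S ω) (ξ ω) ∂P ≤ ∫ ω, B (S ω) ∂P := by
  have hprob : IsProbabilityMeasure (P.map ξ) := Measure.isProbabilityMeasure_map hξ.aemeasurable
  have hB0 : ∀ ω, 0 ≤ B (S ω) := fun ω => (integral_nonneg (h0 (S ω))).trans (hB ω).2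
  have hm : Measurable fun q : A × Ξ => ENNReal.ofReal (h q.1 q.2) := hh.ennreal_ofReal
  have hmeas : Measurable fun ω => h (S ω) (ξ ω) := hh.comp (hS.prodMk hξ)
  -- Independence turns the joint law into a product, and Tonelli integrates out the sample first.
  -- With lower integrals the same bound yields both integrability and the inequality.
  have hle : ∫⁻ ω, ENNReal.ofReal (h (S ω) (ξ ω)) ∂P ≤ ENNReal.ofReal (∫ ω, B (S ω) ∂P) := by
    have e1 : ∫⁻ ω, ENNReal.ofReal (h (S ω) (ξ ω)) ∂P
        = ∫⁻ q, ENNReal.ofReal (h q.1 q.2) ∂(P.map fun ω => (S ω, ξ ω)) := by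
      rw [lintegral_map hm (hS.prodMk hξ)]
    rw [e1, (indepFun_iff_map_prod_eq_prod_map_map hS.aemeasurable hξ.aemeasurable).1 hind,
      lintegral_prod _ hm.aemeasurable, lintegral_map hm.lintegral_prod_right' hS,
      ofReal_integral_eq_lintegral_ofReal hBi (Eventually.of_forall hB0)]
    apply lintegral_mono
    intro ω
    change ∫⁻ s, ENNReal.ofReal (h (S ω) s) ∂(P.map ξ) ≤ ENNReal.ofReal (B (S ω))
    rw [← ofReal_integral_eq_lintegral_ofReal (hB ω).1 (Eventually.of_forall (h0 (S ω)))]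
    exact ENNReal.ofReal_le_ofReal (hB ω).2
  have hi : Integrable (fun ω => h (S ω) (ξ ω)) P := by
    refine ⟨hmeas.aestronglyMeasurable, ?_⟩
    rw [hasFiniteIntegral_iff_ofReal (Eventually.of_forall fun ω => h0 _ _)]
    exact hle.trans_lt ENNReal.ofReal_lt_top
  refine ⟨hi, ?_⟩
  rw [← ofReal_integral_eq_lintegral_ofReal hi (Eventually.of_forall fun ω => h0 _ _)] at hle
  exact (ENNReal.ofReal_le_ofReal_iff (integral_nonneg hB0)).1 hle

/-- Sampling a process at an independent time that is uniform on `{1, …, T}`. -/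
theorem integral_uniform_index {T : ℕ} (hT : 1 ≤ T) {N : Ω → ℕ} (hN : Measurable N)
    (hunif : ∀ k ∈ Finset.Icc 1 T, P.real {ω | N ω = k} = 1 / (T : ℝ)) {h : ℕ → Ω → ℝ}
    (hi : ∀ k, Integrable (h k) P) (hind : ∀ k, IndepFun N (h k) P) :
    (∀ᵐ ω ∂P, N ω ∈ Finset.Icc 1 T) ∧ Integrable (fun ω => h (N ω) ω) P ∧
      ∫ ω, h (N ω) ω ∂P = 1 / (T : ℝ) * ∑ k ∈ Finset.Icc 1 T, ∫ ω, h k ω ∂P := by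
  have hms : ∀ k, MeasurableSet {ω | N ω = k} := fun k => hN (measurableSet_singleton k)
  have hT0 : (T : ℝ) ≠ 0 := by positivity
  have hae : ∀ᵐ ω ∂P, N ω ∈ Finset.Icc 1 T := by
    have hU : {ω | N ω ∈ Finset.Icc 1 T} = ⋃ k ∈ Finset.Icc 1 T, {ω | N ω = k} := by
      ext ω; simp
    have h1 : P.real {ω | N ω ∈ Finset.Icc 1 T} = 1 := by
      rw [hU, measureReal_biUnion_finset (fun i _ j _ hij => by
        apply Set.disjoint_left.2
        intro ω h1 h2
        exact hij (h1.symm.trans h2)) (fun k _ => hms k), Finset.sum_congr rfl hunif]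
      simp [hT0]
    have h2 : P {ω | N ω ∈ Finset.Icc 1 T} = 1 := by
      rw [measureReal_def] at h1
      have h3 := ENNReal.ofReal_toReal (measure_ne_top P {ω | N ω ∈ Finset.Icc 1 T})
      rw [h1] at h3
      simpa using h3.symm
    exact (mem_ae_iff_prob_eq_one (hN (MeasurableSet.of_discrete))).2 h2
  have heq : (fun ω => h (N ω) ω) =ᵐ[P]
      fun ω => ∑ k ∈ Finset.Icc 1 T, {ω | N ω = k}.indicator (fun _ => (1 : ℝ)) ω * h k ω := by
    filter_upwards [hae] with ω hω
    rw [Finset.sum_eq_single_of_mem (N ω) hω]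
    · simp
    · intro k _ hk
      simp [Set.indicator_of_notMem (show ω ∉ {ω | N ω = k} from fun h => hk h.symm)]
  have hti : ∀ k, Integrable (fun ω => {ω | N ω = k}.indicator (fun _ => (1 : ℝ)) ω * h k ω) P := by
    intro k
    refine ((hi k).indicator (hms k)).congr (Eventually.of_forall fun ω => ?_)
    by_cases hk : N ω = k <;> simp [Set.indicator, hk]
  refine ⟨hae, (integrable_finsetSum _ fun k _ => hti k).congr heq.symm, ?_⟩
  rw [integral_congr_ae heq, integral_finsetSum _ fun k _ => hti k, Finset.mul_sum]
  refine Finset.sum_congr rfl fun k hk => ?_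
  have hind' : IndepFun (fun ω => {ω | N ω = k}.indicator (fun _ => (1 : ℝ)) ω) (h k) P := by
    have : (fun ω => {ω | N ω = k}.indicator (fun _ => (1 : ℝ)) ω)
        = (fun j : ℕ => if j = k then (1 : ℝ) else 0) ∘ N := by
      funext ω; simp [Set.indicator]
    rw [this]
    exact (hind k).comp measurable_from_nat measurable_id
  rw [hind'.integral_fun_mul_eq_mul_integral
    ((measurable_const.indicator (hms k)).aestronglyMeasurable) (hi k).aestronglyMeasurable,
    integral_indicator_const _ (hms k), hunif k hk]
  simp

/-- Integrate `‖v‖ ≤ ‖v‖²/(2c) + c/2`. -/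
theorem integral_norm_le_of_integral_sq_le {E : Type*} [NormedAddCommGroup E] {v : Ω → E} {c : ℝ}
    (hc : 0 < c) (hv : AEStronglyMeasurable v P) (hi : Integrable (fun ω => ‖v ω‖ ^ 2) P)
    (hle : ∫ ω, ‖v ω‖ ^ 2 ∂P ≤ c ^ 2) : Integrable v P ∧ ∫ ω, ‖v ω‖ ∂P ≤ c := by
  have hvi : Integrable v P :=
    ((memLp_two_iff_integrable_sq_norm hv).2 hi).integrable (by norm_num)
  refine ⟨hvi, ?_⟩
  have h1 : ∫ ω, ‖v ω‖ ∂P ≤ ∫ ω, (1 / (2 * c) * ‖v ω‖ ^ 2 + c / 2) ∂P := by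
    refine integral_mono hvi.norm ((hi.const_mul _).add (integrable_const _)) fun ω => ?_
    have : 1 / (2 * c) * ‖v ω‖ ^ 2 + c / 2 - ‖v ω‖ = 1 / (2 * c) * (‖v ω‖ - c) ^ 2 := by
      field_simp
      ring
    have h2 : 0 ≤ 1 / (2 * c) * (‖v ω‖ - c) ^ 2 := by positivity
    change ‖v ω‖ ≤ 1 / (2 * c) * ‖v ω‖ ^ 2 + c / 2
    linarith
  rw [integral_add (hi.const_mul _) (integrable_const _), integral_const_mul] at h1
  have h2 := mul_le_mul_of_nonneg_left hle (show 0 ≤ 1 / (2 * c) by positivity)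
  have h3 : 1 / (2 * c) * c ^ 2 = c / 2 := by field_simp
  simp only [integral_const, probReal_univ, one_smul] at h1
  linarith

end Probability

/-! ### Measurability of the iterates and independence from the next sample. -/

section StateMeasurable

variable {dx dy dz : ℕ} {Ξ A : Type*} [MeasurableSpace Ξ] [MeasurableSpace A]

instance : MeasurableSpace (State dx dy dz) :=
  MeasurableSpace.comap (fun S => (S.x, S.xφ, S.xψ, S.y, S.z)) inferInstance

theorem measurable_state_tuple :
    Measurable fun S : State dx dy dz => (S.x, S.xφ, S.xψ, S.y, S.z) :=
  comap_measurable _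

theorem measurable_state_x : Measurable (State.x : State dx dy dz → _) :=
  measurable_state_tuple.fst

theorem measurable_state_xφ : Measurable (State.xφ : State dx dy dz → _) :=
  measurable_state_tuple.snd.fst

theorem measurable_state_xψ : Measurable (State.xψ : State dx dy dz → _) :=
  measurable_state_tuple.snd.snd.fst

theorem measurable_state_y : Measurable (State.y : State dx dy dz → _) :=
  measurable_state_tuple.snd.snd.snd.fst

theorem measurable_state_z : Measurable (State.z : State dx dy dz → _) :=
  measurable_state_tuple.snd.snd.snd.snd

theorem measurable_state_of_components {F : A → State dx dy dz} (hx : Measurable fun q => (F q).x)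
    (hxφ : Measurable fun q => (F q).xφ) (hxψ : Measurable fun q => (F q).xψ)
    (hy : Measurable fun q => (F q).y) (hz : Measurable fun q => (F q).z) : Measurable F :=
  measurable_comap_iff.2 (hx.prodMk (hxφ.prodMk (hxψ.prodMk (hy.prodMk hz))))

variable {prob : DMax dx dy dz} {g : Oracle dx dy dz Ξ} {γ η₀ η₁ : ℝ}

theorem measurable_step (hY : Continuous (proj prob.Y)) (hZ : Continuous (proj prob.Z))
    (h1 : Measurable fun q : Vec dx × Vec dy × Ξ => g.gxφ q.1 q.2.1 q.2.2)
    (h2 : Measurable fun q : Vec dx × Vec dy × Ξ => g.gyφ q.1 q.2.1 q.2.2)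
    (h3 : Measurable fun q : Vec dx × Vec dz × Ξ => g.gxψ q.1 q.2.1 q.2.2)
    (h4 : Measurable fun q : Vec dx × Vec dz × Ξ => g.gzψ q.1 q.2.1 q.2.2) :
    Measurable fun q : State dx dy dz × Ξ => step prob γ η₀ η₁ g q.1 q.2 := by
  have mx : Measurable fun q : State dx dy dz × Ξ => q.1.x :=
    measurable_state_x.comp measurable_fst
  have mxφ : Measurable fun q : State dx dy dz × Ξ => q.1.xφ :=
    measurable_state_xφ.comp measurable_fst
  have mxψ : Measurable fun q : State dx dy dz × Ξ => q.1.xψ :=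
    measurable_state_xψ.comp measurable_fst
  have my : Measurable fun q : State dx dy dz × Ξ => q.1.y :=
    measurable_state_y.comp measurable_fst
  have mz : Measurable fun q : State dx dy dz × Ξ => q.1.z :=
    measurable_state_z.comp measurable_fst
  have k1 : Measurable fun q : State dx dy dz × Ξ => g.gxφ q.1.xφ q.1.y q.2 :=
    h1.comp (mxφ.prodMk (my.prodMk measurable_snd))
  have k2 : Measurable fun q : State dx dy dz × Ξ => g.gyφ q.1.xφ q.1.y q.2 :=
    h2.comp (mxφ.prodMk (my.prodMk measurable_snd))
  have k3 : Measurable fun q : State dx dy dz × Ξ => g.gxψ q.1.xψ q.1.z q.2 :=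
    h3.comp (mxψ.prodMk (mz.prodMk measurable_snd))
  have k4 : Measurable fun q : State dx dy dz × Ξ => g.gzψ q.1.xψ q.1.z q.2 :=
    h4.comp (mxψ.prodMk (mz.prodMk measurable_snd))
  have nφ : Measurable fun q : State dx dy dz × Ξ =>
      q.1.xφ - η₁ • (g.gxφ q.1.xφ q.1.y q.2 + (1 / γ) • (q.1.xφ - q.1.x)) := by fun_prop
  have nψ : Measurable fun q : State dx dy dz × Ξ =>
      q.1.xψ - η₁ • (g.gxψ q.1.xψ q.1.z q.2 + (1 / γ) • (q.1.xψ - q.1.x)) := by fun_prop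
  apply measurable_state_of_components
  · exact mx.sub ((((mx.sub nφ).const_smul (1 / γ)).sub
      ((mx.sub nψ).const_smul (1 / γ))).const_smul η₀)
  · exact nφ
  · exact nψ
  · exact hY.measurable.comp (my.add (k2.const_smul η₁))
  · exact hZ.measurable.comp (mz.add (k4.const_smul η₁))

theorem measurable_iter
    (hstep : Measurable fun q : State dx dy dz × Ξ => step prob γ η₀ η₁ g q.1 q.2)
    (S₀ : State dx dy dz) (t : ℕ) :
    Measurable fun ξ : ℕ → Ξ => iter prob γ η₀ η₁ g S₀ ξ t := by
  induction t with
  | zero => exact measurable_const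
  | succ t ih => exact hstep.comp (ih.prodMk (measurable_pi_apply t))

omit [MeasurableSpace Ξ] in
theorem iter_congr (S₀ : State dx dy dz) {ξ ξ' : ℕ → Ξ} {t : ℕ} (h : ∀ i < t, ξ i = ξ' i) :
    iter prob γ η₀ η₁ g S₀ ξ t = iter prob γ η₀ η₁ g S₀ ξ' t := by
  induction t with
  | zero => rfl
  | succ t ih =>
    rw [iter, iter, ih fun i hi => h i (Nat.lt_succ_of_lt hi), h t (Nat.lt_succ_self t)]

/-- The state at time `t` is a function of the samples before `t` alone. The default `ξ₀` pads a
finite tuple of samples to a sequence; by `iter_congr` its value is irrelevant. -/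
theorem indepFun_iter {Ω : Type*} [MeasurableSpace Ω] {P : Measure Ω} {ξ : ℕ → Ω → Ξ}
    (hstep : Measurable fun q : State dx dy dz × Ξ => step prob γ η₀ η₁ g q.1 q.2)
    (S₀ : State dx dy dz) (hξ : ∀ t, Measurable (ξ t)) (hind : iIndepFun ξ P) (ξ₀ : Ξ) (t : ℕ) :
    IndepFun (fun ω => iter prob γ η₀ η₁ g S₀ (fun i => ξ i ω) t) (ξ t) P := by
  have h := hind.indepFun_finset (Finset.range t) {t} (by simp) hξ
  let ext : (Finset.range t → Ξ) → ℕ → Ξ := fun r i =>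
    if hi : i ∈ Finset.range t then r ⟨i, hi⟩ else ξ₀
  have hext : Measurable ext := by
    refine measurable_pi_lambda _ fun i => ?_
    by_cases hi : i ∈ Finset.range t
    · simpa only [ext, hi, dite_true] using measurable_pi_apply _
    · simpa only [ext, hi, dite_false] using measurable_const
  have h2 := h.comp ((measurable_iter hstep S₀ t).comp hext)
    (measurable_pi_apply (⟨t, by simp⟩ : ({t} : Finset ℕ)))
  have e : ((fun ξ : ℕ → Ξ => iter prob γ η₀ η₁ g S₀ ξ t) ∘ ext) ∘
      (fun (ω : Ω) (i : Finset.range t) => ξ i ω)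
      = fun ω => iter prob γ η₀ η₁ g S₀ (fun i => ξ i ω) t := by
    funext ω
    apply iter_congr
    intro i hi
    simp [ext, hi]
  rw [e] at h2
  exact h2

end StateMeasurable

/-! ### Smoothness of `F_γ` and pathwise inequalities for one step. -/

section Recursion

variable {dx dy dz : ℕ} {prob : DMax dx dy dz} {p : Params}

/-- Assumptions on the problem and the constants under which the smoothed objective is smooth. -/
structure Regular (prob : DMax dx dy dz) (p : Params) : Prop where
  hφ : IsComponent prob.φ prob.Y p.δφ p.μφ p.Lφ
  hψ : IsComponent prob.ψ prob.Z p.δψ p.μψ p.Lψ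
  hM : 0 < p.M
  hγ : 0 < p.γ
  hγφ : p.γ * p.δφ < 1
  hγψ : p.γ * p.δψ < 1

namespace Regular

theorem wcΦ (h : Regular prob p) : WeaklyConvex p.δφ prob.Φ := h.hφ.weaklyConvex_maxValue

theorem wcΨ (h : Regular prob p) : WeaklyConvex p.δψ prob.Ψ := h.hψ.weaklyConvex_maxValue

theorem hasGradientAt_envF (h : Regular prob p) (x : Vec dx) :
    HasGradientAt (prob.envF p.γ)
      ((1 / p.γ) • (prox p.γ prob.Ψ x - prox p.γ prob.Φ x)) x := by
  have h1 := h.wcΦ.hasGradientAt_moreauEnvelope h.hγ h.hγφ x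
  have h2 := h.wcΨ.hasGradientAt_moreauEnvelope h.hγ h.hγψ x
  rw [hasGradientAt_iff_hasFDerivAt] at h1 h2 ⊢
  refine (h1.sub h2).congr_fderiv ?_
  rw [← map_sub]
  congr 1
  module

theorem gradient_envF (h : Regular prob p) (x : Vec dx) :
    gradient (prob.envF p.γ) x = (1 / p.γ) • (prox p.γ prob.Ψ x - prox p.γ prob.Φ x) :=
  (h.hasGradientAt_envF x).gradient

theorem differentiable_envF (h : Regular prob p) : Differentiable ℝ (prob.envF p.γ) := fun x =>
  (h.hasGradientAt_envF x).differentiableAt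

/-- Upper bound for the envelope of `Φ` minus lower bound for that of `Ψ`; the terms `1/(2γ)`
cancel, so only the modulus of `Ψ` enters. -/
theorem envF_le (h : Regular prob p) (x x' : Vec dx) :
    prob.envF p.γ x' ≤ prob.envF p.γ x + inner ℝ (gradient (prob.envF p.γ) x) (x' - x)
      + 1 / (p.γ ^ 2 * (1 / p.γ - p.δψ)) * ‖x' - x‖ ^ 2 := by
  have h1 := h.wcΦ.moreauEnvelope_le h.hγ h.hγφ x x'
  have h2 := h.wcΨ.le_moreauEnvelope h.hγ h.hγψ x x'
  have e : gradient (prob.envF p.γ) x = (1 / p.γ) • (x - prox p.γ prob.Φ x)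
      - (1 / p.γ) • (x - prox p.γ prob.Ψ x) := by
    rw [h.gradient_envF]; module
  rw [e, inner_sub_left]
  unfold DMax.envF
  linarith

/-- Descent of the smoothed objective along an inexact gradient step. -/
theorem envF_descent (h : Regular prob p) {η₀ : ℝ} (hη₀ : 0 < η₀)
    (hL : η₀ * (1 / (p.γ ^ 2 * (1 / p.γ - p.δψ))) ≤ 1 / 4) (x u w : Vec dx) :
    prob.envF p.γ (x - η₀ • ((1 / p.γ) • (x - u) - (1 / p.γ) • (x - w)))
      ≤ prob.envF p.γ x - η₀ / 2 * ‖gradient (prob.envF p.γ) x‖ ^ 2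
        - 1 / (4 * η₀) * ‖η₀ • ((1 / p.γ) • (x - u) - (1 / p.γ) • (x - w))‖ ^ 2
        + η₀ / p.γ ^ 2 * (‖u - prox p.γ prob.Φ x‖ ^ 2 + ‖w - prox p.γ prob.Ψ x‖ ^ 2) := by
  have hγ := h.hγ
  set G := (1 / p.γ) • (x - u) - (1 / p.γ) • (x - w) with hG
  have h1 := h.envF_le x (x - η₀ • G)
  set v := gradient (prob.envF p.γ) x with hv
  have e1 : x - η₀ • G - x = -(η₀ • G) := by abel
  rw [e1, norm_neg, inner_neg_right, real_inner_smul_right, norm_smul,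
    Real.norm_of_nonneg hη₀.le, mul_pow] at h1
  rw [norm_smul, Real.norm_of_nonneg hη₀.le, mul_pow]
  have e2 : v - G = (1 / p.γ) • ((u - prox p.γ prob.Φ x) - (w - prox p.γ prob.Ψ x)) := by
    rw [hv, h.gradient_envF, hG]; module
  have h2 : ‖v - G‖ ^ 2 ≤ 2 / p.γ ^ 2 *
      (‖u - prox p.γ prob.Φ x‖ ^ 2 + ‖w - prox p.γ prob.Ψ x‖ ^ 2) := by
    rw [e2, norm_smul, Real.norm_of_nonneg (by positivity), mul_pow]
    have a1 := norm_sub_le (u - prox p.γ prob.Φ x) (w - prox p.γ prob.Ψ x)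
    have a2 := pow_le_pow_left₀ (norm_nonneg _) a1 2
    have a3 : ‖u - prox p.γ prob.Φ x - (w - prox p.γ prob.Ψ x)‖ ^ 2
        ≤ 2 * (‖u - prox p.γ prob.Φ x‖ ^ 2 + ‖w - prox p.γ prob.Ψ x‖ ^ 2) := by
      nlinarith [sq_nonneg (‖u - prox p.γ prob.Φ x‖ - ‖w - prox p.γ prob.Ψ x‖)]
    have a4 := mul_le_mul_of_nonneg_left a3 (show 0 ≤ (1 / p.γ) ^ 2 by positivity)
    refine a4.trans (le_of_eq ?_)
    field_simp
  -- Polarization of `-η₀⟨v, G⟩` yields `-η₀/2 ‖G‖²`. By `hL`, half of it absorbs the smoothness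
  -- term; the other half is kept to pay for the drift of the saddle points.
  have h3 : ‖v - G‖ ^ 2 = ‖v‖ ^ 2 - 2 * inner ℝ v G + ‖G‖ ^ 2 := norm_sub_sq_real v G
  have h4 := mul_le_mul_of_nonneg_left hL (show 0 ≤ η₀ * ‖G‖ ^ 2 by positivity)
  have h5 := mul_le_mul_of_nonneg_left h2 (show 0 ≤ η₀ / 2 by positivity)
  have e3 : 1 / (4 * η₀) * (η₀ ^ 2 * ‖G‖ ^ 2) = η₀ * ‖G‖ ^ 2 * (1 / 4) := by field_simp
  have e4 : η₀ / 2 * (2 / p.γ ^ 2 *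
      (‖u - prox p.γ prob.Φ x‖ ^ 2 + ‖w - prox p.γ prob.Ψ x‖ ^ 2))
      = η₀ / p.γ ^ 2 * (‖u - prox p.γ prob.Φ x‖ ^ 2 + ‖w - prox p.γ prob.Ψ x‖ ^ 2) := by ring
  rw [e4, h3] at h5
  rw [e3]
  linarith

end Regular

/-- Step sizes small enough for the Lyapunov argument. -/
structure StepSizes (p : Params) (η₀ η₁ a : ℝ) : Prop where
  η₀_pos : 0 < η₀
  η₁_pos : 0 < η₁
  a_pos : 0 < a
  le_φ : 4 * a ≤ 1 / p.γ - p.δφ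
  le_ψ : 4 * a ≤ 1 / p.γ - p.δψ
  le_μφ : a ≤ p.μφ
  le_μψ : a ≤ p.μψ
  mul_le_one : η₁ * a ≤ 1
  η₁_le_φ : η₁ ≤ p.γ ^ 2 * (1 / p.γ - p.δφ) / 2
  η₁_le_ψ : η₁ ≤ p.γ ^ 2 * (1 / p.γ - p.δψ) / 2
  smooth : η₀ * (1 / (p.γ ^ 2 * (1 / p.γ - p.δψ))) ≤ 1 / 4
  drift_φ : 2 * η₀ / (η₁ * p.γ ^ 2 * a) *
    ((1 / a + p.Lφ ^ 2 / p.μφ ^ 3) / (16 * p.γ ^ 2 * a ^ 2 * η₁)) ≤ 1 / (8 * η₀)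
  drift_ψ : 2 * η₀ / (η₁ * p.γ ^ 2 * a) *
    ((1 / a + p.Lψ ^ 2 / p.μψ ^ 3) / (16 * p.γ ^ 2 * a ^ 2 * η₁)) ≤ 1 / (8 * η₀)

variable {Ξ : Type*}

/-- Squared distance of the `φ`-variables after one step to the saddle point. -/
def distφ (prob : DMax dx dy dz) (γ η : ℝ) (g : Oracle dx dy dz Ξ) (S : State dx dy dz)
    (s : Ξ) : ℝ := stepDist prob.φ prob.Y γ η g.gxφ g.gyφ S.x S.xφ S.y s

/-- Squared distance of the `ψ`-variables after one step to the saddle point. -/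
def distψ (prob : DMax dx dy dz) (γ η : ℝ) (g : Oracle dx dy dz Ξ) (S : State dx dy dz)
    (s : Ξ) : ℝ := stepDist prob.ψ prob.Z γ η g.gxψ g.gzψ S.x S.xψ S.z s

variable {g : Oracle dx dy dz Ξ} {η₀ η₁ a : ℝ}

theorem errφ_step_le (S : State dx dy dz) (s : Ξ) :
    errφ prob p.γ S (step prob p.γ η₀ η₁ g S s) ≤ distφ prob p.γ η₁ g S s :=
  le_add_of_nonneg_right (by positivity)

theorem errψ_step_le (S : State dx dy dz) (s : Ξ) :
    errψ prob p.γ S (step prob p.γ η₀ η₁ g S s) ≤ distψ prob p.γ η₁ g S s :=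
  le_add_of_nonneg_right (by positivity)

theorem Regular.descent_step (h : Regular prob p) (hs : StepSizes p η₀ η₁ a)
    (S : State dx dy dz) (s : Ξ) :
    prob.envF p.γ (step prob p.γ η₀ η₁ g S s).x ≤ prob.envF p.γ S.x
      - η₀ / 2 * gradSq prob p.γ S
      - 1 / (4 * η₀) * ‖S.x - (step prob p.γ η₀ η₁ g S s).x‖ ^ 2
      + η₀ / p.γ ^ 2 * (distφ prob p.γ η₁ g S s + distψ prob p.γ η₁ g S s) := by
  have hd := h.envF_descent hs.η₀_pos hs.smooth S.x (step prob p.γ η₀ η₁ g S s).xφ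
    (step prob p.γ η₀ η₁ g S s).xψ
  have h1 := errφ_step_le (prob := prob) (p := p) (η₀ := η₀) (η₁ := η₁) (g := g) S s
  have h2 := errψ_step_le (prob := prob) (p := p) (η₀ := η₀) (η₁ := η₁) (g := g) S s
  have h3 := mul_le_mul_of_nonneg_left (add_le_add h1 h2)
    (show 0 ≤ η₀ / p.γ ^ 2 from div_nonneg hs.η₀_pos.le (sq_nonneg _))
  have e : S.x - (step prob p.γ η₀ η₁ g S s).x
      = η₀ • ((1 / p.γ) • (S.x - (step prob p.γ η₀ η₁ g S s).xφ)
        - (1 / p.γ) • (S.x - (step prob p.γ η₀ η₁ g S s).xψ)) := sub_sub_cancel _ _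
  rw [e]
  unfold errφ errψ at h3
  unfold gradSq
  exact hd.trans (by linarith)

/-- The `φ`-part of the Lyapunov function. -/
def potφ (prob : DMax dx dy dz) (p : Params) (η a : ℝ) (S : State dx dy dz) : ℝ :=
  potential prob.φ prob.Y p.γ p.μφ p.M η a S.x S.xφ S.y

/-- The `ψ`-part of the Lyapunov function. -/
def potψ (prob : DMax dx dy dz) (p : Params) (η a : ℝ) (S : State dx dy dz) : ℝ :=
  potential prob.ψ prob.Z p.γ p.μψ p.M η a S.x S.xψ S.z

theorem Regular.potφ_step_le (h : Regular prob p) (hs : StepSizes p η₀ η₁ a)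
    (S : State dx dy dz) (s : Ξ) :
    potφ prob p η₁ a (step prob p.γ η₀ η₁ g S s) ≤ (1 - η₁ * a) * distφ prob p.γ η₁ g S s
      + (1 / a + p.Lφ ^ 2 / p.μφ ^ 3) / (16 * p.γ ^ 2 * a ^ 2 * η₁)
        * ‖S.x - (step prob p.γ η₀ η₁ g S s).x‖ ^ 2 + 9 * η₁ ^ 2 * p.M ^ 2 :=
  h.hφ.potential_le h.hγ h.hγφ hs.η₁_pos hs.a_pos hs.le_φ hs.le_μφ hs.mul_le_one _ _ _ _

theorem Regular.potψ_step_le (h : Regular prob p) (hs : StepSizes p η₀ η₁ a)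
    (S : State dx dy dz) (s : Ξ) :
    potψ prob p η₁ a (step prob p.γ η₀ η₁ g S s) ≤ (1 - η₁ * a) * distψ prob p.γ η₁ g S s
      + (1 / a + p.Lψ ^ 2 / p.μψ ^ 3) / (16 * p.γ ^ 2 * a ^ 2 * η₁)
        * ‖S.x - (step prob p.γ η₀ η₁ g S s).x‖ ^ 2 + 9 * η₁ ^ 2 * p.M ^ 2 :=
  h.hψ.potential_le h.hγ h.hγψ hs.η₁_pos hs.a_pos hs.le_ψ hs.le_μψ hs.mul_le_one _ _ _ _

end Recursion

/-! ### Integrability and the Lyapunov argument in expectation. -/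

section Trajectory

variable {dx dy dz : ℕ} {prob : DMax dx dy dz} {p : Params} {η₀ η₁ a Fstar : ℝ}
  {Ξ : Type*} [MeasurableSpace Ξ] {D : Measure Ξ} [IsProbabilityMeasure D]
  {g : Oracle dx dy dz Ξ} {Ω : Type*} [MeasurableSpace Ω] {P : Measure Ω} [IsProbabilityMeasure P]
  {ξ : ℕ → Ω → Ξ} {S₀ : State dx dy dz} {S : ℕ → Ω → State dx dy dz}

/-- `S` is the random sequence of iterates driven by independent samples `ξ` of law `D`. -/
structure IsTrajectory (prob : DMax dx dy dz) (p : Params) (η₀ η₁ : ℝ) (D : Measure Ξ)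
    (g : Oracle dx dy dz Ξ) (P : Measure Ω) (ξ : ℕ → Ω → Ξ) (S₀ : State dx dy dz)
    (S : ℕ → Ω → State dx dy dz) : Prop where
  oφ : IsOracle D prob.φ prob.Y p.M g.gxφ g.gyφ
  oψ : IsOracle D prob.ψ prob.Z p.M g.gxψ g.gzψ
  y₀_mem : S₀.y ∈ prob.Y
  z₀_mem : S₀.z ∈ prob.Z
  measurable_sample : ∀ t, Measurable (ξ t)
  law : ∀ t, P.map (ξ t) = D
  indep : iIndepFun ξ P
  eq_iter : ∀ t ω, S t ω = iter prob p.γ η₀ η₁ g S₀ (fun i => ξ i ω) t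

namespace IsTrajectory

omit [IsProbabilityMeasure D] [IsProbabilityMeasure P] in
theorem succ (hT : IsTrajectory prob p η₀ η₁ D g P ξ S₀ S) (t : ℕ) (ω : Ω) :
    S (t + 1) ω = step prob p.γ η₀ η₁ g (S t ω) (ξ t ω) := by
  rw [hT.eq_iter, hT.eq_iter, iter]

omit [IsProbabilityMeasure D] [IsProbabilityMeasure P] in
theorem zero (hT : IsTrajectory prob p η₀ η₁ D g P ξ S₀ S) (ω : Ω) : S 0 ω = S₀ := by
  rw [hT.eq_iter, iter]

omit [IsProbabilityMeasure D] [IsProbabilityMeasure P] in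
theorem mem (hT : IsTrajectory prob p η₀ η₁ D g P ξ S₀ S) (h : Regular prob p) (t : ℕ) (ω : Ω) :
    (S t ω).y ∈ prob.Y ∧ (S t ω).z ∈ prob.Z := by
  cases t with
  | zero => rw [hT.zero]; exact ⟨hT.y₀_mem, hT.z₀_mem⟩
  | succ t =>
    rw [hT.succ]
    exact ⟨(proj_spec h.hφ.nonempty h.hφ.compact _).1, (proj_spec h.hψ.nonempty h.hψ.compact _).1⟩

omit [IsProbabilityMeasure D] [IsProbabilityMeasure P] in
theorem measurable_step (hT : IsTrajectory prob p η₀ η₁ D g P ξ S₀ S) (h : Regular prob p) :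
    Measurable fun q : State dx dy dz × Ξ => step prob p.γ η₀ η₁ g q.1 q.2 :=
  SMAG.measurable_step (continuous_proj h.hφ.nonempty h.hφ.convex h.hφ.compact)
    (continuous_proj h.hψ.nonempty h.hψ.convex h.hψ.compact)
    hT.oφ.measurable_gx hT.oφ.measurable_gy hT.oψ.measurable_gx hT.oψ.measurable_gy

omit [IsProbabilityMeasure D] [IsProbabilityMeasure P] in
theorem measurable_state (hT : IsTrajectory prob p η₀ η₁ D g P ξ S₀ S) (h : Regular prob p)
    (t : ℕ) : Measurable (S t) := by
  have e : S t = (fun ξ : ℕ → Ξ => iter prob p.γ η₀ η₁ g S₀ ξ t) ∘ fun ω i => ξ i ω :=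
    funext (hT.eq_iter t)
  rw [e]
  exact (measurable_iter (hT.measurable_step h) S₀ t).comp
    (measurable_pi_lambda _ hT.measurable_sample)

omit [IsProbabilityMeasure P] in
theorem indepFun_state (hT : IsTrajectory prob p η₀ η₁ D g P ξ S₀ S) (h : Regular prob p)
    (t : ℕ) : IndepFun (S t) (ξ t) P := by
  have e : S t = fun ω => iter prob p.γ η₀ η₁ g S₀ (fun i => ξ i ω) t := funext (hT.eq_iter t)
  rw [e]
  -- The sample space is nonempty because it carries a probability measure.
  obtain ⟨ξ₀⟩ := (inferInstance : (ae D).NeBot).nonempty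
  exact indepFun_iter (hT.measurable_step h) S₀ hT.measurable_sample hT.indep ξ₀ t

end IsTrajectory

variable {m n : ℕ} {f : Vec m → Vec n → ℝ} {Y : Set (Vec n)} {δ μ L γ M : ℝ}

theorem IsComponent.measurable_stepDist (hf : IsComponent f Y δ μ L) (hγ : 0 < γ)
    (hγδ : γ * δ < 1) {gx : Vec m → Vec n → Ξ → Vec m} {gy : Vec m → Vec n → Ξ → Vec n}
    (hx : Measurable fun q : Vec m × Vec n × Ξ => gx q.1 q.2.1 q.2.2)
    (hy : Measurable fun q : Vec m × Vec n × Ξ => gy q.1 q.2.1 q.2.2)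
    {A : Type*} [MeasurableSpace A] {x u : A → Vec m} {y : A → Vec n} {s : A → Ξ}
    (mx : Measurable x) (mu : Measurable u) (my : Measurable y) (ms : Measurable s) (η : ℝ) :
    Measurable fun q => stepDist f Y γ η gx gy (x q) (u q) (y q) (s q) := by
  have k1 : Measurable fun q => gx (u q) (y q) (s q) := hx.comp (mu.prodMk (my.prodMk ms))
  have k2 : Measurable fun q => gy (u q) (y q) (s q) := hy.comp (mu.prodMk (my.prodMk ms))
  have c1 := hf.weaklyConvex_maxValue.continuous_prox hγ hγδ
  have c2 := hf.continuous_argMax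
  have c3 := continuous_proj hf.nonempty hf.convex hf.compact
  have k3 : Measurable fun q => prox γ (maxValue f Y) (x q) := c1.measurable.comp mx
  have k4 : Measurable fun q => argMax f Y (prox γ (maxValue f Y) (x q)) :=
    c2.measurable.comp k3
  have k5 : Measurable fun q => proj Y (y q + η • gy (u q) (y q) (s q)) :=
    c3.measurable.comp (my.add (k2.const_smul η))
  unfold stepDist
  fun_prop

theorem IsComponent.measurable_potential (hf : IsComponent f Y δ μ L) (hγ : 0 < γ)
    (hγδ : γ * δ < 1) {A : Type*} [MeasurableSpace A] {x u : A → Vec m} {y : A → Vec n}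
    (mx : Measurable x) (mu : Measurable u) (my : Measurable y) (M η a : ℝ) :
    Measurable fun q => potential f Y γ μ M η a (x q) (u q) (y q) := by
  have k3 : Measurable fun q => prox γ (maxValue f Y) (x q) :=
    (hf.weaklyConvex_maxValue.continuous_prox hγ hγδ).measurable.comp mx
  have k4 : Measurable fun q => argMax f Y (prox γ (maxValue f Y) (x q)) :=
    hf.continuous_argMax.measurable.comp k3
  unfold potential
  fun_prop

namespace IsTrajectory

omit [IsProbabilityMeasure D] [IsProbabilityMeasure P] in
theorem measurable_distφ (hT : IsTrajectory prob p η₀ η₁ D g P ξ S₀ S) (h : Regular prob p) :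
    Measurable fun q : State dx dy dz × Ξ => distφ prob p.γ η₁ g q.1 q.2 :=
  h.hφ.measurable_stepDist h.hγ h.hγφ hT.oφ.measurable_gx hT.oφ.measurable_gy
    (measurable_state_x.comp measurable_fst) (measurable_state_xφ.comp measurable_fst)
    (measurable_state_y.comp measurable_fst) measurable_snd η₁

omit [IsProbabilityMeasure D] [IsProbabilityMeasure P] in
theorem measurable_distψ (hT : IsTrajectory prob p η₀ η₁ D g P ξ S₀ S) (h : Regular prob p) :
    Measurable fun q : State dx dy dz × Ξ => distψ prob p.γ η₁ g q.1 q.2 :=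
  h.hψ.measurable_stepDist h.hγ h.hγψ hT.oψ.measurable_gx hT.oψ.measurable_gy
    (measurable_state_x.comp measurable_fst) (measurable_state_xψ.comp measurable_fst)
    (measurable_state_z.comp measurable_fst) measurable_snd η₁

/-- One stochastic step contracts the distance to the saddle point of the `φ`-part. -/
theorem integral_distφ_le (hT : IsTrajectory prob p η₀ η₁ D g P ξ S₀ S) (h : Regular prob p)
    (hs : StepSizes p η₀ η₁ a) (t : ℕ)
    (hi : Integrable (fun ω => potφ prob p η₁ a (S t ω)) P) :
    Integrable (fun ω => distφ prob p.γ η₁ g (S t ω) (ξ t ω)) P ∧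
      ∫ ω, distφ prob p.γ η₁ g (S t ω) (ξ t ω) ∂P ≤ ∫ ω, potφ prob p η₁ a (S t ω) ∂P := by
  refine integrable_and_integral_le_of_indepFun (hT.measurable_state h t)
    (hT.measurable_sample t) (hT.indepFun_state h t) (hT.measurable_distφ h)
    (fun S s => stepDist_nonneg _ _ _ _) (fun ω => ?_) hi
  rw [hT.law]
  exact hT.oφ.stepDist_integral_le_potential h.hφ h.hM.le h.hγ h.hγφ hs.η₁_pos.le hs.le_φ
    hs.η₁_le_φ _ _ (hT.mem h t ω).1

/-- One stochastic step contracts the distance to the saddle point of the `ψ`-part. -/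
theorem integral_distψ_le (hT : IsTrajectory prob p η₀ η₁ D g P ξ S₀ S) (h : Regular prob p)
    (hs : StepSizes p η₀ η₁ a) (t : ℕ)
    (hi : Integrable (fun ω => potψ prob p η₁ a (S t ω)) P) :
    Integrable (fun ω => distψ prob p.γ η₁ g (S t ω) (ξ t ω)) P ∧
      ∫ ω, distψ prob p.γ η₁ g (S t ω) (ξ t ω) ∂P ≤ ∫ ω, potψ prob p η₁ a (S t ω) ∂P := by
  refine integrable_and_integral_le_of_indepFun (hT.measurable_state h t)
    (hT.measurable_sample t) (hT.indepFun_state h t) (hT.measurable_distψ h)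
    (fun S s => stepDist_nonneg _ _ _ _) (fun ω => ?_) hi
  rw [hT.law]
  exact hT.oψ.stepDist_integral_le_potential h.hψ h.hM.le h.hγ h.hγψ hs.η₁_pos.le hs.le_ψ
    hs.η₁_le_ψ _ _ (hT.mem h t ω).2

omit [IsProbabilityMeasure P] in
-- Not visible from the formula, whose coefficient `1 - 2ημ` may be negative; it holds because the
-- potential dominates the expectation of a squared distance.
theorem potφ_nonneg (hT : IsTrajectory prob p η₀ η₁ D g P ξ S₀ S) (h : Regular prob p)
    (hs : StepSizes p η₀ η₁ a) (t : ℕ) (ω : Ω) : 0 ≤ potφ prob p η₁ a (S t ω) :=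
  (integral_nonneg fun s => stepDist_nonneg _ _ _ s).trans
    (hT.oφ.stepDist_integral_le_potential h.hφ h.hM.le h.hγ h.hγφ hs.η₁_pos.le hs.le_φ
    hs.η₁_le_φ (S t ω).x (S t ω).xφ (hT.mem h t ω).1).2

omit [IsProbabilityMeasure P] in
theorem potψ_nonneg (hT : IsTrajectory prob p η₀ η₁ D g P ξ S₀ S) (h : Regular prob p)
    (hs : StepSizes p η₀ η₁ a) (t : ℕ) (ω : Ω) : 0 ≤ potψ prob p η₁ a (S t ω) :=
  (integral_nonneg fun s => stepDist_nonneg _ _ _ s).trans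
    (hT.oψ.stepDist_integral_le_potential h.hψ h.hM.le h.hγ h.hγψ hs.η₁_pos.le hs.le_ψ
    hs.η₁_le_ψ (S t ω).x (S t ω).xψ (hT.mem h t ω).2).2

omit [IsProbabilityMeasure D] [IsProbabilityMeasure P] in
theorem measurable_envF (hT : IsTrajectory prob p η₀ η₁ D g P ξ S₀ S) (h : Regular prob p)
    (t : ℕ) : Measurable fun ω => prob.envF p.γ (S t ω).x :=
  h.differentiable_envF.continuous.measurable.comp
    (measurable_state_x.comp (hT.measurable_state h t))

theorem _root_.SMAG.Regular.continuous_gradient_envF (h : Regular prob p) :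
    Continuous (gradient (prob.envF p.γ)) := by
  have e : gradient (prob.envF p.γ)
      = fun x => (1 / p.γ) • (prox p.γ prob.Ψ x - prox p.γ prob.Φ x) := funext h.gradient_envF
  have h1 := h.wcΨ.continuous_prox h.hγ h.hγψ
  have h2 := h.wcΦ.continuous_prox h.hγ h.hγφ
  rw [e]
  fun_prop

omit [IsProbabilityMeasure D] [IsProbabilityMeasure P] in
theorem measurable_gradient (hT : IsTrajectory prob p η₀ η₁ D g P ξ S₀ S) (h : Regular prob p)
    (t : ℕ) : Measurable fun ω => gradient (prob.envF p.γ) (S t ω).x :=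
  h.continuous_gradient_envF.measurable.comp
    (measurable_state_x.comp (hT.measurable_state h t))

omit [IsProbabilityMeasure D] [IsProbabilityMeasure P] in
theorem measurable_displacement (hT : IsTrajectory prob p η₀ η₁ D g P ξ S₀ S)
    (h : Regular prob p) (t : ℕ) : Measurable fun ω => ‖(S t ω).x - (S (t + 1) ω).x‖ ^ 2 :=
  ((measurable_state_x.comp (hT.measurable_state h t)).sub
    (measurable_state_x.comp (hT.measurable_state h (t + 1)))).norm.pow_const 2

/-- Integrability passes from one iteration to the next. -/
theorem integrable_of_integrable (hT : IsTrajectory prob p η₀ η₁ D g P ξ S₀ S)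
    (h : Regular prob p) (hs : StepSizes p η₀ η₁ a) (hF : ∀ x, Fstar ≤ prob.envF p.γ x) (t : ℕ)
    (hφ : Integrable (fun ω => distφ prob p.γ η₁ g (S t ω) (ξ t ω)) P)
    (hψ : Integrable (fun ω => distψ prob p.γ η₁ g (S t ω) (ξ t ω)) P)
    (he : Integrable (fun ω => prob.envF p.γ (S t ω).x) P) :
    Integrable (fun ω => prob.envF p.γ (S (t + 1) ω).x) P ∧
    Integrable (fun ω => gradSq prob p.γ (S t ω)) P ∧
    Integrable (fun ω => ‖(S t ω).x - (S (t + 1) ω).x‖ ^ 2) P ∧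
    Integrable (fun ω => potφ prob p η₁ a (S (t + 1) ω)) P ∧
    Integrable (fun ω => potψ prob p η₁ a (S (t + 1) ω)) P := by
  have hη₀ := hs.η₀_pos
  have hd : ∀ ω, prob.envF p.γ (S (t + 1) ω).x ≤ prob.envF p.γ (S t ω).x
      - η₀ / 2 * gradSq prob p.γ (S t ω) - 1 / (4 * η₀) * ‖(S t ω).x - (S (t + 1) ω).x‖ ^ 2
      + η₀ / p.γ ^ 2 * (distφ prob p.γ η₁ g (S t ω) (ξ t ω)
        + distψ prob p.γ η₁ g (S t ω) (ξ t ω)) := by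
    intro ω
    rw [hT.succ]
    exact h.descent_step hs _ _
  -- Because `F_γ` is bounded below, the descent inequality dominates each of its nonnegative terms
  -- by this integrable function.
  set R : Ω → ℝ := fun ω => prob.envF p.γ (S t ω).x - Fstar
    + η₀ / p.γ ^ 2 * (distφ prob p.γ η₁ g (S t ω) (ξ t ω)
        + distψ prob p.γ η₁ g (S t ω) (ξ t ω)) with hR
  have hRi : Integrable R P := (he.sub (integrable_const _)).add ((hφ.add hψ).const_mul _)
  have hg0 : ∀ ω, 0 ≤ η₀ / 2 * gradSq prob p.γ (S t ω) := fun ω => by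
    unfold gradSq; positivity
  have hd0 : ∀ ω, 0 ≤ 1 / (4 * η₀) * ‖(S t ω).x - (S (t + 1) ω).x‖ ^ 2 := fun ω => by positivity
  have i1 : Integrable (fun ω => prob.envF p.γ (S (t + 1) ω).x - Fstar) P := by
    refine hRi.mono' ((hT.measurable_envF h (t + 1)).sub_const _).aestronglyMeasurable
      (Eventually.of_forall fun ω => ?_)
    rw [Real.norm_of_nonneg (sub_nonneg.2 (hF _))]
    simp only [hR]
    linarith [hd ω, hg0 ω, hd0 ω]
  have i2 : Integrable (fun ω => η₀ / 2 * gradSq prob p.γ (S t ω)) P := by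
    refine hRi.mono'
      (((hT.measurable_gradient h t).norm.pow_const 2).const_mul _).aestronglyMeasurable
      (Eventually.of_forall fun ω => ?_)
    rw [Real.norm_of_nonneg (hg0 ω)]
    simp only [hR]
    linarith [hd ω, hd0 ω, hF (S (t + 1) ω).x]
  have i3 : Integrable (fun ω => 1 / (4 * η₀) * ‖(S t ω).x - (S (t + 1) ω).x‖ ^ 2) P := by
    refine hRi.mono' ((hT.measurable_displacement h t).const_mul _).aestronglyMeasurable
      (Eventually.of_forall fun ω => ?_)
    rw [Real.norm_of_nonneg (hd0 ω)]
    simp only [hR]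
    linarith [hd ω, hg0 ω, hF (S (t + 1) ω).x]
  have i3' : Integrable (fun ω => ‖(S t ω).x - (S (t + 1) ω).x‖ ^ 2) P :=
    (integrable_const_mul_iff (IsUnit.mk0 _ (by positivity)) _).1 i3
  have mS := hT.measurable_state h (t + 1)
  refine ⟨?_, (integrable_const_mul_iff (IsUnit.mk0 _ (by positivity)) _).1 i2, i3', ?_, ?_⟩
  · exact (i1.add (integrable_const Fstar)).congr (Eventually.of_forall fun ω => by simp)
  · have hb : Integrable (fun ω => (1 - η₁ * a) * distφ prob p.γ η₁ g (S t ω) (ξ t ω)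
        + (1 / a + p.Lφ ^ 2 / p.μφ ^ 3) / (16 * p.γ ^ 2 * a ^ 2 * η₁)
          * ‖(S t ω).x - (S (t + 1) ω).x‖ ^ 2 + 9 * η₁ ^ 2 * p.M ^ 2) P :=
      ((hφ.const_mul _).add (i3'.const_mul _)).add (integrable_const _)
    refine hb.mono'
      (h.hφ.measurable_potential h.hγ h.hγφ (measurable_state_x.comp mS)
        (measurable_state_xφ.comp mS) (measurable_state_y.comp mS) _ _ _).aestronglyMeasurable
      (Eventually.of_forall fun ω => ?_)
    change ‖potφ prob p η₁ a (S (t + 1) ω)‖ ≤ _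
    rw [Real.norm_of_nonneg (hT.potφ_nonneg h hs _ _), hT.succ]
    exact h.potφ_step_le hs _ _
  · have hb : Integrable (fun ω => (1 - η₁ * a) * distψ prob p.γ η₁ g (S t ω) (ξ t ω)
        + (1 / a + p.Lψ ^ 2 / p.μψ ^ 3) / (16 * p.γ ^ 2 * a ^ 2 * η₁)
          * ‖(S t ω).x - (S (t + 1) ω).x‖ ^ 2 + 9 * η₁ ^ 2 * p.M ^ 2) P :=
      ((hψ.const_mul _).add (i3'.const_mul _)).add (integrable_const _)
    refine hb.mono'
      (h.hψ.measurable_potential h.hγ h.hγψ (measurable_state_x.comp mS)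
        (measurable_state_xψ.comp mS) (measurable_state_z.comp mS) _ _ _).aestronglyMeasurable
      (Eventually.of_forall fun ω => ?_)
    change ‖potψ prob p η₁ a (S (t + 1) ω)‖ ≤ _
    rw [Real.norm_of_nonneg (hT.potψ_nonneg h hs _ _), hT.succ]
    exact h.potψ_step_le hs _ _

/-- Induction from the deterministic initial state; no moment bound uniform in time is needed. -/
theorem integrable_dist (hT : IsTrajectory prob p η₀ η₁ D g P ξ S₀ S)
    (h : Regular prob p) (hs : StepSizes p η₀ η₁ a) (hF : ∀ x, Fstar ≤ prob.envF p.γ x) (t : ℕ) :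
    Integrable (fun ω => distφ prob p.γ η₁ g (S t ω) (ξ t ω)) P ∧
    Integrable (fun ω => distψ prob p.γ η₁ g (S t ω) (ξ t ω)) P ∧
    Integrable (fun ω => prob.envF p.γ (S t ω).x) P := by
  induction t with
  | zero =>
    refine ⟨(hT.integral_distφ_le h hs 0 ?_).1, (hT.integral_distψ_le h hs 0 ?_).1, ?_⟩ <;>
    · simp only [hT.zero]; exact integrable_const _
  | succ t ih =>
    obtain ⟨h1, -, -, h2, h3⟩ := hT.integrable_of_integrable h hs hF t ih.1 ih.2.1 ih.2.2
    exact ⟨(hT.integral_distφ_le h hs _ h2).1, (hT.integral_distψ_le h hs _ h3).1, h1⟩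

theorem integrable_gradSq (hT : IsTrajectory prob p η₀ η₁ D g P ξ S₀ S)
    (h : Regular prob p) (hs : StepSizes p η₀ η₁ a) (hF : ∀ x, Fstar ≤ prob.envF p.γ x) (t : ℕ) :
    Integrable (fun ω => gradSq prob p.γ (S t ω)) P := by
  obtain ⟨h1, h2, h3⟩ := hT.integrable_dist h hs hF t
  exact (hT.integrable_of_integrable h hs hF t h1 h2 h3).2.1

/-- Expected squared distance to the saddle points after iteration `t`. -/
def expDist (prob : DMax dx dy dz) (p : Params) (η₁ : ℝ) (g : Oracle dx dy dz Ξ) (P : Measure Ω)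
    (ξ : ℕ → Ω → Ξ) (S : ℕ → Ω → State dx dy dz) (t : ℕ) : ℝ :=
  ∫ ω, distφ prob p.γ η₁ g (S t ω) (ξ t ω) ∂P + ∫ ω, distψ prob p.γ η₁ g (S t ω) (ξ t ω) ∂P

theorem expDist_zero_le (hT : IsTrajectory prob p η₀ η₁ D g P ξ S₀ S)
    (h : Regular prob p) (hs : StepSizes p η₀ η₁ a) :
    expDist prob p η₁ g P ξ S 0 ≤ potφ prob p η₁ a S₀ + potψ prob p η₁ a S₀ := by
  have h1 := (hT.integral_distφ_le h hs 0 (by simp only [hT.zero]; exact integrable_const _)).2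
  have h2 := (hT.integral_distψ_le h hs 0 (by simp only [hT.zero]; exact integrable_const _)).2
  have e1 : ∫ ω, potφ prob p η₁ a (S 0 ω) ∂P = potφ prob p η₁ a S₀ := by simp [hT.zero]
  have e2 : ∫ ω, potψ prob p η₁ a (S 0 ω) ∂P = potψ prob p η₁ a S₀ := by simp [hT.zero]
  rw [e1] at h1
  rw [e2] at h2
  exact add_le_add h1 h2

/-- One step of the Lyapunov argument. -/
theorem lyapunov_step (hT : IsTrajectory prob p η₀ η₁ D g P ξ S₀ S)
    (h : Regular prob p) (hs : StepSizes p η₀ η₁ a) (hF : ∀ x, Fstar ≤ prob.envF p.γ x) (t : ℕ) :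
    ∫ ω, prob.envF p.γ (S (t + 1) ω).x ∂P
        + 2 * η₀ / (η₁ * p.γ ^ 2 * a) * expDist prob p η₁ g P ξ S (t + 1)
      ≤ ∫ ω, prob.envF p.γ (S t ω).x ∂P
        + 2 * η₀ / (η₁ * p.γ ^ 2 * a) * expDist prob p η₁ g P ξ S t
        - η₀ * (1 / 2 * ∫ ω, gradSq prob p.γ (S t ω) ∂P
          + 1 / p.γ ^ 2 * expDist prob p η₁ g P ξ S t)
        + 36 * η₀ * η₁ * p.M ^ 2 / (p.γ ^ 2 * a) := by
  obtain ⟨hφ, hψ, he⟩ := hT.integrable_dist h hs hF t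
  obtain ⟨he', hg, hx, hVφ, hVψ⟩ := hT.integrable_of_integrable h hs hF t hφ hψ he
  have hη₀ := hs.η₀_pos
  have hη₁ := hs.η₁_pos
  have ha := hs.a_pos
  have hγ := h.hγ
  have d1 : ∫ ω, prob.envF p.γ (S (t + 1) ω).x ∂P ≤ ∫ ω, (prob.envF p.γ (S t ω).x
      - η₀ / 2 * gradSq prob p.γ (S t ω) - 1 / (4 * η₀) * ‖(S t ω).x - (S (t + 1) ω).x‖ ^ 2
      + η₀ / p.γ ^ 2 * (distφ prob p.γ η₁ g (S t ω) (ξ t ω)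
        + distψ prob p.γ η₁ g (S t ω) (ξ t ω))) ∂P := by
    refine integral_mono he' (((he.sub (hg.const_mul _)).sub (hx.const_mul _)).add
      ((hφ.add hψ).const_mul _)) fun ω => ?_
    change prob.envF p.γ (S (t + 1) ω).x ≤ _
    rw [hT.succ]
    exact h.descent_step hs _ _
  have j1 : Integrable (fun ω => prob.envF p.γ (S t ω).x - η₀ / 2 * gradSq prob p.γ (S t ω)) P :=
    he.sub (hg.const_mul _)
  have j2 : Integrable (fun ω => prob.envF p.γ (S t ω).x - η₀ / 2 * gradSq prob p.γ (S t ω)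
      - 1 / (4 * η₀) * ‖(S t ω).x - (S (t + 1) ω).x‖ ^ 2) P := j1.sub (hx.const_mul _)
  have j3 : Integrable (fun ω => η₀ / p.γ ^ 2 * (distφ prob p.γ η₁ g (S t ω) (ξ t ω)
      + distψ prob p.γ η₁ g (S t ω) (ξ t ω))) P := (hφ.add hψ).const_mul _
  rw [integral_add j2 j3, integral_sub j1 (hx.const_mul _), integral_sub he (hg.const_mul _),
    integral_const_mul, integral_const_mul, integral_const_mul, integral_add hφ hψ] at d1
  have v1 := (hT.integral_distφ_le h hs _ hVφ).2
  have v2 := (hT.integral_distψ_le h hs _ hVψ).2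
  have w1 : ∫ ω, potφ prob p η₁ a (S (t + 1) ω) ∂P
      ≤ ∫ ω, ((1 - η₁ * a) * distφ prob p.γ η₁ g (S t ω) (ξ t ω)
      + (1 / a + p.Lφ ^ 2 / p.μφ ^ 3) / (16 * p.γ ^ 2 * a ^ 2 * η₁)
        * ‖(S t ω).x - (S (t + 1) ω).x‖ ^ 2 + 9 * η₁ ^ 2 * p.M ^ 2) ∂P := by
    refine integral_mono hVφ (((hφ.const_mul _).add (hx.const_mul _)).add (integrable_const _))
      fun ω => ?_
    change potφ prob p η₁ a (S (t + 1) ω) ≤ _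
    rw [hT.succ]
    exact h.potφ_step_le hs _ _
  have w2 : ∫ ω, potψ prob p η₁ a (S (t + 1) ω) ∂P
      ≤ ∫ ω, ((1 - η₁ * a) * distψ prob p.γ η₁ g (S t ω) (ξ t ω)
      + (1 / a + p.Lψ ^ 2 / p.μψ ^ 3) / (16 * p.γ ^ 2 * a ^ 2 * η₁)
        * ‖(S t ω).x - (S (t + 1) ω).x‖ ^ 2 + 9 * η₁ ^ 2 * p.M ^ 2) ∂P := by
    refine integral_mono hVψ (((hψ.const_mul _).add (hx.const_mul _)).add (integrable_const _))
      fun ω => ?_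
    change potψ prob p η₁ a (S (t + 1) ω) ≤ _
    rw [hT.succ]
    exact h.potψ_step_le hs _ _
  have k1 : Integrable (fun ω => (1 - η₁ * a) * distφ prob p.γ η₁ g (S t ω) (ξ t ω)
      + (1 / a + p.Lφ ^ 2 / p.μφ ^ 3) / (16 * p.γ ^ 2 * a ^ 2 * η₁)
        * ‖(S t ω).x - (S (t + 1) ω).x‖ ^ 2) P := (hφ.const_mul _).add (hx.const_mul _)
  have k2 : Integrable (fun ω => (1 - η₁ * a) * distψ prob p.γ η₁ g (S t ω) (ξ t ω)
      + (1 / a + p.Lψ ^ 2 / p.μψ ^ 3) / (16 * p.γ ^ 2 * a ^ 2 * η₁)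
        * ‖(S t ω).x - (S (t + 1) ω).x‖ ^ 2) P := (hψ.const_mul _).add (hx.const_mul _)
  rw [integral_add k1 (integrable_const _), integral_add (hφ.const_mul _) (hx.const_mul _),
    integral_const_mul, integral_const_mul] at w1
  rw [integral_add k2 (integrable_const _), integral_add (hψ.const_mul _) (hx.const_mul _),
    integral_const_mul, integral_const_mul] at w2
  simp only [integral_const, probReal_univ, one_smul] at w1 w2
  have hX : 0 ≤ ∫ ω, ‖(S t ω).x - (S (t + 1) ω).x‖ ^ 2 ∂P := integral_nonneg fun _ => by positivity
  unfold expDist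
  -- The weight for which the contraction gains `c * (η₁ * a) = 2η₀/γ²` per unit of distance: one
  -- `η₀/γ²` cancels the error in the descent inequality, the other remains to be summed.
  set c := 2 * η₀ / (η₁ * p.γ ^ 2 * a) with hc
  have hc0 : 0 ≤ c := by positivity
  have q1 := mul_le_mul_of_nonneg_left (add_le_add (v1.trans w1) (v2.trans w2)) hc0
  have q2 := mul_le_mul_of_nonneg_right (add_le_add hs.drift_φ hs.drift_ψ) hX
  rw [← hc] at q2
  have e1 : c * (η₁ * a) = 2 * (η₀ / p.γ ^ 2) := by rw [hc]; field_simp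
  have e2 : c * (18 * η₁ ^ 2 * p.M ^ 2) = 36 * η₀ * η₁ * p.M ^ 2 / (p.γ ^ 2 * a) := by
    rw [hc]; field_simp; ring
  -- The two drift costs together use exactly the displacement term left over by the descent.
  have e3 : 1 / (8 * η₀) + 1 / (8 * η₀) = 1 / (4 * η₀) := by field_simp; norm_num
  rw [e3] at q2
  rw [← e2]
  set A := ∫ ω, distφ prob p.γ η₁ g (S t ω) (ξ t ω) ∂P
  set B := ∫ ω, distψ prob p.γ η₁ g (S t ω) (ξ t ω) ∂P
  have e4 : c * ((1 - η₁ * a) * A + (1 - η₁ * a) * B)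
      = c * (A + B) - 2 * (η₀ / p.γ ^ 2 * (A + B)) := by
    calc _ = c * (A + B) - (c * (η₁ * a)) * (A + B) := by ring
      _ = _ := by rw [e1]; ring
  have e5 : η₀ * (1 / p.γ ^ 2 * (A + B)) = η₀ / p.γ ^ 2 * (A + B) := by ring
  linarith

/-- The summed Lyapunov inequality. -/
theorem sum_le (hT : IsTrajectory prob p η₀ η₁ D g P ξ S₀ S)
    (h : Regular prob p) (hs : StepSizes p η₀ η₁ a) (hF : ∀ x, Fstar ≤ prob.envF p.γ x) (T : ℕ) :
    η₀ * ∑ t ∈ Finset.range T, (1 / 2 * ∫ ω, gradSq prob p.γ (S t ω) ∂P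
        + 1 / p.γ ^ 2 * expDist prob p η₁ g P ξ S t)
      ≤ prob.envF p.γ S₀.x - Fstar
        + 2 * η₀ / (η₁ * p.γ ^ 2 * a) * expDist prob p η₁ g P ξ S 0
        + T * (36 * η₀ * η₁ * p.M ^ 2 / (p.γ ^ 2 * a)) := by
  have key : ∀ T : ℕ, ∫ ω, prob.envF p.γ (S T ω).x ∂P
      + 2 * η₀ / (η₁ * p.γ ^ 2 * a) * expDist prob p η₁ g P ξ S T
      + η₀ * ∑ t ∈ Finset.range T, (1 / 2 * ∫ ω, gradSq prob p.γ (S t ω) ∂P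
        + 1 / p.γ ^ 2 * expDist prob p η₁ g P ξ S t)
      ≤ prob.envF p.γ S₀.x + 2 * η₀ / (η₁ * p.γ ^ 2 * a) * expDist prob p η₁ g P ξ S 0
        + T * (36 * η₀ * η₁ * p.M ^ 2 / (p.γ ^ 2 * a)) := by
    intro T
    induction T with
    | zero => simp [hT.zero]
    | succ T ih =>
      have h1 := hT.lyapunov_step h hs hF T
      rw [Finset.sum_range_succ, mul_add]
      push_cast
      linarith
  have h1 := key T
  have h2 : Fstar ≤ ∫ ω, prob.envF p.γ (S T ω).x ∂P := by
    have := integral_mono (integrable_const (μ := P) Fstar) (hT.integrable_dist h hs hF T).2.2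
      fun ω => hF _
    simpa using this
  have h3 : 0 ≤ 2 * η₀ / (η₁ * p.γ ^ 2 * a) * expDist prob p η₁ g P ξ S T := by
    have := hs.η₀_pos
    have := hs.η₁_pos
    have := hs.a_pos
    exact mul_nonneg (by positivity) (add_nonneg
      (integral_nonneg fun _ => stepDist_nonneg _ _ _ _)
      (integral_nonneg fun _ => stepDist_nonneg _ _ _ _))
  linarith

end IsTrajectory

end Trajectory

/-! ### Step sizes and the numerical balance. -/

section Constants

variable {dx dy dz : ℕ} {prob : DMax dx dy dz} {p : Params}

namespace Regular

theorem α_pos (h : Regular prob p) : 0 < p.α :=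
  lt_min (lt_min (div_pos (one_div_sub_pos h.hγ h.hγφ) (by norm_num))
    (div_pos (one_div_sub_pos h.hγ h.hγψ) (by norm_num))) (lt_min h.hφ.μ_pos h.hψ.μ_pos)

theorem τ_pos (h : Regular prob p) : 0 < p.τ := by
  have h1 := h.hγ
  have h2 := h.α_pos
  have h3 := h.hφ.μ_pos
  have h4 := h.hψ.μ_pos
  have h5 := h.hφ.L_pos
  have h6 := h.hψ.L_pos
  unfold Params.τ
  exact lt_min (by positivity) (lt_min (by positivity) (by positivity))

theorem ν_pos (h : Regular prob p) : 0 < p.ν := by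
  have h1 := h.hγ
  have h2 := h.α_pos
  have h3 := h.τ_pos
  exact lt_min one_pos (by positivity)

theorem LF_pos (h : Regular prob p) : 0 < p.LF := by
  refine div_pos two_pos ?_
  have h1 := mul_le_mul_of_nonneg_left (min_le_right p.δψ p.δφ) h.hγ.le
  nlinarith [h.hγ, h.hγφ]

end Regular

/-- The coefficient of `ε²` in the step size `η₁`. -/
def rate (p : Params) : ℝ := min 1 (p.γ ^ 2) * min p.α p.τ * p.ν * p.α / (768 * p.τ * p.M ^ 2)

theorem Regular.rate_pos (h : Regular prob p) : 0 < rate p := by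
  have h1 := h.hγ
  have h2 := h.α_pos
  have h3 := h.τ_pos
  have h4 := h.ν_pos
  have h5 := h.hM
  unfold rate
  have : 0 < min 1 (p.γ ^ 2) := lt_min one_pos (by positivity)
  have : 0 < min p.α p.τ := lt_min h2 h3
  positivity

theorem η₁_le_rate (p : Params) (ε : ℝ) : p.η₁ ε ≤ rate p * ε ^ 2 :=
  (min_le_right _ _).trans (min_le_right _ _)

theorem η₁_le_φ (p : Params) (ε : ℝ) : p.η₁ ε ≤ p.γ ^ 2 * (1 / p.γ - p.δφ) / 2 :=
  (min_le_left _ _).trans (min_le_left _ _)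

theorem η₁_le_ψ (p : Params) (ε : ℝ) : p.η₁ ε ≤ p.γ ^ 2 * (1 / p.γ - p.δψ) / 2 :=
  (min_le_left _ _).trans (min_le_right _ _)

theorem Regular.η₁_pos (h : Regular prob p) {ε : ℝ} (hε : 0 < ε) : 0 < p.η₁ ε := by
  have h1 := h.hγ
  have h2 := one_div_sub_pos h.hγ h.hγφ
  have h3 := one_div_sub_pos h.hγ h.hγψ
  have h4 := h.LF_pos
  have h5 := h.τ_pos
  exact lt_min (lt_min (by positivity) (by positivity))
    (lt_min (by positivity) (mul_pos h.rate_pos (by positivity)))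

theorem sq_rpow_one_point_five {x : ℝ} (hx : 0 ≤ x) : (x ^ (1.5 : ℝ)) ^ 2 = x ^ 3 := by
  rw [← Real.rpow_natCast, ← Real.rpow_mul hx, ← Real.rpow_natCast]
  norm_num

/-- Up to the factor `1/(8τη)` the left side is `τ²(1/α + L²/μ³)/(γ⁴α³)`, free of `η`. Squaring the
two bounds on `τ` limits each summand to `1/16`, whence the exponents `1.5` in the definition of
`τ`. -/
theorem Params.τ_sq_mul_le {γ α τ μ L : ℝ} (hγ : 0 < γ) (hα : 0 < α) (hτ : 0 < τ)
    (hμ : 0 < μ) (hL : 0 < L) (h1 : τ ≤ γ ^ 2 * α ^ 2 / 4)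
    (h2 : τ ≤ μ ^ (1.5 : ℝ) * γ ^ 2 * α ^ (1.5 : ℝ) / (4 * L)) {η : ℝ} (hη : 0 < η) :
    2 * (τ * η) / (η * γ ^ 2 * α) * ((1 / α + L ^ 2 / μ ^ 3) / (16 * γ ^ 2 * α ^ 2 * η))
      ≤ 1 / (8 * (τ * η)) := by
  have a1 : τ ^ 2 ≤ γ ^ 4 * α ^ 4 / 16 := by
    calc τ ^ 2 ≤ (γ ^ 2 * α ^ 2 / 4) ^ 2 := pow_le_pow_left₀ hτ.le h1 2
      _ = _ := by ring
  have a2 : τ ^ 2 * L ^ 2 ≤ μ ^ 3 * γ ^ 4 * α ^ 3 / 16 := by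
    have := pow_le_pow_left₀ hτ.le h2 2
    rw [div_pow, mul_pow, mul_pow, sq_rpow_one_point_five hμ.le, sq_rpow_one_point_five hα.le,
      le_div_iff₀ (by positivity)] at this
    nlinarith
  have a3 : τ ^ 2 * (1 / α) ≤ γ ^ 4 * α ^ 3 / 16 := by
    rw [mul_one_div, div_le_iff₀ hα]; nlinarith
  have a4 : τ ^ 2 * (L ^ 2 / μ ^ 3) ≤ γ ^ 4 * α ^ 3 / 16 := by
    rw [← mul_div_assoc, div_le_iff₀ (by positivity)]; nlinarith
  have a5 : τ ^ 2 * (1 / α + L ^ 2 / μ ^ 3) ≤ γ ^ 4 * α ^ 3 := by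
    have : 0 < γ ^ 4 * α ^ 3 := by positivity
    rw [mul_add]; linarith
  have e : 2 * (τ * η) / (η * γ ^ 2 * α) * ((1 / α + L ^ 2 / μ ^ 3) / (16 * γ ^ 2 * α ^ 2 * η))
      = τ ^ 2 * (1 / α + L ^ 2 / μ ^ 3) / (γ ^ 4 * α ^ 3) * (1 / (8 * (τ * η))) := by
    generalize 1 / α + L ^ 2 / μ ^ 3 = w
    field_simp
    ring
  rw [e]
  have : τ ^ 2 * (1 / α + L ^ 2 / μ ^ 3) / (γ ^ 4 * α ^ 3) ≤ 1 :=
    (div_le_one (by positivity)).2 a5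
  exact mul_le_of_le_one_left (by positivity) this

theorem Regular.stepSizes (h : Regular prob p) {ε : ℝ} (hε : 0 < ε) :
    StepSizes p (p.η₀ ε) (p.η₁ ε) p.α := by
  have hγ := h.hγ
  have hα := h.α_pos
  have hτ := h.τ_pos
  have hη := h.η₁_pos hε
  have hρφ := one_div_sub_pos h.hγ h.hγφ
  have hρψ := one_div_sub_pos h.hγ h.hγψ
  have l1 : p.α ≤ (1 / p.γ - p.δφ) / 4 := (min_le_left _ _).trans (min_le_left _ _)
  have l2 : p.α ≤ (1 / p.γ - p.δψ) / 4 := (min_le_left _ _).trans (min_le_right _ _)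
  have l3 : p.α ≤ p.μφ := (min_le_right _ _).trans (min_le_left _ _)
  have l4 : p.α ≤ p.μψ := (min_le_right _ _).trans (min_le_right _ _)
  have t1 : p.τ ≤ p.γ ^ 2 * p.α ^ 2 / 4 := min_le_left _ _
  -- Since `δφ ≥ 0`, this gives `γα ≤ 1/4` and thus `τ ≤ γ²α²/4 ≤ 1/64`, which turns the `ψ`-cap on
  -- `η₁` into the smoothness condition on `η₀`.
  have hk : p.γ * (1 / p.γ - p.δφ) ≤ 1 := by
    have : p.γ * (1 / p.γ - p.δφ) = 1 - p.γ * p.δφ := by field_simp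
    rw [this]
    linarith [mul_nonneg hγ.le h.hφ.δ_nonneg]
  have hγα : p.γ * p.α ≤ 1 / 4 := by
    have := mul_le_mul_of_nonneg_left l1 hγ.le
    linarith
  have hγα2 : p.γ ^ 2 * p.α ^ 2 ≤ 1 / 16 := by
    have := pow_le_pow_left₀ (by positivity) hγα 2
    nlinarith
  refine ⟨mul_pos hτ hη, hη, hα, by linarith, by linarith, l3, l4, ?_, η₁_le_φ p ε,
    η₁_le_ψ p ε, ?_, ?_, ?_⟩
  · have h1 := mul_le_mul_of_nonneg_right (η₁_le_φ p ε) hα.le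
    have h2 : p.γ ^ 2 * (1 / p.γ - p.δφ) / 2 * p.α
        = (p.γ * (1 / p.γ - p.δφ)) * (p.γ * p.α) / 2 := by ring
    have h3 := mul_le_mul hk hγα (by positivity) zero_le_one
    linarith
  · have h1 : p.η₁ ε * (1 / (p.γ ^ 2 * (1 / p.γ - p.δψ))) ≤ 1 / 2 := by
      rw [mul_one_div, div_le_iff₀ (by positivity)]
      linarith [η₁_le_ψ p ε]
    have h2 : p.τ ≤ 1 / 64 := by linarith
    have h3 : p.η₀ ε * (1 / (p.γ ^ 2 * (1 / p.γ - p.δψ)))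
        = p.τ * (p.η₁ ε * (1 / (p.γ ^ 2 * (1 / p.γ - p.δψ)))) := by
      unfold Params.η₀; ring
    rw [h3]
    have h4 := mul_le_mul h2 h1 (by positivity) (by norm_num)
    linarith
  · exact Params.τ_sq_mul_le hγ hα hτ h.hφ.μ_pos h.hφ.L_pos t1
      ((min_le_right _ _).trans (min_le_left _ _)) hη
  · exact Params.τ_sq_mul_le hγ hα hτ h.hψ.μ_pos h.hψ.L_pos t1
      ((min_le_right _ _).trans (min_le_right _ _)) hη

theorem one_div_min {a b : ℝ} (ha : 0 < a) (hb : 0 < b) :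
    1 / min a b = max (1 / a) (1 / b) := by
  rcases le_total a b with hab | hab
  · rw [min_eq_left hab, max_eq_left (one_div_le_one_div_of_le ha hab)]
  · rw [min_eq_right hab, max_eq_right (one_div_le_one_div_of_le hb hab)]

/-- The maximum in `iterBound` is the reciprocal of the minimum defining `η₁`, so `T ≥ T₀` is a
lower bound on `T * η₁`. -/
theorem Regular.one_div_η₁ (h : Regular prob p) {ε : ℝ} (hε : 0 < ε) :
    1 / p.η₁ ε = max (max (2 / (p.γ ^ 2 * (1 / p.γ - p.δφ))) (2 / (p.γ ^ 2 * (1 / p.γ - p.δψ))))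
      (max (2 * p.LF * p.τ)
        (768 * p.τ * p.M ^ 2 / (min 1 (p.γ ^ 2) * min p.α p.τ * p.ν * p.α * ε ^ 2))) := by
  have h1 := h.hγ
  have h2 := one_div_sub_pos h.hγ h.hγφ
  have h3 := one_div_sub_pos h.hγ h.hγψ
  have h4 := h.LF_pos
  have h5 := h.τ_pos
  have h6 := h.rate_pos
  have b1 : 0 < p.γ ^ 2 * (1 / p.γ - p.δφ) / 2 := by positivity
  have b2 : 0 < p.γ ^ 2 * (1 / p.γ - p.δψ) / 2 := by positivity
  have b3 : 0 < 1 / (2 * p.LF * p.τ) := by positivity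
  have b4 : 0 < rate p * ε ^ 2 := by positivity
  change 1 / min _ (min _ (rate p * ε ^ 2)) = _
  rw [one_div_min (lt_min b1 b2) (lt_min b3 b4), one_div_min b1 b2, one_div_min b3 b4]
  simp only [one_div_div, div_one]
  congr 2
  rw [rate, div_mul_eq_mul_div, one_div_div]

theorem Regular.iterBound_eq (h : Regular prob p) {ε : ℝ} (hε : 0 < ε) (Δ : ℝ) :
    iterBound p ε Δ = 16 * Δ / (min 1 ((p.γ ^ 2)⁻¹) * min p.α p.τ * p.ν * ε ^ 2)
      * (1 / p.η₁ ε) := by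
  rw [h.one_div_η₁ hε, iterBound]

/-- A maximum of positive terms is at most their sum, and for `ε ≤ 1` the terms free of `ε` may be
multiplied by `ε⁻² ≥ 1`. The other factor `ε⁻²` of `ε⁻⁴` is explicit in `iterBound`. -/
theorem Regular.one_div_η₁_le (h : Regular prob p) {ε : ℝ} (hε : 0 < ε) (hε1 : ε ≤ 1) :
    1 / p.η₁ ε ≤ (2 / (p.γ ^ 2 * (1 / p.γ - p.δφ)) + 2 / (p.γ ^ 2 * (1 / p.γ - p.δψ))
      + 2 * p.LF * p.τ + 1 / rate p) * (ε ^ 2)⁻¹ := by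
  have h1 := h.hγ
  have h2 := one_div_sub_pos h.hγ h.hγφ
  have h3 := one_div_sub_pos h.hγ h.hγψ
  have h4 := h.LF_pos
  have h5 := h.τ_pos
  have h6 := h.rate_pos
  have e : 768 * p.τ * p.M ^ 2 / (min 1 (p.γ ^ 2) * min p.α p.τ * p.ν * p.α * ε ^ 2)
      = 1 / rate p * (ε ^ 2)⁻¹ := by
    rw [rate, one_div_div, div_mul_eq_div_div, div_eq_mul_inv _ (ε ^ 2)]
  have hi : 1 ≤ (ε ^ 2)⁻¹ := (one_le_inv₀ (by positivity)).2 (pow_le_one₀ hε.le hε1)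
  rw [h.one_div_η₁ hε, e]
  have a1 : 0 < 2 / (p.γ ^ 2 * (1 / p.γ - p.δφ)) := by positivity
  have a2 : 0 < 2 / (p.γ ^ 2 * (1 / p.γ - p.δψ)) := by positivity
  have a3 : 0 < 2 * p.LF * p.τ := by positivity
  have a4 : 0 < 1 / rate p := by positivity
  refine max_le (max_le ?_ ?_) (max_le ?_ ?_) <;> nlinarith

/-- The numerical core: the step sizes balance the two error terms. -/
theorem Regular.average_le (h : Regular prob p) {ε : ℝ} (hε : 0 < ε) {T A B Δ : ℝ} (hT : 0 ≤ T)
    (hAB : min (1 / 2) (1 / p.γ ^ 2) * A ≤ B)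
    (hB : p.η₀ ε * B ≤ Δ + T * (36 * p.η₀ ε * p.η₁ ε * p.M ^ 2 / (p.γ ^ 2 * p.α)))
    (hTΔ : iterBound p ε Δ ≤ T) : A ≤ T * (min 1 ((p.γ ^ 2)⁻¹) * ε ^ 2 / 4) := by
  have hγ := h.hγ
  have hα := h.α_pos
  have hτ := h.τ_pos
  have hν := h.ν_pos
  have hM := h.hM
  have hη := h.η₁_pos hε
  rw [h.iterBound_eq hε] at hTΔ
  set η := p.η₁ ε with hηdef
  set m := min p.α p.τ with hm
  set q := min (1 / 2) (1 / p.γ ^ 2) with hq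
  set κ := min 1 ((p.γ ^ 2)⁻¹) with hκ
  have hm0 : 0 < m := lt_min hα hτ
  have hq0 : 0 < q := lt_min (by norm_num) (by positivity)
  have hκ0 : 0 < κ := lt_min one_pos (by positivity)
  have hκ2 : min 1 (p.γ ^ 2) = κ * p.γ ^ 2 := by
    rw [hκ, min_mul_of_nonneg _ _ (by positivity), one_mul, inv_mul_cancel₀ (by positivity),
      min_comm]
  -- `m` and `ν` are minima so that both values of `q` are covered: `τ · 1` for `q = 1/2`, and `α ·
  -- 2τ/(γ²α)` for `q = 1/γ²`.
  have hmν : m * p.ν ≤ 2 * (q * p.τ) := by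
    have h1 : m * p.ν ≤ p.τ := by
      have := mul_le_mul (min_le_right p.α p.τ) (min_le_left 1 (2 * p.τ / (p.γ ^ 2 * p.α)))
        hν.le hτ.le
      rwa [mul_one] at this
    have h2 : m * p.ν ≤ 2 * (1 / p.γ ^ 2 * p.τ) := by
      have := mul_le_mul (min_le_left p.α p.τ) (min_le_right 1 (2 * p.τ / (p.γ ^ 2 * p.α)))
        hν.le hα.le
      refine this.trans (le_of_eq ?_)
      field_simp
    rcases min_choice (1 / 2) (1 / p.γ ^ 2) with h3 | h3
    · rw [hq, h3]; linarith
    · rw [hq, h3]; exact h2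
  have hΔ : Δ ≤ T * η * (κ * (m * p.ν) * ε ^ 2 / 16) := by
    rw [div_mul_div_comm, mul_one, div_le_iff₀ (by positivity)] at hTΔ
    linarith
  have hrate : 36 * η * p.M ^ 2 / (p.γ ^ 2 * p.α) ≤ κ * (m * p.ν) * ε ^ 2 * (36 / 768) / p.τ := by
    have h1 := η₁_le_rate p ε
    rw [rate, hκ2, ← hm, ← hηdef] at h1
    rw [div_mul_eq_mul_div, le_div_iff₀ (by positivity)] at h1
    rw [div_le_div_iff₀ (by positivity) hτ]
    nlinarith
  -- The gap contributes `1/16` and the noise `36/768 = 3/64`, together `7/64`; doubled by `hmν`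
  -- this stays below `1/4`.
  have h1 : p.τ * (q * A) ≤ T * (κ * (m * p.ν) * ε ^ 2) * (7 / 64) := by
    have h2 : p.η₀ ε = p.τ * η := rfl
    rw [h2] at hB
    have h3 := mul_le_mul_of_nonneg_left hAB (by positivity : 0 ≤ p.τ * η)
    have h4 := mul_le_mul_of_nonneg_left hrate (by positivity : 0 ≤ T * (p.τ * η))
    have e4 : T * (p.τ * η) * (κ * (m * p.ν) * ε ^ 2 * (36 / 768) / p.τ)
        = T * η * (κ * (m * p.ν) * ε ^ 2 * (36 / 768)) := by field_simp
    have e5 : T * (36 * (p.τ * η) * η * p.M ^ 2 / (p.γ ^ 2 * p.α))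
        = T * (p.τ * η) * (36 * η * p.M ^ 2 / (p.γ ^ 2 * p.α)) := by ring
    rw [e4] at h4
    rw [e5] at hB
    have h5 : η * (p.τ * (q * A)) ≤ η * (T * (κ * (m * p.ν) * ε ^ 2) * (7 / 64)) := by
      linarith
    exact le_of_mul_le_mul_left h5 hη
  have h2 := mul_le_mul_of_nonneg_left hmν (by positivity : 0 ≤ T * (κ * ε ^ 2))
  have h3 : q * p.τ * A ≤ q * p.τ * (T * (κ * ε ^ 2 / 4)) := by
    have : 0 ≤ T * (κ * ε ^ 2) * (q * p.τ) := by positivity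
    linarith
  exact le_of_mul_le_mul_left h3 (by positivity)

end Constants

/-! ### The averaged bound, the random output and near criticality. -/

section Output

variable {dx dy dz : ℕ} {prob : DMax dx dy dz} {p : Params} {η₀ η₁ a Fstar ε : ℝ}
  {Ξ : Type*} [MeasurableSpace Ξ] {D : Measure Ξ} [IsProbabilityMeasure D]
  {g : Oracle dx dy dz Ξ} {Ω : Type*} [MeasurableSpace Ω] {P : Measure Ω} [IsProbabilityMeasure P]
  {ξ : ℕ → Ω → Ξ} {S₀ : State dx dy dz} {S : ℕ → Ω → State dx dy dz}

/-- The quantity whose average over the iterations is controlled. -/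
def totalErr (prob : DMax dx dy dz) (γ : ℝ) (S S' : State dx dy dz) : ℝ :=
  errφ prob γ S S' + errψ prob γ S S' + gradSq prob γ S

namespace Regular

theorem measurable_errφ (h : Regular prob p) :
    Measurable fun q : State dx dy dz × State dx dy dz => errφ prob p.γ q.1 q.2 :=
  ((measurable_state_xφ.comp measurable_snd).sub
    ((h.wcΦ.continuous_prox h.hγ h.hγφ).measurable.comp
      (measurable_state_x.comp measurable_fst))).norm.pow_const 2

theorem measurable_errψ (h : Regular prob p) :
    Measurable fun q : State dx dy dz × State dx dy dz => errψ prob p.γ q.1 q.2 :=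
  ((measurable_state_xψ.comp measurable_snd).sub
    ((h.wcΨ.continuous_prox h.hγ h.hγψ).measurable.comp
      (measurable_state_x.comp measurable_fst))).norm.pow_const 2

theorem measurable_totalErr (h : Regular prob p) :
    Measurable fun q : State dx dy dz × State dx dy dz => totalErr prob p.γ q.1 q.2 :=
  (h.measurable_errφ.add h.measurable_errψ).add
    ((h.continuous_gradient_envF.measurable.comp
      (measurable_state_x.comp measurable_fst)).norm.pow_const 2)

end Regular

namespace IsTrajectory

theorem integrable_errφ (hT : IsTrajectory prob p η₀ η₁ D g P ξ S₀ S)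
    (h : Regular prob p) (hs : StepSizes p η₀ η₁ a) (hF : ∀ x, Fstar ≤ prob.envF p.γ x) (t : ℕ) :
    Integrable (fun ω => errφ prob p.γ (S t ω) (S (t + 1) ω)) P := by
  refine (hT.integrable_dist h hs hF t).1.mono' (h.measurable_errφ.comp
    ((hT.measurable_state h t).prodMk (hT.measurable_state h (t + 1)))).aestronglyMeasurable
    (Eventually.of_forall fun ω => ?_)
  have h0 : 0 ≤ errφ prob p.γ (S t ω) (S (t + 1) ω) := sq_nonneg _
  rw [Real.norm_of_nonneg h0, hT.succ]
  exact errφ_step_le _ _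

theorem integrable_errψ (hT : IsTrajectory prob p η₀ η₁ D g P ξ S₀ S)
    (h : Regular prob p) (hs : StepSizes p η₀ η₁ a) (hF : ∀ x, Fstar ≤ prob.envF p.γ x) (t : ℕ) :
    Integrable (fun ω => errψ prob p.γ (S t ω) (S (t + 1) ω)) P := by
  refine (hT.integrable_dist h hs hF t).2.1.mono' (h.measurable_errψ.comp
    ((hT.measurable_state h t).prodMk (hT.measurable_state h (t + 1)))).aestronglyMeasurable
    (Eventually.of_forall fun ω => ?_)
  have h0 : 0 ≤ errψ prob p.γ (S t ω) (S (t + 1) ω) := sq_nonneg _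
  rw [Real.norm_of_nonneg h0, hT.succ]
  exact errψ_step_le _ _

/-- The initial potential in terms of the distances to the saddle points. -/
theorem initPotential_eq (hT : IsTrajectory prob p (p.η₀ ε) (p.η₁ ε) D g P ξ S₀ S)
    (h : Regular prob p) (hε : 0 < ε) (hF : ∀ x, Fstar ≤ prob.envF p.γ x) :
    initPotential prob p ε P S
      = 2 * p.η₀ ε / (p.η₁ ε * p.γ ^ 2 * p.α) * expDist prob p (p.η₁ ε) g P ξ S 0 := by
  have hs := h.stepSizes hε
  obtain ⟨h1, h2, -⟩ := hT.integrable_dist h hs hF 0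
  have eφ : ∀ ω, distφ prob p.γ (p.η₁ ε) g (S 0 ω) (ξ 0 ω) = errφ prob p.γ (S 0 ω) (S 1 ω)
      + ‖(S 1 ω).y - argMax prob.φ prob.Y (prox p.γ prob.Φ (S 0 ω).x)‖ ^ 2 := by
    intro ω; rw [hT.succ 0 ω]; rfl
  have eψ : ∀ ω, distψ prob p.γ (p.η₁ ε) g (S 0 ω) (ξ 0 ω) = errψ prob p.γ (S 0 ω) (S 1 ω)
      + ‖(S 1 ω).z - argMax prob.ψ prob.Z (prox p.γ prob.Ψ (S 0 ω).x)‖ ^ 2 := by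
    intro ω; rw [hT.succ 0 ω]; rfl
  have iφ := hT.integrable_errφ h hs hF 0
  have iψ := hT.integrable_errψ h hs hF 0
  simp only [zero_add] at iφ iψ
  have iy : Integrable (fun ω =>
      ‖(S 1 ω).y - argMax prob.φ prob.Y (prox p.γ prob.Φ (S 0 ω).x)‖ ^ 2) P :=
    (h1.sub iφ).congr (Eventually.of_forall fun ω => by simp [eφ])
  have iz : Integrable (fun ω =>
      ‖(S 1 ω).z - argMax prob.ψ prob.Z (prox p.γ prob.Ψ (S 0 ω).x)‖ ^ 2) P :=
    (h2.sub iψ).congr (Eventually.of_forall fun ω => by simp [eψ])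
  unfold initPotential expDist
  simp_rw [eφ, eψ]
  rw [integral_add iφ iy, integral_add iψ iz]
  ring

theorem sum_totalErr_le (hT : IsTrajectory prob p (p.η₀ ε) (p.η₁ ε) D g P ξ S₀ S)
    (h : Regular prob p) (hε : 0 < ε) (hF : ∀ x, Fstar ≤ prob.envF p.γ x) {T : ℕ} (hT1 : 1 ≤ T)
    (hT0 : iterBound p ε (prob.envF p.γ S₀.x - Fstar + initPotential prob p ε P S) ≤ T) :
    1 / (T : ℝ) * ∑ t ∈ Finset.range T, ((∫ ω, errφ prob p.γ (S t ω) (S (t + 1) ω) ∂P)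
      + (∫ ω, errψ prob p.γ (S t ω) (S (t + 1) ω) ∂P) + (∫ ω, gradSq prob p.γ (S t ω) ∂P))
      ≤ min 1 ((p.γ ^ 2)⁻¹) * ε ^ 2 / 4 := by
  have hs := h.stepSizes hε
  have hγ := h.hγ
  rw [hT.initPotential_eq h hε hF] at hT0
  have hTpos : (0 : ℝ) < T := by positivity
  rw [one_div_mul_eq_div, div_le_iff₀' hTpos]
  refine h.average_le hε hTpos.le ?_ (hT.sum_le h hs hF T) hT0
  rw [Finset.mul_sum]
  refine Finset.sum_le_sum fun t _ => ?_
  obtain ⟨h1, h2, -⟩ := hT.integrable_dist h hs hF t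
  have l1 : ∫ ω, errφ prob p.γ (S t ω) (S (t + 1) ω) ∂P
      ≤ ∫ ω, distφ prob p.γ (p.η₁ ε) g (S t ω) (ξ t ω) ∂P :=
    integral_mono (hT.integrable_errφ h hs hF t) h1 fun ω => by
      change errφ prob p.γ (S t ω) (S (t + 1) ω) ≤ _
      rw [hT.succ]; exact errφ_step_le _ _
  have l2 : ∫ ω, errψ prob p.γ (S t ω) (S (t + 1) ω) ∂P
      ≤ ∫ ω, distψ prob p.γ (p.η₁ ε) g (S t ω) (ξ t ω) ∂P :=
    integral_mono (hT.integrable_errψ h hs hF t) h2 fun ω => by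
      change errψ prob p.γ (S t ω) (S (t + 1) ω) ≤ _
      rw [hT.succ]; exact errψ_step_le _ _
  have n1 : 0 ≤ ∫ ω, errφ prob p.γ (S t ω) (S (t + 1) ω) ∂P := integral_nonneg fun _ => sq_nonneg _
  have n2 : 0 ≤ ∫ ω, errψ prob p.γ (S t ω) (S (t + 1) ω) ∂P := integral_nonneg fun _ => sq_nonneg _
  have n3 : 0 ≤ ∫ ω, gradSq prob p.γ (S t ω) ∂P := integral_nonneg fun _ => sq_nonneg _
  -- The Lyapunov sum weights gradients by `1/2` and distances by `1/γ²`; the smaller weight serves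
  -- for the unweighted sum.
  have m1 := mul_le_mul_of_nonneg_right (min_le_left (1 / 2) (1 / p.γ ^ 2)) n3
  have m2 := mul_le_mul_of_nonneg_right (min_le_right (1 / 2) (1 / p.γ ^ 2)) (add_nonneg n1 n2)
  have m3 := mul_le_mul_of_nonneg_left (add_le_add l1 l2) (show 0 ≤ 1 / p.γ ^ 2 by positivity)
  unfold expDist
  linarith

/-- The controlled quantity at iteration `k` as a function of the samples. -/
def iterErr (prob : DMax dx dy dz) (p : Params) (η₀ η₁ : ℝ) (g : Oracle dx dy dz Ξ)
    (S₀ : State dx dy dz) (k : ℕ) (ζ : ℕ → Ξ) : ℝ :=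
  totalErr prob p.γ (iter prob p.γ η₀ η₁ g S₀ ζ (k - 1)) (iter prob p.γ η₀ η₁ g S₀ ζ k)

omit [IsProbabilityMeasure D] [IsProbabilityMeasure P] in
theorem measurable_iterErr (hT : IsTrajectory prob p η₀ η₁ D g P ξ S₀ S) (h : Regular prob p)
    (k : ℕ) : Measurable (iterErr prob p η₀ η₁ g S₀ k) := by
  have m := measurable_iter (hT.measurable_step h) S₀
  unfold iterErr
  generalize k - 1 = j
  exact h.measurable_totalErr.comp (f := fun ζ : ℕ → Ξ =>
    (iter prob p.γ η₀ η₁ g S₀ ζ j, iter prob p.γ η₀ η₁ g S₀ ζ k)) ((m j).prodMk (m k))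

/-- Properties of the output at a uniformly random iteration. -/
theorem uniform_output (hT : IsTrajectory prob p η₀ η₁ D g P ξ S₀ S)
    (h : Regular prob p) (hs : StepSizes p η₀ η₁ a) (hF : ∀ x, Fstar ≤ prob.envF p.γ x) {T : ℕ}
    (hT1 : 1 ≤ T) {N : Ω → ℕ} (hN : Measurable N)
    (hunif : ∀ k ∈ Finset.Icc 1 T, P.real {ω | N ω = k} = 1 / (T : ℝ))
    (hind : IndepFun N (fun ω t => ξ t ω) P) :
    Integrable (fun ω => totalErr prob p.γ (S (N ω - 1) ω) (S (N ω) ω)) P ∧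
      ∫ ω, totalErr prob p.γ (S (N ω - 1) ω) (S (N ω) ω) ∂P
        = 1 / (T : ℝ) * ∑ t ∈ Finset.range T, ((∫ ω, errφ prob p.γ (S t ω) (S (t + 1) ω) ∂P)
          + (∫ ω, errψ prob p.γ (S t ω) (S (t + 1) ω) ∂P)
          + (∫ ω, gradSq prob p.γ (S t ω) ∂P)) := by
  have hi : ∀ k, Integrable (fun ω => totalErr prob p.γ (S (k - 1) ω) (S k ω)) P := by
    intro k
    cases k with
    -- Index `0` is never sampled; truncated subtraction makes it a constant.
    | zero => simp only [Nat.zero_sub, hT.zero]; exact integrable_const _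
    | succ t =>
      exact ((hT.integrable_errφ h hs hF t).add (hT.integrable_errψ h hs hF t)).add
        (hT.integrable_gradSq h hs hF t)
  have hindk : ∀ k, IndepFun N (fun ω => totalErr prob p.γ (S (k - 1) ω) (S k ω)) P := by
    intro k
    have e : (fun ω => totalErr prob p.γ (S (k - 1) ω) (S k ω))
        = iterErr prob p η₀ η₁ g S₀ k ∘ fun ω t => ξ t ω := by
      funext ω; simp only [hT.eq_iter, Function.comp, iterErr]
    rw [e]
    exact hind.comp (φ := id) measurable_id (hT.measurable_iterErr h k)
  obtain ⟨-, h1, h2⟩ := integral_uniform_index hT1 hN hunif hi hindk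
  refine ⟨h1, h2.trans ?_⟩
  have hsum : ∀ (F : ℕ → ℝ) (T : ℕ), ∑ k ∈ Finset.Icc 1 T, F k
      = ∑ t ∈ Finset.range T, F (t + 1) := by
    intro F T
    induction T with
    | zero => simp
    | succ T ih => rw [Finset.sum_Icc_succ_top (by omega), Finset.sum_range_succ, ih]
  rw [hsum]
  congr 1
  refine Finset.sum_congr rfl fun t _ => ?_
  have e : ∀ ω, totalErr prob p.γ (S (t + 1 - 1) ω) (S (t + 1) ω)
      = errφ prob p.γ (S t ω) (S (t + 1) ω) + errψ prob p.γ (S t ω) (S (t + 1) ω)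
        + gradSq prob p.γ (S t ω) := fun ω => rfl
  simp_rw [e]
  have hadd : Integrable (fun ω => errφ prob p.γ (S t ω) (S (t + 1) ω)
      + errψ prob p.γ (S t ω) (S (t + 1) ω)) P :=
    (hT.integrable_errφ h hs hF t).add (hT.integrable_errψ h hs hF t)
  rw [integral_add hadd (hT.integrable_gradSq h hs hF t), integral_add (hT.integrable_errφ h hs hF t)
    (hT.integrable_errψ h hs hF t)]

end IsTrajectory

/-- Small errors of the proximal estimates and of the gradient give near criticality. -/
theorem Regular.nearlyCritical (h : Regular prob p) (hε : 0 < ε) {R R' : Ω → State dx dy dz}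
    (hR : Measurable R) (hR' : Measurable R')
    (hi : Integrable (fun ω => totalErr prob p.γ (R ω) (R' ω)) P)
    (hle : ∫ ω, totalErr prob p.γ (R ω) (R' ω) ∂P ≤ min 1 ((p.γ ^ 2)⁻¹) * ε ^ 2 / 4) :
    NearlyCritical prob P ε (fun ω => (R' ω).xφ) ∧
      NearlyCritical prob P ε (fun ω => (R' ω).xψ) := by
  have hγ := h.hγ
  set X : Ω → Vec dx := fun ω => (R ω).x with hX
  have mX : Measurable X := measurable_state_x.comp hR
  have mφ : Measurable fun ω => (R' ω).xφ - prox p.γ prob.Φ (X ω) :=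
    (measurable_state_xφ.comp hR').sub
      ((h.wcΦ.continuous_prox h.hγ h.hγφ).measurable.comp mX)
  have mψ : Measurable fun ω => (R' ω).xψ - prox p.γ prob.Ψ (X ω) :=
    (measurable_state_xψ.comp hR').sub
      ((h.wcΨ.continuous_prox h.hγ h.hγψ).measurable.comp mX)
  have mv : Measurable fun ω => gradient (prob.envF p.γ) (X ω) :=
    h.continuous_gradient_envF.measurable.comp mX
  have key : ∀ (v : Ω → Vec dx), Measurable v →
      (∀ ω, ‖v ω‖ ^ 2 ≤ totalErr prob p.γ (R ω) (R' ω)) →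
      Integrable (fun ω => ‖v ω‖ ^ 2) P ∧
        ∫ ω, ‖v ω‖ ^ 2 ∂P ≤ min 1 ((p.γ ^ 2)⁻¹) * ε ^ 2 / 4 := by
    intro v hv hb
    have h1 : Integrable (fun ω => ‖v ω‖ ^ 2) P := by
      refine hi.mono' (hv.norm.pow_const 2).aestronglyMeasurable (Eventually.of_forall fun ω => ?_)
      rw [Real.norm_of_nonneg (by positivity)]
      exact hb ω
    exact ⟨h1, (integral_mono h1 hi hb).trans hle⟩
  have bφ : ∀ ω, ‖(R' ω).xφ - prox p.γ prob.Φ (X ω)‖ ^ 2 ≤ totalErr prob p.γ (R ω) (R' ω) := by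
    intro ω
    have : 0 ≤ errψ prob p.γ (R ω) (R' ω) := sq_nonneg _
    have : 0 ≤ gradSq prob p.γ (R ω) := sq_nonneg _
    change errφ prob p.γ (R ω) (R' ω) ≤ errφ prob p.γ (R ω) (R' ω) + errψ prob p.γ (R ω) (R' ω)
      + gradSq prob p.γ (R ω)
    linarith
  have bψ : ∀ ω, ‖(R' ω).xψ - prox p.γ prob.Ψ (X ω)‖ ^ 2 ≤ totalErr prob p.γ (R ω) (R' ω) := by
    intro ω
    have : 0 ≤ errφ prob p.γ (R ω) (R' ω) := sq_nonneg _
    have : 0 ≤ gradSq prob p.γ (R ω) := sq_nonneg _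
    change errψ prob p.γ (R ω) (R' ω) ≤ errφ prob p.γ (R ω) (R' ω) + errψ prob p.γ (R ω) (R' ω)
      + gradSq prob p.γ (R ω)
    linarith
  have bv : ∀ ω, ‖gradient (prob.envF p.γ) (X ω)‖ ^ 2 ≤ totalErr prob p.γ (R ω) (R' ω) := by
    intro ω
    have : 0 ≤ errφ prob p.γ (R ω) (R' ω) := sq_nonneg _
    have : 0 ≤ errψ prob p.γ (R ω) (R' ω) := sq_nonneg _
    change gradSq prob p.γ (R ω) ≤ errφ prob p.γ (R ω) (R' ω) + errψ prob p.γ (R ω) (R' ω)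
      + gradSq prob p.γ (R ω)
    linarith
  -- The two halves of the minimum: errors are at most `ε/2` in mean, and the gradient also at most
  -- `ε/(2γ)`.
  have hκ : min 1 ((p.γ ^ 2)⁻¹) * ε ^ 2 / 4 ≤ (ε / 2) ^ 2 := by
    have := mul_le_mul_of_nonneg_right (min_le_left 1 ((p.γ ^ 2)⁻¹)) (sq_nonneg ε)
    linarith
  have hκ' : min 1 ((p.γ ^ 2)⁻¹) * ε ^ 2 / 4 ≤ (ε / (2 * p.γ)) ^ 2 := by
    have := mul_le_mul_of_nonneg_right (min_le_right 1 ((p.γ ^ 2)⁻¹)) (sq_nonneg ε)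
    have e : (ε / (2 * p.γ)) ^ 2 = (p.γ ^ 2)⁻¹ * ε ^ 2 / 4 := by field_simp; norm_num
    rw [e]; linarith
  obtain ⟨i1, l1⟩ := key _ mφ bφ
  obtain ⟨i2, l2⟩ := key _ mψ bψ
  obtain ⟨i3, l3⟩ := key _ mv bv
  have hε2 : 0 < ε / 2 := by positivity
  obtain ⟨I1, L1⟩ := integral_norm_le_of_integral_sq_le hε2 mφ.aestronglyMeasurable i1 (l1.trans hκ)
  obtain ⟨I2, L2⟩ := integral_norm_le_of_integral_sq_le hε2 mψ.aestronglyMeasurable i2 (l2.trans hκ)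
  obtain ⟨I3, L3⟩ := integral_norm_le_of_integral_sq_le hε2 mv.aestronglyMeasurable i3 (l3.trans hκ)
  have L3' := (integral_norm_le_of_integral_sq_le (by positivity : 0 < ε / (2 * p.γ))
    mv.aestronglyMeasurable i3 (l3.trans hκ')).2
  -- Witnesses: `v = ∇F_γ(x)`, `x'` and `x''` the proximal points of `Φ` and `Ψ` at `x`; the
  -- multiples of `x` in the two residual subgradients cancel.
  have hv : ∀ᵐ ω ∂P, ∃ a ∈ subdifferential prob.Φ (prox p.γ prob.Φ (X ω)),
      ∃ b ∈ subdifferential prob.Ψ (prox p.γ prob.Ψ (X ω)),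
      gradient (prob.envF p.γ) (X ω) = a - b := by
    refine Eventually.of_forall fun ω => ⟨_, h.wcΦ.smul_sub_prox_mem_subdifferential h.hγ h.hγφ _,
      _, h.wcΨ.smul_sub_prox_mem_subdifferential h.hγ h.hγψ _, ?_⟩
    rw [h.gradient_envF]; module
  have hpp : ∀ x, prox p.γ prob.Ψ x - prox p.γ prob.Φ x
      = p.γ • gradient (prob.envF p.γ) x := by
    intro x
    rw [h.gradient_envF, smul_smul, mul_one_div_cancel hγ.ne', one_smul]
  -- To reach the other proximal point, add the gap `γ∇F_γ(x)`, of mean norm at most `ε/2`.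
  have e1 : ∀ ω, (R' ω).xφ - prox p.γ prob.Ψ (X ω)
      = ((R' ω).xφ - prox p.γ prob.Φ (X ω)) - p.γ • gradient (prob.envF p.γ) (X ω) := by
    intro ω; rw [← hpp]; abel
  have e2 : ∀ ω, (R' ω).xψ - prox p.γ prob.Φ (X ω)
      = ((R' ω).xψ - prox p.γ prob.Ψ (X ω)) + p.γ • gradient (prob.envF p.γ) (X ω) := by
    intro ω; rw [← hpp]; abel
  have I4 : Integrable (fun ω => (R' ω).xφ - prox p.γ prob.Ψ (X ω)) P := by
    simp_rw [e1]; exact I1.sub (I3.smul p.γ)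
  have I5 : Integrable (fun ω => (R' ω).xψ - prox p.γ prob.Φ (X ω)) P := by
    simp_rw [e2]; exact I2.add (I3.smul p.γ)
  have hγv : p.γ * ∫ ω, ‖gradient (prob.envF p.γ) (X ω)‖ ∂P ≤ ε / 2 := by
    have := mul_le_mul_of_nonneg_left L3' hγ.le
    refine this.trans (le_of_eq ?_)
    field_simp
  have L4 : ∫ ω, ‖(R' ω).xφ - prox p.γ prob.Ψ (X ω)‖ ∂P ≤ ε := by
    have h1 : ∫ ω, ‖(R' ω).xφ - prox p.γ prob.Ψ (X ω)‖ ∂P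
        ≤ ∫ ω, (‖(R' ω).xφ - prox p.γ prob.Φ (X ω)‖
          + p.γ * ‖gradient (prob.envF p.γ) (X ω)‖) ∂P := by
      refine integral_mono I4.norm (I1.norm.add (I3.norm.const_mul _)) fun ω => ?_
      have := norm_sub_le ((R' ω).xφ - prox p.γ prob.Φ (X ω))
        (p.γ • gradient (prob.envF p.γ) (X ω))
      rwa [← e1, norm_smul, Real.norm_of_nonneg hγ.le] at this
    rw [integral_add I1.norm (I3.norm.const_mul _), integral_const_mul] at h1
    linarith
  have L5 : ∫ ω, ‖(R' ω).xψ - prox p.γ prob.Φ (X ω)‖ ∂P ≤ ε := by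
    have h1 : ∫ ω, ‖(R' ω).xψ - prox p.γ prob.Φ (X ω)‖ ∂P
        ≤ ∫ ω, (‖(R' ω).xψ - prox p.γ prob.Ψ (X ω)‖
          + p.γ * ‖gradient (prob.envF p.γ) (X ω)‖) ∂P := by
      refine integral_mono I5.norm (I2.norm.add (I3.norm.const_mul _)) fun ω => ?_
      have := norm_add_le ((R' ω).xψ - prox p.γ prob.Ψ (X ω))
        (p.γ • gradient (prob.envF p.γ) (X ω))
      rwa [← e2, norm_smul, Real.norm_of_nonneg hγ.le] at this
    rw [integral_add I2.norm (I3.norm.const_mul _), integral_const_mul] at h1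
    linarith
  exact ⟨⟨_, _, _, hv, I3, I1, I4, max_le (by linarith) (max_le (by linarith) L4)⟩,
    ⟨_, _, _, hv, I3, I5, I2, max_le (by linarith) (max_le L5 (by linarith))⟩⟩

/-- A bound on the potentials at a deterministic state that is uniform in the accuracy. -/
theorem Regular.potφ_add_potψ_le (h : Regular prob p) (hε : 0 < ε) (S₀ : State dx dy dz) :
    potφ prob p (p.η₁ ε) p.α S₀ + potψ prob p (p.η₁ ε) p.α S₀
      ≤ ‖S₀.xφ - prox p.γ prob.Φ S₀.x‖ ^ 2
        + ‖S₀.y - argMax prob.φ prob.Y (prox p.γ prob.Φ S₀.x)‖ ^ 2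
        + ‖S₀.xψ - prox p.γ prob.Ψ S₀.x‖ ^ 2
        + ‖S₀.z - argMax prob.ψ prob.Z (prox p.γ prob.Ψ S₀.x)‖ ^ 2
        + 18 * (p.γ ^ 2 * (1 / p.γ - p.δφ) / 2) ^ 2 * p.M ^ 2 := by
  have hη := h.η₁_pos hε
  have hα := h.α_pos
  have hμφ := h.hφ.μ_pos
  have hμψ := h.hψ.μ_pos
  -- The `φ`-cap on `η₁` makes both noise terms independent of `ε`; `18 = 9 + 9`.
  have h1 : (p.η₁ ε) ^ 2 ≤ (p.γ ^ 2 * (1 / p.γ - p.δφ) / 2) ^ 2 :=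
    pow_le_pow_left₀ hη.le (η₁_le_φ p ε) 2
  have h2 := mul_le_mul_of_nonneg_right h1 (sq_nonneg p.M)
  have a1 : ∀ {c : ℝ} (r : ℝ), 0 < c → (1 - 2 * (p.η₁ ε * c)) * r ^ 2 ≤ r ^ 2 := by
    intro c r hc
    have : 0 ≤ p.η₁ ε * c * r ^ 2 := by positivity
    linarith
  have b1 := a1 ‖S₀.xφ - prox p.γ prob.Φ S₀.x‖ hα
  have b2 := a1 ‖S₀.y - argMax prob.φ prob.Y (prox p.γ prob.Φ S₀.x)‖ hμφ
  have b3 := a1 ‖S₀.xψ - prox p.γ prob.Ψ S₀.x‖ hα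
  have b4 := a1 ‖S₀.z - argMax prob.ψ prob.Z (prox p.γ prob.Ψ S₀.x)‖ hμψ
  unfold potφ potψ potential
  change (_ * ‖S₀.xφ - prox p.γ prob.Φ S₀.x‖ ^ 2
    + _ * ‖S₀.y - argMax prob.φ prob.Y (prox p.γ prob.Φ S₀.x)‖ ^ 2 + _)
    + (_ * ‖S₀.xψ - prox p.γ prob.Ψ S₀.x‖ ^ 2
    + _ * ‖S₀.z - argMax prob.ψ prob.Z (prox p.γ prob.Ψ S₀.x)‖ ^ 2 + _) ≤ _
  linarith

/-- Uniform bound on the optimality gap plus the initial potential. -/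
def gapBound (prob : DMax dx dy dz) (p : Params) (Fstar : ℝ) (S₀ : State dx dy dz) : ℝ :=
  prob.envF p.γ S₀.x - Fstar + 2 * p.τ / (p.γ ^ 2 * p.α) *
    (‖S₀.xφ - prox p.γ prob.Φ S₀.x‖ ^ 2
      + ‖S₀.y - argMax prob.φ prob.Y (prox p.γ prob.Φ S₀.x)‖ ^ 2
      + ‖S₀.xψ - prox p.γ prob.Ψ S₀.x‖ ^ 2
      + ‖S₀.z - argMax prob.ψ prob.Z (prox p.γ prob.Ψ S₀.x)‖ ^ 2
      + 18 * (p.γ ^ 2 * (1 / p.γ - p.δφ) / 2) ^ 2 * p.M ^ 2)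

theorem IsTrajectory.gap_le (hT : IsTrajectory prob p (p.η₀ ε) (p.η₁ ε) D g P ξ S₀ S)
    (h : Regular prob p) (hε : 0 < ε) (hF : ∀ x, Fstar ≤ prob.envF p.γ x) :
    prob.envF p.γ S₀.x - Fstar + initPotential prob p ε P S ≤ gapBound prob p Fstar S₀ := by
  have hγ := h.hγ
  have hα := h.α_pos
  have hτ := h.τ_pos
  have hη := h.η₁_pos hε
  -- As `η₀/η₁ = τ`, the weight of the initial potential does not depend on `ε`.
  have e : 2 * p.η₀ ε / (p.η₁ ε * p.γ ^ 2 * p.α) = 2 * p.τ / (p.γ ^ 2 * p.α) := by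
    unfold Params.η₀; field_simp
  rw [hT.initPotential_eq h hε hF, e, gapBound]
  have := mul_le_mul_of_nonneg_left
    ((hT.expDist_zero_le h (h.stepSizes hε)).trans (h.potφ_add_potψ_le hε S₀))
    (show 0 ≤ 2 * p.τ / (p.γ ^ 2 * p.α) by positivity)
  linarith

theorem Regular.iterBound_le (h : Regular prob p) (hε : 0 < ε) (hε1 : ε ≤ 1) {Δ Δ' : ℝ}
    (hΔ0 : 0 ≤ Δ') (hΔ : Δ ≤ Δ') :
    iterBound p ε Δ ≤ 16 * Δ' / (min 1 ((p.γ ^ 2)⁻¹) * min p.α p.τ * p.ν)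
      * (2 / (p.γ ^ 2 * (1 / p.γ - p.δφ)) + 2 / (p.γ ^ 2 * (1 / p.γ - p.δψ))
      + 2 * p.LF * p.τ + 1 / rate p) * (ε ^ 4)⁻¹ := by
  have hγ := h.hγ
  have hν := h.ν_pos
  have hm : 0 < min p.α p.τ := lt_min h.α_pos h.τ_pos
  have hκ : 0 < min 1 ((p.γ ^ 2)⁻¹) := lt_min one_pos (by positivity)
  have hη := h.η₁_pos hε
  rw [h.iterBound_eq hε]
  have h1 := h.one_div_η₁_le hε hε1
  generalize 2 / (p.γ ^ 2 * (1 / p.γ - p.δφ)) + 2 / (p.γ ^ 2 * (1 / p.γ - p.δψ))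
      + 2 * p.LF * p.τ + 1 / rate p = K at h1 ⊢
  have h2 : 16 * Δ / (min 1 ((p.γ ^ 2)⁻¹) * min p.α p.τ * p.ν * ε ^ 2)
      ≤ 16 * Δ' / (min 1 ((p.γ ^ 2)⁻¹) * min p.α p.τ * p.ν * ε ^ 2) := by gcongr
  have h3 := mul_le_mul h2 h1 (by positivity) (by positivity)
  refine h3.trans (le_of_eq ?_)
  field_simp

end Output

end SMAG

end

/-! ### The convergence theorem. -/

theorem theorem1 {dx dy dz : ℕ} (prob : SMAG.DMax dx dy dz) (p : SMAG.Params)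
    (hφ : SMAG.IsComponent prob.φ prob.Y p.δφ p.μφ p.Lφ)
    (hψ : SMAG.IsComponent prob.ψ prob.Z p.δψ p.μψ p.Lψ)
    (hM : 0 < p.M)
    -- `γ < 1 / δφ` and `γ < 1 / δψ`, read as no restriction when the modulus is `0`
    (hγ : 0 < p.γ) (hγφ : p.γ * p.δφ < 1) (hγψ : p.γ * p.δψ < 1)
    (Fstar : ℝ) (hF : ∀ x, Fstar ≤ prob.envF p.γ x)
    (S₀ : SMAG.State dx dy dz) (hy₀ : S₀.y ∈ prob.Y) (hz₀ : S₀.z ∈ prob.Z) :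
    Differentiable ℝ (prob.envF p.γ) ∧
    -- `C` depends only on the problem, the constants and the initial points
    ∃ C : ℝ, ∀ ε : ℝ, 0 < ε →
      p.η₁ ε ≤ C * ε ^ 2 ∧
      ∀ {Ξ : Type*} [MeasurableSpace Ξ] (D : Measure Ξ) [IsProbabilityMeasure D]
        (g : SMAG.Oracle dx dy dz Ξ)
        (_ : SMAG.IsOracle D prob.φ prob.Y p.M g.gxφ g.gyφ)
        (_ : SMAG.IsOracle D prob.ψ prob.Z p.M g.gxψ g.gzψ)
        {Ω : Type*} [MeasurableSpace Ω] (P : Measure Ω) [IsProbabilityMeasure P]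
        (ξ : ℕ → Ω → Ξ) (_ : ∀ t, Measurable (ξ t)) (_ : ∀ t, P.map (ξ t) = D)
        (_ : iIndepFun ξ P)
        (S : ℕ → Ω → SMAG.State dx dy dz)
        (_ : ∀ t ω, S t ω =
          SMAG.iter prob p.γ (p.η₀ ε) (p.η₁ ε) g S₀ (fun i => ξ i ω) t)
        (T₀ : ℝ)
        (_ : T₀ = SMAG.iterBound p ε
          (prob.envF p.γ S₀.x - Fstar + SMAG.initPotential prob p ε P S)),
        (ε ≤ 1 → T₀ ≤ C * (ε ^ 4)⁻¹) ∧
        ∀ T : ℕ, 1 ≤ T → T₀ ≤ T →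
          -- the averaged bound, all expectations being finite
          (∀ t, Integrable (fun ω => SMAG.errφ prob p.γ (S t ω) (S (t + 1) ω)) P ∧
            Integrable (fun ω => SMAG.errψ prob p.γ (S t ω) (S (t + 1) ω)) P ∧
            Integrable (fun ω => SMAG.gradSq prob p.γ (S t ω)) P) ∧
          1 / (T : ℝ) * ∑ t ∈ Finset.range T,
              ((∫ ω, SMAG.errφ prob p.γ (S t ω) (S (t + 1) ω) ∂P)
                + (∫ ω, SMAG.errψ prob p.γ (S t ω) (S (t + 1) ω) ∂P)
                + (∫ ω, SMAG.gradSq prob p.γ (S t ω) ∂P))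
            ≤ min 1 ((p.γ ^ 2)⁻¹) * ε ^ 2 / 4 ∧
          -- the randomly sampled output, with `tbar` uniform on `{1, …, T}`
          ∀ tbar : Ω → ℕ, Measurable tbar →
            (∀ k ∈ Finset.Icc 1 T, P.real {ω | tbar ω = k} = 1 / (T : ℝ)) →
            IndepFun tbar (fun ω t => ξ t ω) P →
            Integrable (fun ω =>
              SMAG.errφ prob p.γ (S (tbar ω - 1) ω) (S (tbar ω) ω)
                + SMAG.errψ prob p.γ (S (tbar ω - 1) ω) (S (tbar ω) ω)
                + SMAG.gradSq prob p.γ (S (tbar ω - 1) ω)) P ∧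
            ∫ ω, (SMAG.errφ prob p.γ (S (tbar ω - 1) ω) (S (tbar ω) ω)
                + SMAG.errψ prob p.γ (S (tbar ω - 1) ω) (S (tbar ω) ω)
                + SMAG.gradSq prob p.γ (S (tbar ω - 1) ω)) ∂P
              ≤ min 1 ((p.γ ^ 2)⁻¹) * ε ^ 2 / 4 ∧
            SMAG.NearlyCritical prob P ε (fun ω => (S (tbar ω) ω).xφ) ∧
            SMAG.NearlyCritical prob P ε (fun ω => (S (tbar ω) ω).xψ) := by
  have h : SMAG.Regular prob p := ⟨hφ, hψ, hM, hγ, hγφ, hγψ⟩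
  have hgap : 0 ≤ SMAG.gapBound prob p Fstar S₀ := by
    have := h.α_pos
    have := h.τ_pos
    have := hF S₀.x
    unfold SMAG.gapBound
    exact add_nonneg (by linarith) (by positivity)
  -- The first entry of the maximum serves the bound on `η₁`, the second the bound on `T₀`, where
  -- `gapBound` replaces the gap and initial potential uniformly in `ε`.
  refine ⟨h.differentiable_envF, max (SMAG.rate p)
    (16 * SMAG.gapBound prob p Fstar S₀ / (min 1 ((p.γ ^ 2)⁻¹) * min p.α p.τ * p.ν)
      * (2 / (p.γ ^ 2 * (1 / p.γ - p.δφ)) + 2 / (p.γ ^ 2 * (1 / p.γ - p.δψ))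
      + 2 * p.LF * p.τ + 1 / SMAG.rate p)), fun ε hε => ⟨?_, ?_⟩⟩
  · exact (SMAG.η₁_le_rate p ε).trans
      (mul_le_mul_of_nonneg_right (le_max_left _ _) (sq_nonneg ε))
  intro Ξ _ D _ g oφ oψ Ω _ P _ ξ hξ hlaw hind S hS T₀ hT₀
  have hT : SMAG.IsTrajectory prob p (p.η₀ ε) (p.η₁ ε) D g P ξ S₀ S :=
    ⟨oφ, oψ, hy₀, hz₀, hξ, hlaw, hind, hS⟩
  have hs := h.stepSizes hε
  have hzero : ∀ ω, S 0 ω = S₀ := hT.zero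
  subst hT₀
  refine ⟨fun hε1 => (h.iterBound_le hε hε1 hgap (hT.gap_le h hε hF)).trans
    (mul_le_mul_of_nonneg_right (le_max_right _ _) (by positivity)), fun T hT1 hTT => ?_⟩
  have havg := hT.sum_totalErr_le h hε hF hT1 hTT
  refine ⟨fun t => ⟨hT.integrable_errφ h hs hF t, hT.integrable_errψ h hs hF t,
    hT.integrable_gradSq h hs hF t⟩, havg, fun N hN hunif hNind => ?_⟩
  obtain ⟨hi, heq⟩ := hT.uniform_output h hs hF hT1 hN hunif hNind
  have hle := heq.le.trans havg
  -- Evaluation at a random time is measurable because the index set is countable.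
  have hmeas : ∀ {M : Ω → ℕ}, Measurable M → Measurable fun ω => S (M ω) ω := fun hM =>
    (measurable_from_prod_countable_right (f := fun q : ℕ × Ω => S q.1 q.2)
      (hT.measurable_state h)).comp (hM.prodMk measurable_id)
  exact ⟨hi, hle, h.nearlyCritical hε (hmeas ((measurable_from_nat (f := fun k => k - 1)).comp hN))
    (hmeas hN) hi hle⟩
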